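/- **Theorem 2 (Convergence rate for residual connection in aggregation).** Let $G=(V,E)$ be a finite undirected simple graph with $n=|V|\ge 1$, let $\mathcal N(u)$ be the set of neighbours of $u$, and let $\mathcal A=\mathcal A(G)\in\mathbb R^{n^2\times n^2}$ be the aggregation matrix indexed by $V\times V$, $$(\mathcal A K)(u,u')=\frac1{|\mathcal N(u)|+1}\,\frac1{|\mathcal N(u')|+1}\sum_{v\in\mathcal N(u)\cup\{u\}}\ \sum_{v'\in\mathcal N(u')\cup\{u'\}}K(v,v').$$ Assume that $\mathcal A$ is irreducible (it is then automatically aperiodic, its diagonal being positive). Let $0<\delta<1$ and $\tilde{\mathcal A}=(1-\delta)\mathcal A+\delta I$. Let $\phi$ be either the ReLU $\phi(x)=\max\{0,x\}$ (with $\phi'=1_{(0,\infty)}$) or $\phi=\tanh$, and let $\sigma_w,\sigma_b\in\mathbb R$ be on the edge of chaos: there is $q^*>0$ with $$\sigma_w^2\,\mathbb E[\phi(\sqrt{q^*}z)^2]+\sigma_b^2=q^*,\qquad \sigma_w^2\,\mathbb E[\phi'(\sqrt{q^*}z)^2]=1,\qquad z\sim\mathcal N(0,1)$$ (for ReLU this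 means $\sigma_w^2=2$, $\sigma_b=0$). Let $R\ge0$ be the number of MLP layers per propagation unit and let $h_u\in\mathbb R^d$ $(u\in V)$ be node features. Define the Gaussian process kernel $\Sigma^{(l)}_{(r)}$ and the graph neural tangent kernel $\Theta^{(l)}_{(r)}$ on $V\times V$, for $l\ge 0$ and $r\ge0$, by $\Theta^{(0)}_{(0)}(u,u')=\Sigma^{(0)}_{(0)}(u,u')=\langle h_u,h_{u'}\rangle$, $$\Sigma^{(l+1)}_{(0)}=\tilde{\mathcal A}\,\Sigma^{(l)}_{(R)},\qquad \Theta^{(l+1)}_{(0)}=\tilde{\mathcal A}\,\Theta^{(l)}_{(R)},$$ $$\Sigma^{(l)}_{(r)}(u,u')=\sigma_w^2\,\mathbb E[\phi(z_1)\phi(z_2)]+\sigma_b^2,\qquad \dot\Sigma^{(l)}_{(r)}(u,u')=\sigma_w^2\,\mathbb E[\phi'(z_1)\phi'(z_2)],$$ $$\Theta^{(l)}_{(r)}(u,u')=\Theta^{(l)}_{(r-1)}(u,u')\,\dot\Sigma^{(l)}_{(r)}(u,u')+\Sigma^{(l)}_{(r)}(u,u')\qquad(r\ge1),$$ where $(z_1,z_2)$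 is a centred Gaussian pair with covariance matrix $\begin{pmatrix}\Sigma^{(l)}_{(r-1)}(u,u)&\Sigma^{(l)}_{(r-1)}(u,u')\\ \Sigma^{(l)}_{(r-1)}(u',u)&\Sigma^{(l)}_{(r-1)}(u',u')\end{pmatrix}$. Then: 1. $\tilde{\mathcal A}$ is a (row-)stochastic matrix and has exactly one stationary distribution $\tilde\pi\in\mathbb R^{n^2}$, i.e. one probability vector with $\tilde\pi^T\tilde{\mathcal A}=\tilde\pi^T$. 2. There are constants $0<\tilde\alpha<1$ and $C>0$, a vector $\vec v\in\mathbb R^{n^2}$ and, for each $0\le r\le R$, a vector $\vec v'=\vec v'_r\in\mathbb R^{n^2}$, such that for all $0\le r\le R$, $l\ge0$ and $u,u'\in V$ $$\bigl|\Theta^{(l)}_{(r)}(u,u')-\tilde\pi^T\bigl(Rl\,\vec v+\vec v'\bigr)\bigr|\le C\,\tilde\alpha^{\,l}.$$ 3. If $n\ge2$, then all eigenvalues of $\mathcal A$ and of $\tilde{\mathcal A}$ are real and their second largest eigenvalues $\lambda_2$, $\tilde\lambda_2$ (eigenvalues counted with multiplicity, in non-increasing order) satisfy $$\tilde\lambda_2=(1-\delta)\lambda_2+\delta,\qquad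 \lambda_2<\tilde\lambda_2<1.$$ -/

import Mathlib

open MeasureTheory ProbabilityTheory Matrix

namespace GNTK

noncomputable section

/-- The ReLU activation `x ↦ max {0, x}`. Its `deriv` is the indicator of `(0, ∞)`. -/
def relu (x : ℝ) : ℝ := max 0 x

/-- The pair `(σ_w, σ_b)` is on the edge of chaos for `φ`: for a positive fixed point `q` of the
variance map `q ↦ σ_w² 𝔼[φ(√q z)²] + σ_b²`, `z ∼ N(0,1)`, one has `σ_w² 𝔼[φ'(√q z)²] = 1`. -/
def IsEdgeOfChaos (φ : ℝ → ℝ) (σw σb : ℝ) : Prop :=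
  ∃ q : ℝ, 0 < q ∧
    σw ^ 2 * ∫ z, φ (√q * z) ^ 2 ∂(gaussianReal 0 1) + σb ^ 2 = q ∧
    σw ^ 2 * ∫ z, deriv φ (√q * z) ^ 2 ∂(gaussianReal 0 1) = 1

section Graph

variable {V : Type*} [Fintype V] [DecidableEq V]

/-- The neighbourhood averaging matrix: row `u` is uniform on `N(u) ∪ {u}`. -/
def averagingMatrix (G : SimpleGraph V) [DecidableRel G.Adj] : Matrix V V ℝ :=
  of fun u v => if v ∈ insert u (G.neighborFinset u) then 1 / ((G.degree u : ℝ) + 1) else 0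

/-- The aggregation matrix `𝒜(G)` acting on vectorized kernels (functions on `V × V`):
`(𝒜 Θ)(u,u') = 1/(|N(u)|+1) · 1/(|N(u')|+1) · ∑_{v ∈ N(u) ∪ u} ∑_{v' ∈ N(u') ∪ u'} Θ(v,v')`. -/
def aggregation (G : SimpleGraph V) [DecidableRel G.Adj] : Matrix (V × V) (V × V) ℝ :=
  kroneckerMap (· * ·) (averagingMatrix G) (averagingMatrix G)

/-- The aggregation matrix with residual connection, `(1 - δ) 𝒜(G) + δ I`. -/
def residualAggregation (G : SimpleGraph V) [DecidableRel G.Adj] (δ : ℝ) :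
    Matrix (V × V) (V × V) ℝ :=
  (1 - δ) • aggregation G + δ • (1 : Matrix (V × V) (V × V) ℝ)

end Graph

/-- `𝔼[ψ(z₁) ψ(z₂)]` for a centred Gaussian pair `(z₁, z₂)` with covariance matrix
`[[K(u,u), K(u,u')], [K(u',u), K(u',u')]]`. -/
def gaussianPairing {V : Type*} (ψ : ℝ → ℝ) (K : V × V → ℝ) (u u' : V) : ℝ :=
  ∫ z : EuclideanSpace ℝ (Fin 2), ψ (z 0) * ψ (z 1)
    ∂(multivariateGaussian 0 !![K (u, u), K (u, u'); K (u', u), K (u', u')])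

section Kernels

variable {V : Type*} [Fintype V]

/-- The Gaussian process kernel `Σ^{(l)}_{(r)}` (arguments `l`, then `r`) of the infinitely wide
network with `R` MLP layers per propagation unit, aggregation matrix `A` and input features `h`:
`Σ^{(0)}_{(0)}` is the Gram kernel of the features, `Σ^{(l)}_{(0)} = A Σ^{(l-1)}_{(R)}`, and
`Σ^{(l)}_{(r)}(u,u') = σ_w² 𝔼[φ(z₁) φ(z₂)] + σ_b²` with covariance from `Σ^{(l)}_{(r-1)}`. -/
def gpk (A : Matrix (V × V) (V × V) ℝ) (φ : ℝ → ℝ) (σw σb : ℝ) (R : ℕ) {d : ℕ}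
    (h : V → EuclideanSpace ℝ (Fin d)) : ℕ → ℕ → V × V → ℝ
  | 0, 0 => fun p => inner ℝ (h p.1) (h p.2)
  | l + 1, 0 => A *ᵥ gpk A φ σw σb R h l R
  | l, r + 1 => fun p =>
      σw ^ 2 * gaussianPairing φ (gpk A φ σw σb R h l r) p.1 p.2 + σb ^ 2
termination_by l r => (l, r)

/-- The derivative kernel `Σ̇^{(l)}_{(r+1)}(u,u') = σ_w² 𝔼[φ'(z₁) φ'(z₂)]` with covariance from
`Σ^{(l)}_{(r)}`. -/
def gpkDeriv (A : Matrix (V × V) (V × V) ℝ) (φ : ℝ → ℝ) (σw σb : ℝ) (R : ℕ) {d : ℕ}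
    (h : V → EuclideanSpace ℝ (Fin d)) (l r : ℕ) (p : V × V) : ℝ :=
  σw ^ 2 * gaussianPairing (deriv φ) (gpk A φ σw σb R h l r) p.1 p.2

/-- The graph neural tangent kernel `Θ^{(l)}_{(r)}`: `Θ^{(0)}_{(0)} = Σ^{(0)}_{(0)}`,
`Θ^{(l)}_{(0)} = A Θ^{(l-1)}_{(R)}` and
`Θ^{(l)}_{(r)} = Θ^{(l)}_{(r-1)} Σ̇^{(l)}_{(r)} + Σ^{(l)}_{(r)}` entrywise. -/
def gntk (A : Matrix (V × V) (V × V) ℝ) (φ : ℝ → ℝ) (σw σb : ℝ) (R : ℕ) {d : ℕ}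
    (h : V → EuclideanSpace ℝ (Fin d)) : ℕ → ℕ → V × V → ℝ
  | 0, 0 => gpk A φ σw σb R h 0 0
  | l + 1, 0 => A *ᵥ gntk A φ σw σb R h l R
  | l, r + 1 => fun p =>
      gntk A φ σw σb R h l r p * gpkDeriv A φ σw σb R h l r p + gpk A φ σw σb R h l (r + 1) p
termination_by l r => (l, r)

end Kernels

section Spectrum

variable {ι : Type*} [Fintype ι]

/-- `π` is a probability vector with `πᵀ M = πᵀ`. -/
def IsStationaryDistribution (M : Matrix ι ι ℝ) (π : ι → ℝ) : Prop :=
  (∀ i, 0 ≤ π i) ∧ ∑ i, π i = 1 ∧ π ᵥ* M = π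

/-- All eigenvalues of `M` are real and, listed with multiplicity in non-increasing order
`λ₁ ≥ λ₂ ≥ ⋯`, the second one is `μ`. -/
def IsSecondLargestEigenvalue [DecidableEq ι] (M : Matrix ι ι ℝ) (μ : ℝ) : Prop :=
  ∃ ev : Fin (Fintype.card ι) → ℝ, Antitone ev ∧
    M.charpoly = ∏ i, (Polynomial.X - Polynomial.C (ev i)) ∧
    ∃ h : 1 < Fintype.card ι, ev ⟨1, h⟩ = μ

end Spectrum

end

end GNTK

/-!
Aggregation is an averaging operator: its matrix is stochastic, and a power of it is entrywise
positive, so by Doeblin's argument its iterates flatten every kernel at an exponential rate. It is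
also reversible, which gives the stationary distribution and, through a similar symmetric matrix,
the real spectrum.

On the edge of chaos the Gaussian process kernel converges exponentially fast to a constant `q > 0`
(for ReLU, unless all features vanish), so that the multiplier `Σ̇` converges to `1` and the tangent
kernel is an exponentially small perturbation of the recursion which adds `q` in each MLP layer and
averages in between; this produces the drift `R l q`. Why the Gaussian process kernel converges
depends on the activation.

* For ReLU a layer keeps variances and increases covariances. Hence the kernel dominates the
  iterates of the aggregation matrix while its maximum, attained on the diagonal, does not increase.
* For `tanh` the bias is nonzero. A layer contracts variances towards `q`, and by Price's theorem it
  does not push nonnegative covariances away from `q`; aggregation spreads the contraction from the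
  diagonal to all entries. Covariances are eventually nonnegative, because each layer adds the
  positive constant kernel `σ_b²`.
-/

namespace GNTK

open Filter Asymptotics Topology

section Decay

variable {E F : Type*} [NormedAddCommGroup E] [NormedAddCommGroup F]

/-- Exponential decay of a sequence at an unspecified rate: the form in which all error terms of
the kernel recursions are tracked. -/
def DecaysExponentially (f : ℕ → E) : Prop :=
  ∃ α ∈ Set.Ioo (0 : ℝ) 1, f =O[atTop] fun l : ℕ => α ^ l

/-- Growth slower than every exponential; a product with an exponentially decaying sequence still
decays exponentially. -/
def IsSubexponential (f : ℕ → E) : Prop :=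
  ∀ b : ℝ, 1 < b → f =O[atTop] fun l : ℕ => b ^ l

theorem isBigO_pow_of_le {α β : ℝ} (hα : 0 ≤ α) (h : α ≤ β) :
    (fun l : ℕ => α ^ l) =O[atTop] fun l : ℕ => β ^ l :=
  IsBigO.of_bound 1 <| .of_forall fun l => by
    rw [one_mul, Real.norm_of_nonneg (pow_nonneg hα l),
      Real.norm_of_nonneg (pow_nonneg (hα.trans h) l)]
    gcongr

namespace DecaysExponentially

variable {f g : ℕ → E}

theorem of_isBigO {f : ℕ → E} {g : ℕ → F} (hg : DecaysExponentially g) (h : f =O[atTop] g) :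
    DecaysExponentially f :=
  let ⟨α, hα, hgα⟩ := hg
  ⟨α, hα, h.trans hgα⟩

theorem of_norm_le {f : ℕ → E} {g : ℕ → ℝ} (hg : DecaysExponentially g)
    (h : ∀ᶠ l in atTop, ‖f l‖ ≤ g l) : DecaysExponentially f :=
  hg.of_isBigO (IsBigO.of_norm_eventuallyLE h)

theorem exists_forall_le (hf : DecaysExponentially f) :
    ∃ α C : ℝ, 0 < α ∧ α < 1 ∧ 0 < C ∧ ∀ l, ‖f l‖ ≤ C * α ^ l := by
  obtain ⟨α, ⟨hα0, hα1⟩, h⟩ := hf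
  obtain ⟨C, hC, hb⟩ := bound_of_isBigO_nat_atTop h
  refine ⟨α, C, hα0, hα1, hC, fun l => ?_⟩
  simpa [abs_of_pos hα0] using hb (pow_pos hα0 l).ne'

theorem of_forall_le {α C : ℝ} (hα0 : 0 < α) (hα1 : α < 1) (h : ∀ l, ‖f l‖ ≤ C * α ^ l) :
    DecaysExponentially f :=
  ⟨α, ⟨hα0, hα1⟩, IsBigO.of_bound C <| .of_forall fun l => by
    simpa only [Real.norm_of_nonneg (pow_pos hα0 l).le] using h l⟩

theorem pow {β : ℝ} (hβ0 : 0 ≤ β) (hβ1 : β < 1) : DecaysExponentially fun l : ℕ => β ^ l :=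
  ⟨(β + 1) / 2, ⟨by linarith, by linarith⟩, isBigO_pow_of_le hβ0 (by linarith)⟩

theorem zero : DecaysExponentially fun _ : ℕ => (0 : E) :=
  ⟨1 / 2, by norm_num, isBigO_zero _ _⟩

theorem add (hf : DecaysExponentially f) (hg : DecaysExponentially g) :
    DecaysExponentially fun l => f l + g l := by
  obtain ⟨α, hα, hfα⟩ := hf
  obtain ⟨β, hβ, hgβ⟩ := hg
  exact ⟨max α β, ⟨lt_max_of_lt_left hα.1, max_lt hα.2 hβ.2⟩,
    (hfα.trans (isBigO_pow_of_le hα.1.le (le_max_left _ _))).add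
      (hgβ.trans (isBigO_pow_of_le hβ.1.le (le_max_right _ _)))⟩

theorem neg (hf : DecaysExponentially f) : DecaysExponentially fun l => -f l :=
  hf.of_isBigO (isBigO_refl f _).neg_left

theorem sub (hf : DecaysExponentially f) (hg : DecaysExponentially g) :
    DecaysExponentially fun l => f l - g l := by
  simpa only [sub_eq_add_neg] using hf.add hg.neg

theorem norm (hf : DecaysExponentially f) : DecaysExponentially fun l => ‖f l‖ :=
  hf.of_isBigO (isBigO_refl f _).norm_left

theorem const_mul {f : ℕ → ℝ} (c : ℝ) (hf : DecaysExponentially f) :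
    DecaysExponentially fun l => c * f l :=
  hf.of_isBigO (isBigO_const_mul_self c f _)

theorem sum {ι : Type*} {s : Finset ι} {f : ι → ℕ → E} (hf : ∀ i ∈ s, DecaysExponentially (f i)) :
    DecaysExponentially fun l => ∑ i ∈ s, f i l := by
  classical
  induction s using Finset.induction_on with
  | empty => simpa only [Finset.sum_empty] using zero
  | insert i s hi ih =>
    simp only [Finset.sum_insert hi]
    exact (hf i (Finset.mem_insert_self i s)).add
      (ih fun j hj => hf j (Finset.mem_insert_of_mem hj))

theorem comp_add_nat (hf : DecaysExponentially f) (k : ℕ) :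
    DecaysExponentially fun l => f (l + k) := by
  obtain ⟨α, C, hα0, hα1, -, h⟩ := hf.exists_forall_le
  refine of_forall_le (C := C * α ^ k) hα0 hα1 fun l => (h _).trans_eq ?_
  rw [pow_add]
  ring

theorem of_comp_add_nat {k : ℕ} (hf : DecaysExponentially fun l => f (l + k)) :
    DecaysExponentially f := by
  obtain ⟨α, C, hα0, hα1, -, h⟩ := hf.exists_forall_le
  refine ⟨α, ⟨hα0, hα1⟩, IsBigO.of_bound (C * (α ^ k)⁻¹) ?_⟩
  filter_upwards [eventually_ge_atTop k] with l hl
  obtain ⟨m, rfl⟩ := Nat.exists_eq_add_of_le' hl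
  rw [Real.norm_of_nonneg (by positivity), mul_assoc, pow_add, mul_comm (α ^ m),
    inv_mul_cancel_left₀ (pow_pos hα0 k).ne']
  exact h m

theorem tendsto_zero (hf : DecaysExponentially f) : Tendsto f atTop (𝓝 0) := by
  obtain ⟨α, hα, h⟩ := hf
  exact h.trans_tendsto (tendsto_pow_atTop_nhds_zero_of_lt_one hα.1.le hα.2)

theorem sqrt {f : ℕ → ℝ} (hf : DecaysExponentially f) : DecaysExponentially fun l => √(f l) := by
  obtain ⟨α, C, hα0, hα1, hC, h⟩ := hf.exists_forall_le
  refine of_forall_le (C := √C) (Real.sqrt_pos.2 hα0)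
    ((Real.sqrt_lt' one_pos).2 (by simpa using hα1)) fun l => ?_
  have hpow : √α ^ l = √(α ^ l) := by
    rw [← Real.sqrt_sq (by positivity : 0 ≤ √α ^ l), ← pow_mul, mul_comm, pow_mul,
      Real.sq_sqrt hα0.le]
  rw [Real.norm_of_nonneg (Real.sqrt_nonneg _), hpow, ← Real.sqrt_mul hC.le]
  exact Real.sqrt_le_sqrt ((le_abs_self _).trans (h l))

theorem mul_isSubexponential {f g : ℕ → ℝ} (hf : DecaysExponentially f) (hg : IsSubexponential g) :
    DecaysExponentially fun l => f l * g l := by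
  obtain ⟨α, hα, h⟩ := hf
  have hs : √α < 1 := (Real.sqrt_lt' one_pos).2 (by simpa using hα.2)
  have hs0 : 0 < √α := Real.sqrt_pos.2 hα.1
  refine ⟨√α, ⟨hs0, hs⟩, (h.mul (hg (√α)⁻¹ ((one_lt_inv₀ hs0).2 hs))).congr_right fun l => ?_⟩
  rw [← mul_pow]
  congr 1
  field_simp
  rw [Real.sq_sqrt hα.1.le]

end DecaysExponentially

theorem isSubexponential_of_forall_le {f : ℕ → ℝ} (hf0 : ∀ l, 0 ≤ f l)
    (hf : ∀ b : ℝ, 1 < b → ∃ B, 0 ≤ B ∧ ∀ᶠ l in atTop, f (l + 1) ≤ b * f l + B) :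
    IsSubexponential f := by
  intro b hb
  have hb0 : 0 < b := one_pos.trans hb
  obtain ⟨B, hB, h⟩ := hf b hb
  obtain ⟨L, hL⟩ := eventually_atTop.1 h
  set K := B / (b - 1)
  have hK : 0 ≤ K := div_nonneg hB (sub_nonneg.2 hb.le)
  have hKB : B + K = b * K := by
    have := div_mul_cancel₀ B (sub_pos.2 hb).ne'
    linarith
  refine IsBigO.of_bound ((f L + K) / b ^ L) (eventually_atTop.2 ⟨L, fun l hl => ?_⟩)
  obtain ⟨m, rfl⟩ := Nat.exists_eq_add_of_le' hl
  have hgeom := le_geom (u := fun k => f (k + L) + K) hb0.le m fun k _ => by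
    have := hL (k + L) (Nat.le_add_left _ _)
    rw [add_right_comm k 1 L]
    linarith
  rw [zero_add] at hgeom
  rw [Real.norm_of_nonneg (hf0 _), Real.norm_of_nonneg (by positivity), pow_add]
  calc f (m + L) ≤ b ^ m * (f L + K) := by linarith
    _ = (f L + K) / b ^ L * (b ^ m * b ^ L) := by field_simp

theorem decaysExponentially_pi_iff {ι : Type*} [Fintype ι] {f : ℕ → ι → ℝ} :
    DecaysExponentially f ↔ ∀ i, DecaysExponentially fun l => f l i := by
  refine ⟨fun ⟨α, hα, h⟩ i => ⟨α, hα, isBigO_pi.1 h i⟩, fun h => ?_⟩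
  refine (DecaysExponentially.sum fun i (_ : i ∈ Finset.univ) => (h i).norm).of_norm_le
    (.of_forall fun l => ?_)
  refine (pi_norm_le_iff_of_nonneg (Finset.sum_nonneg fun _ _ => norm_nonneg _)).2 fun i => ?_
  exact Finset.single_le_sum (f := fun i => ‖f l i‖) (fun _ _ => norm_nonneg _) (Finset.mem_univ i)

theorem exists_decaysExponentially_sub_of_increments [CompleteSpace E] {f : ℕ → E}
    (h : DecaysExponentially fun l => f (l + 1) - f l) :
    ∃ L, DecaysExponentially fun l => f l - L := by
  obtain ⟨α, C, hα0, hα1, -, hC⟩ := h.exists_forall_le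
  have hdist : ∀ l, dist (f l) (f (l + 1)) ≤ C * α ^ l := fun l => by
    rw [dist_comm, dist_eq_norm]
    exact hC l
  obtain ⟨L, hL⟩ := cauchySeq_tendsto_of_complete (cauchySeq_of_le_geometric α C hα1 hdist)
  refine ⟨L, .of_forall_le (C := C / (1 - α)) hα0 hα1 fun l => ?_⟩
  rw [← dist_eq_norm, div_mul_eq_mul_div]
  exact dist_le_of_le_geometric_of_tendsto α C hα1 hdist hL l

theorem exists_lt_pow_of_lt_one {β : ℝ} (hβ : β < 1) (k : ℕ) :
    ∃ α ∈ Set.Ioo (0 : ℝ) 1, β < α ^ k := by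
  have hlim : Tendsto (fun a : ℝ => a ^ k) (𝓝[<] 1) (𝓝 1) := by
    simpa using ((continuous_pow k).tendsto (1 : ℝ)).mono_left nhdsWithin_le_nhds
  obtain ⟨α, hα, h⟩ := ((hlim.eventually (lt_mem_nhds hβ)).and (Ioo_mem_nhdsLT one_pos)).exists
  exact ⟨α, h, hα⟩

theorem decaysExponentially_of_window_contraction {f e : ℕ → ℝ} {k : ℕ} (hk : 0 < k) {β : ℝ}
    (hβ0 : 0 ≤ β) (hβ1 : β < 1) (hf0 : ∀ l, 0 ≤ f l) (he : DecaysExponentially e)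
    (hf : ∀ l, f (l + k) ≤ β * f l + e l) : DecaysExponentially f := by
  obtain ⟨α₀, C₀, hα₀, hα₀1, hC₀, hle⟩ := he.exists_forall_le
  obtain ⟨α₁, ⟨hα₁, hα₁1⟩, hβα₁⟩ := exists_lt_pow_of_lt_one hβ1 k
  set α := max α₀ α₁
  have hα : 0 < α := lt_max_of_lt_left hα₀
  have hgap : 0 < α ^ k - β :=
    sub_pos.2 (hβα₁.trans_le (pow_le_pow_left₀ hα₁.le (le_max_right _ _) k))
  set S := ∑ l ∈ Finset.range k, f l / α ^ l
  have hterm : ∀ l, 0 ≤ f l / α ^ l := fun l => div_nonneg (hf0 l) (by positivity)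
  have hS : 0 ≤ S := Finset.sum_nonneg fun l _ => hterm l
  set C := C₀ / (α ^ k - β) + S
  refine .of_forall_le (C := C) hα (max_lt hα₀1 hα₁1) fun l => ?_
  rw [Real.norm_of_nonneg (hf0 l)]
  induction l using Nat.strong_induction_on with
  | _ l ih =>
    rcases lt_or_ge l k with hl | hl
    · rw [← div_le_iff₀ (by positivity)]
      exact (Finset.single_le_sum (f := fun l => f l / α ^ l) (fun l _ => hterm l)
        (Finset.mem_range.2 hl)).trans (le_add_of_nonneg_left (by positivity))
    · obtain ⟨m, rfl⟩ := Nat.exists_eq_add_of_le' hl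
      have hC₀C : C₀ ≤ C * (α ^ k - β) :=
        (div_le_iff₀ hgap).1 (le_add_of_nonneg_right hS)
      calc f (m + k) ≤ β * f m + C₀ * α₀ ^ m := by
            linarith [hf m, (le_abs_self (e m)).trans (hle m)]
        _ ≤ β * (C * α ^ m) + C * (α ^ k - β) * α ^ m := by
            gcongr
            exacts [ih m (by omega), le_max_left _ _]
        _ = C * α ^ (m + k) := by ring

end Decay

section Stochastic

variable {ι : Type*} [Fintype ι]

theorem mulVec_mono {M : Matrix ι ι ℝ} (hM : ∀ i j, 0 ≤ M i j) {x y : ι → ℝ} (h : x ≤ y) :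
    M *ᵥ x ≤ M *ᵥ y := fun i =>
  Finset.sum_le_sum fun j _ => mul_le_mul_of_nonneg_left (h j) (hM i j)

section Oscillation

/-- The oscillation `max x - min x` of a vector, the seminorm contracted by mixing matrices. -/
def oscillation (x : ι → ℝ) : ℝ :=
  ‖fun p : ι × ι => x p.1 - x p.2‖

theorem oscillation_nonneg (x : ι → ℝ) : 0 ≤ oscillation x :=
  norm_nonneg _

theorem oscillation_le_iff {x : ι → ℝ} {r : ℝ} (hr : 0 ≤ r) :
    oscillation x ≤ r ↔ ∀ i j, |x i - x j| ≤ r :=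
  (pi_norm_le_iff_of_nonneg hr).trans Prod.forall

theorem abs_sub_le_oscillation (x : ι → ℝ) (i j : ι) : |x i - x j| ≤ oscillation x :=
  (oscillation_le_iff (oscillation_nonneg x)).1 le_rfl i j

theorem oscillation_smul (a : ℝ) (x : ι → ℝ) : oscillation (a • x) = |a| * oscillation x := by
  rw [oscillation, oscillation, ← Real.norm_eq_abs, ← norm_smul]
  congr 1
  ext p
  exact (mul_sub _ _ _).symm

theorem oscillation_le_add_two_mul_norm_sub (x y : ι → ℝ) :
    oscillation x ≤ oscillation y + 2 * ‖x - y‖ := by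
  refine (oscillation_le_iff (by positivity [oscillation_nonneg y])).2 fun i j => ?_
  have hi := abs_le.1 (norm_le_pi_norm (x - y) i)
  have hj := abs_le.1 (norm_le_pi_norm (x - y) j)
  have hij := abs_le.1 (abs_sub_le_oscillation y i j)
  simp only [Pi.sub_apply] at hi hj
  rw [abs_le]
  constructor <;> linarith

theorem norm_sub_const_le (x : ι → ℝ) (i : ι) (c : ℝ) :
    ‖x - fun _ => c‖ ≤ oscillation x + |x i - c| := by
  refine (pi_norm_le_iff_of_nonneg (by positivity [oscillation_nonneg x])).2 fun j => ?_
  exact (abs_sub_le _ (x i) _).trans (add_le_add_left (abs_sub_le_oscillation x j i) _)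

end Oscillation

section RowStochastic

variable [DecidableEq ι] {M : Matrix ι ι ℝ}

theorem mulVec_const (hM : M ∈ rowStochastic ℝ ι) (c : ℝ) : M *ᵥ (fun _ => c) = fun _ => c := by
  funext i
  simp only [mulVec, dotProduct, ← Finset.sum_mul, sum_row_of_mem_rowStochastic hM i, one_mul]

theorem mulVec_le_const (hM : M ∈ rowStochastic ℝ ι) {x : ι → ℝ} {c : ℝ} (h : ∀ i, x i ≤ c)
    (i : ι) : (M *ᵥ x) i ≤ c :=
  (mulVec_mono hM.1 (y := fun _ => c) h i).trans_eq
    (congrFun (mulVec_const hM c) i)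

theorem const_le_mulVec (hM : M ∈ rowStochastic ℝ ι) {x : ι → ℝ} {c : ℝ} (h : ∀ i, c ≤ x i)
    (i : ι) : c ≤ (M *ᵥ x) i :=
  (congrFun (mulVec_const hM c) i).ge.trans
    (mulVec_mono hM.1 (x := fun _ => c) h i)

theorem norm_mulVec_le (hM : M ∈ rowStochastic ℝ ι) (x : ι → ℝ) : ‖M *ᵥ x‖ ≤ ‖x‖ := by
  refine (pi_norm_le_iff_of_nonneg (norm_nonneg _)).2 fun i => abs_le.2 ?_
  have h j := abs_le.1 (norm_le_pi_norm x j)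
  exact ⟨const_le_mulVec hM (fun j => (h j).1) i, mulVec_le_const hM (fun j => (h j).2) i⟩

theorem norm_mulVec_sub_le_oscillation (hM : M ∈ rowStochastic ℝ ι) (x : ι → ℝ) :
    ‖M *ᵥ x - x‖ ≤ oscillation x := by
  refine (pi_norm_le_iff_of_nonneg (oscillation_nonneg x)).2 fun i => abs_le.2 ?_
  have h j := abs_le.1 (abs_sub_le_oscillation x j i)
  rw [Pi.sub_apply, neg_le_sub_iff_le_add, sub_le_iff_le_add]
  refine ⟨?_, mulVec_le_const hM (fun j => by linarith [(h j).2]) i⟩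
  rw [← sub_le_iff_le_add]
  exact const_le_mulVec hM (fun j => by linarith [(h j).1]) i

theorem card_mul_le_one [Nonempty ι] (hM : M ∈ rowStochastic ℝ ι) {c : ℝ}
    (hc : ∀ i j, c ≤ M i j) : Fintype.card ι * c ≤ 1 := by
  obtain ⟨i⟩ := ‹Nonempty ι›
  rw [← sum_row_of_mem_rowStochastic hM i, ← nsmul_eq_mul]
  exact Finset.card_nsmul_le_sum _ _ _ fun j _ => hc i j

/-- Doeblin's argument: all rows share the mass `c` of every state, and averaging the shared mass
produces no oscillation. -/
theorem oscillation_mulVec_le (hM : M ∈ rowStochastic ℝ ι) {c : ℝ} (hc : ∀ i j, c ≤ M i j)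
    (x : ι → ℝ) : oscillation (M *ᵥ x) ≤ (1 - Fintype.card ι * c) * oscillation x := by
  cases isEmpty_or_nonempty ι
  · simp only [oscillation, norm_of_subsingleton, mul_zero, le_refl]
  have hmass (i : ι) : ∑ j, (M i j - c) = 1 - Fintype.card ι * c := by
    simp [Finset.sum_sub_distrib, sum_row_of_mem_rowStochastic hM i]
  have hsplit (i : ι) : (M *ᵥ x) i = c * ∑ j, x j + ∑ j, (M i j - c) * x j := by
    simp [mulVec, dotProduct, sub_mul, Finset.sum_sub_distrib, Finset.mul_sum]
  obtain ⟨a, -, ha⟩ := Finset.exists_min_image Finset.univ x Finset.univ_nonempty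
  have hx (j : ι) : x j ≤ x a + oscillation x := by
    linarith [(abs_le.1 (abs_sub_le_oscillation x j a)).2]
  have hlow (i : ι) : (1 - Fintype.card ι * c) * x a ≤ ∑ j, (M i j - c) * x j := by
    rw [← hmass i, Finset.sum_mul]
    exact Finset.sum_le_sum fun j _ =>
      mul_le_mul_of_nonneg_left (ha j (Finset.mem_univ j)) (sub_nonneg.2 (hc i j))
  have hupp (i : ι) : ∑ j, (M i j - c) * x j ≤
      (1 - Fintype.card ι * c) * (x a + oscillation x) := by
    rw [← hmass i, Finset.sum_mul]
    exact Finset.sum_le_sum fun j _ => mul_le_mul_of_nonneg_left (hx j) (sub_nonneg.2 (hc i j))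
  refine (oscillation_le_iff (mul_nonneg (sub_nonneg.2 (card_mul_le_one hM hc))
    (oscillation_nonneg x))).2 fun i j => ?_
  rw [hsplit, hsplit, add_sub_add_left_eq_sub, abs_le]
  constructor <;> linarith [hlow i, hlow j, hupp i, hupp j]

end RowStochastic

section Primitive

variable [DecidableEq ι] {M : Matrix ι ι ℝ}

theorem pow_mulVec_succ (M : Matrix ι ι ℝ) (l : ℕ) (x : ι → ℝ) :
    M ^ (l + 1) *ᵥ x = M *ᵥ (M ^ l *ᵥ x) := by
  rw [pow_succ', mulVec_mulVec]

theorem pow_mulVec_le_of_mulVec_le (hM : ∀ i j, 0 ≤ M i j) {x : ℕ → ι → ℝ}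
    (hx : ∀ l, M *ᵥ x l ≤ x (l + 1)) (l : ℕ) : M ^ l *ᵥ x 0 ≤ x l := by
  induction l with
  | zero => simp
  | succ l ih =>
    rw [pow_mulVec_succ]
    exact (mulVec_mono hM ih).trans (hx l)

theorem pow_apply_nonneg (hM : ∀ i j, 0 ≤ M i j) (k : ℕ) (i j : ι) : 0 ≤ (M ^ k) i j := by
  induction k generalizing i j with
  | zero =>
    rw [pow_zero, one_apply]
    split_ifs <;> norm_num
  | succ k ih =>
    rw [pow_succ, mul_apply]
    exact Finset.sum_nonneg fun a _ => mul_nonneg (ih i a) (hM a j)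

theorem pow_apply_pos_of_le (hM : ∀ i j, 0 ≤ M i j) (hdiag : ∀ i, 0 < M i i) {k n : ℕ}
    (hkn : k ≤ n) {i j : ι} (hk : 0 < (M ^ k) i j) : 0 < (M ^ n) i j := by
  induction n, hkn using Nat.le_induction with
  | base => exact hk
  | succ n _ ih =>
    rw [pow_succ, mul_apply]
    exact (mul_pos ih (hdiag j)).trans_le
      (Finset.single_le_sum (f := fun a => (M ^ n) i a * M a j)
        (fun a _ => mul_nonneg (pow_apply_nonneg hM n i a) (hM a j)) (Finset.mem_univ j))

theorem isPrimitive_of_isIrreducible (hM : M.IsIrreducible) (hdiag : ∀ i, 0 < M i i) :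
    M.IsPrimitive := by
  choose k _ hk using (isIrreducible_iff_exists_pow_pos hM.nonneg).1 hM
  refine ⟨hM.nonneg, (∑ p : ι × ι, k p.1 p.2) + 1, Nat.succ_pos _, fun i j => ?_⟩
  exact pow_apply_pos_of_le hM.nonneg hdiag ((Finset.single_le_sum (f := fun p : ι × ι => k p.1 p.2)
    (fun _ _ => Nat.zero_le _) (Finset.mem_univ (i, j))).trans (Nat.le_succ _)) (hk i j)

theorem exists_pow_lower_bound (hM : M.IsPrimitive) : ∃ k > 0, ∃ c > 0, ∀ i j, c ≤ (M ^ k) i j := by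
  obtain ⟨k, hk, h⟩ := hM.exists_pos_pow
  cases isEmpty_or_nonempty ι
  · exact ⟨k, hk, 1, one_pos, fun i => isEmptyElim i⟩
  obtain ⟨p, -, hp⟩ := Finset.exists_min_image (Finset.univ : Finset (ι × ι))
    (fun p => (M ^ k) p.1 p.2) Finset.univ_nonempty
  exact ⟨k, hk, _, h p.1 p.2, fun i j => hp (i, j) (Finset.mem_univ _)⟩

variable [Nonempty ι]

theorem exists_oscillation_pow_mulVec_le (hM : M ∈ rowStochastic ℝ ι) (hprim : M.IsPrimitive) :
    ∃ k > 0, ∃ β ∈ Set.Ico (0 : ℝ) 1, ∀ x, oscillation (M ^ k *ᵥ x) ≤ β * oscillation x := by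
  obtain ⟨k, hk, c, hc0, hc⟩ := exists_pow_lower_bound hprim
  have hcard : (0 : ℝ) < Fintype.card ι := Nat.cast_pos.2 Fintype.card_pos
  exact ⟨k, hk, _, ⟨sub_nonneg.2 (card_mul_le_one (pow_mem hM k) hc),
    sub_lt_self _ (mul_pos hcard hc0)⟩, oscillation_mulVec_le (pow_mem hM k) hc⟩

theorem eq_of_mulVec_eq_smul (hM : M ∈ rowStochastic ℝ ι) (hprim : M.IsPrimitive) {x : ι → ℝ}
    {μ : ℝ} (hμ : 1 ≤ μ) (hx : M *ᵥ x = μ • x) (i j : ι) : x i = x j := by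
  obtain ⟨k, -, β, hβ, hcontr⟩ := exists_oscillation_pow_mulVec_le hM hprim
  have hpow : M ^ k *ᵥ x = μ ^ k • x := by
    clear hcontr
    induction k with
    | zero => simp only [pow_zero, one_mulVec, one_smul]
    | succ k ih => rw [pow_mulVec_succ, ih, mulVec_smul, hx, smul_smul, ← pow_succ]
  have hle := hcontr x
  rw [hpow, oscillation_smul, abs_of_nonneg (by positivity)] at hle
  have hosc : oscillation x = 0 := by
    nlinarith [oscillation_nonneg x, one_le_pow₀ hμ (n := k), hβ.2]
  have habs := abs_sub_le_oscillation x i j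
  rw [hosc] at habs
  exact sub_eq_zero.1 (abs_nonpos_iff.1 habs)

end Primitive

section PerturbedIteration

variable [DecidableEq ι] {M : Matrix ι ι ℝ} {x : ℕ → ι → ℝ}

theorem decaysExponentially_sub_pow_mulVec (hM : M ∈ rowStochastic ℝ ι)
    (hx : DecaysExponentially fun l => x (l + 1) - M *ᵥ x l) (k : ℕ) :
    DecaysExponentially fun l => x (l + k) - M ^ k *ᵥ x l := by
  induction k with
  | zero => simpa only [add_zero, pow_zero, one_mulVec, sub_self] using DecaysExponentially.zero
  | succ k ih =>
    have hMih : DecaysExponentially fun l => M *ᵥ (x (l + k) - M ^ k *ᵥ x l) :=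
      ih.norm.of_norm_le (.of_forall fun l => norm_mulVec_le hM _)
    convert (hx.comp_add_nat k).add hMih using 2 with l
    rw [mulVec_sub, ← pow_mulVec_succ, sub_add_sub_cancel, add_assoc]

theorem exists_decaysExponentially_sub_const [Nonempty ι] (hM : M ∈ rowStochastic ℝ ι)
    (hprim : M.IsPrimitive) (hx : DecaysExponentially fun l => x (l + 1) - M *ᵥ x l) :
    ∃ c : ℝ, DecaysExponentially fun l => x l - fun _ => c := by
  obtain ⟨k, hk, β, hβ, hcontr⟩ := exists_oscillation_pow_mulVec_le hM hprim
  have hosc : DecaysExponentially fun l => oscillation (x l) :=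
    decaysExponentially_of_window_contraction hk hβ.1 hβ.2 (fun l => oscillation_nonneg _)
      ((decaysExponentially_sub_pow_mulVec hM hx k).norm.const_mul 2) fun l =>
        (oscillation_le_add_two_mul_norm_sub _ _).trans (add_le_add_left (hcontr (x l)) _)
  have hincr : DecaysExponentially fun l => x (l + 1) - x l :=
    (hx.norm.add hosc).of_norm_le <| .of_forall fun l => by
      rw [← sub_add_sub_cancel _ (M *ᵥ x l)]
      exact (norm_add_le _ _).trans (add_le_add_right (norm_mulVec_sub_le_oscillation hM _) _)
  obtain ⟨i⟩ := ‹Nonempty ι›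
  obtain ⟨c, hc⟩ := exists_decaysExponentially_sub_of_increments (f := fun l => x l i)
    (decaysExponentially_pi_iff.1 hincr i)
  exact ⟨c, (hosc.add hc.norm).of_norm_le (.of_forall fun l => norm_sub_const_le (x l) i c)⟩

end PerturbedIteration

section Stationary

variable {M : Matrix ι ι ℝ} {π : ι → ℝ}

theorem IsStationaryDistribution.dotProduct_const (hπ : IsStationaryDistribution M π) (c : ℝ) :
    π ⬝ᵥ (fun _ => c) = c := by
  rw [dotProduct, ← Finset.sum_mul, hπ.2.1, one_mul]

variable [DecidableEq ι]

theorem IsStationaryDistribution.dotProduct_pow_mulVec (hπ : IsStationaryDistribution M π) (l : ℕ)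
    (x : ι → ℝ) : π ⬝ᵥ (M ^ l *ᵥ x) = π ⬝ᵥ x := by
  induction l with
  | zero => rw [pow_zero, one_mulVec]
  | succ l ih => rw [pow_mulVec_succ, dotProduct_mulVec, hπ.2.2, ih]

theorem exists_forall_dotProduct_eq [Nonempty ι] (hM : M ∈ rowStochastic ℝ ι)
    (hprim : M.IsPrimitive) (x : ι → ℝ) :
    ∃ c, ∀ π, IsStationaryDistribution M π → π ⬝ᵥ x = c := by
  obtain ⟨c, hc⟩ := exists_decaysExponentially_sub_const (x := fun l => M ^ l *ᵥ x) hM hprim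
    (by simpa only [pow_mulVec_succ, sub_self] using DecaysExponentially.zero)
  have hlim : Tendsto (fun l => M ^ l *ᵥ x) atTop (𝓝 fun _ => c) :=
    tendsto_sub_nhds_zero_iff.1 hc.tendsto_zero
  refine ⟨c, fun π hπ => ?_⟩
  have hdot : Continuous fun y : ι → ℝ => π ⬝ᵥ y := continuous_const.dotProduct continuous_id
  have hlimπ := (hdot.tendsto fun _ => c).comp hlim
  simp only [Function.comp_def, hπ.dotProduct_pow_mulVec, hπ.dotProduct_const] at hlimπ
  exact tendsto_nhds_unique tendsto_const_nhds hlimπ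

theorem IsStationaryDistribution.unique [Nonempty ι] (hM : M ∈ rowStochastic ℝ ι)
    (hprim : M.IsPrimitive) {ρ : ι → ℝ} (hπ : IsStationaryDistribution M π)
    (hρ : IsStationaryDistribution M ρ) : π = ρ :=
  dotProduct_eq _ _ fun x =>
    let ⟨_, hc⟩ := exists_forall_dotProduct_eq hM hprim x
    (hc π hπ).trans (hc ρ hρ).symm

theorem isStationaryDistribution_of_detailedBalance (hM : M ∈ rowStochastic ℝ ι) {w : ι → ℝ}
    (hw : ∀ i, 0 ≤ w i) (hsum : 0 < ∑ i, w i) (hbal : ∀ i j, w i * M i j = w j * M j i) :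
    IsStationaryDistribution M fun i => w i / ∑ j, w j := by
  refine ⟨fun i => div_nonneg (hw i) hsum.le, ?_, funext fun j => ?_⟩
  · rw [← Finset.sum_div, div_self hsum.ne']
  · simp only [vecMul, dotProduct, div_mul_eq_mul_div, hbal _ j]
    rw [← Finset.sum_div, ← Finset.mul_sum, sum_row_of_mem_rowStochastic hM j, mul_one]

end Stationary

section DampedIteration

variable [DecidableEq ι] {M : Matrix ι ι ℝ}

theorem mulVec_le_of_apply_le (hM : M ∈ rowStochastic ℝ ι) {c : ℝ} (hc : ∀ i j, c ≤ M i j)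
    {z : ι → ℝ} {m θ : ℝ} (hm : 0 ≤ m) (hθ : θ ≤ 1) (hz : ∀ i, z i ≤ m) {i₀ : ι}
    (hz₀ : z i₀ ≤ θ * m) (i : ι) : (M *ᵥ z) i ≤ (1 - (1 - θ) * c) * m := by
  have hle : z ≤ (fun _ => m) - ((1 - θ) * m) • Pi.single i₀ 1 := fun j => by
    rcases eq_or_ne j i₀ with rfl | hj
    · simpa using by linarith
    · simpa [hj] using hz j
  refine (mulVec_mono hM.1 hle i).trans ?_
  rw [mulVec_sub, mulVec_const hM, mulVec_smul, mulVec_single_one]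
  simp only [Pi.sub_apply, Pi.smul_apply, smul_eq_mul, col_apply]
  linarith [mul_le_mul_of_nonneg_left (hc i i₀) (mul_nonneg (sub_nonneg.2 hθ) hm)]

variable {y z : ℕ → ι → ℝ} {e : ℕ → ℝ}

theorem exists_le_pow_mulVec_add (hM : M ∈ rowStochastic ℝ ι) (hzy : ∀ l, z l ≤ y l)
    (he : DecaysExponentially e) (hy : ∀ l i, y (l + 1) i ≤ (M *ᵥ z l) i + e l) (k : ℕ) :
    ∃ E, DecaysExponentially E ∧
      ∀ l i, y (l + (k + 1)) i ≤ (M ^ (k + 1) *ᵥ z l) i + E l := by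
  induction k with
  | zero => exact ⟨e, he, by simpa only [zero_add, pow_one] using hy⟩
  | succ k ih =>
    obtain ⟨E, hE, hyE⟩ := ih
    refine ⟨fun l => E l + e (l + (k + 1)), hE.add (he.comp_add_nat _), fun l i => ?_⟩
    have hzE : z (l + (k + 1)) ≤ M ^ (k + 1) *ᵥ z l + fun _ => E l :=
      (hzy _).trans fun i => hyE l i
    have hMz := mulVec_mono hM.1 hzE i
    rw [mulVec_add, mulVec_const hM, ← pow_mulVec_succ, Pi.add_apply] at hMz
    exact (hy (l + (k + 1)) i).trans (by linarith)

/-- Sub-iterates `y` whose largest entry is damped at some state at each step: mixing spreads the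
damping to all states. -/
theorem decaysExponentially_of_damped_iteration (hM : M ∈ rowStochastic ℝ ι)
    (hprim : M.IsPrimitive) {θ : ℝ} (hθ0 : 0 ≤ θ) (hθ1 : θ < 1) (hy0 : ∀ l i, 0 ≤ y l i)
    (hzy : ∀ l, z l ≤ y l) (hz : ∀ l, ∃ i, z l i ≤ θ * ‖y l‖) (he : DecaysExponentially e)
    (hy : ∀ l i, y (l + 1) i ≤ (M *ᵥ z l) i + e l) : DecaysExponentially y := by
  obtain ⟨k, hk, c, hc0, hc⟩ := exists_pow_lower_bound hprim
  obtain ⟨i₀, -⟩ := hz 0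
  have hc1 : c ≤ 1 := (hc i₀ i₀).trans (le_one_of_mem_rowStochastic (pow_mem hM k))
  have hβ0 : 0 ≤ 1 - (1 - θ) * c := by nlinarith
  obtain ⟨E, hE, hyE⟩ := exists_le_pow_mulVec_add hM hzy he hy (k - 1)
  rw [Nat.sub_add_cancel hk] at hyE
  refine (decaysExponentially_of_window_contraction (f := fun l => ‖y l‖) hk hβ0
    (sub_lt_self _ (mul_pos (sub_pos.2 hθ1) hc0)) (fun l => norm_nonneg _) hE.norm
      fun l => ?_).of_norm_le (.of_forall fun l => le_rfl)
  obtain ⟨i₁, hi₁⟩ := hz l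
  refine (pi_norm_le_iff_of_nonneg (by positivity)).2 fun i => ?_
  rw [Real.norm_of_nonneg (hy0 _ i)]
  have hzl (j : ι) : z l j ≤ ‖y l‖ := 
    (hzy l j).trans ((le_abs_self _).trans (norm_le_pi_norm (y l) j))
  exact (hyE l i).trans (add_le_add (mulVec_le_of_apply_le (pow_mem hM k) hc (norm_nonneg _) hθ1.le
    hzl hi₁ i) (le_abs_self _))

end DampedIteration

section MonotoneIteration

variable [DecidableEq ι] [Nonempty ι] {M : Matrix ι ι ℝ}

/-- Super-iterates whose upper bounds persist converge: the gap to the maximum is a sub-iterate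
that vanishes somewhere. -/
theorem exists_decaysExponentially_of_monotone_iteration (hM : M ∈ rowStochastic ℝ ι)
    (hprim : M.IsPrimitive) {x : ℕ → ι → ℝ} (hlow : ∀ l, M *ᵥ x l ≤ x (l + 1))
    (hup : ∀ l b, (∀ i, x l i ≤ b) → ∀ i, x (l + 1) i ≤ b) :
    ∃ q : ℝ, (∀ l m, (∀ i, m ≤ x l i) → m ≤ q) ∧ DecaysExponentially fun l => x l - fun _ => q := by
  choose imax himax using fun l => Finite.exists_max (x l)
  set s : ℕ → ℝ := fun l => x l (imax l)
  set y : ℕ → ι → ℝ := fun l => (fun _ => s l) - x l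
  have hs (l : ℕ) : s (l + 1) ≤ s l := hup l _ (himax l) _
  have hMy (l : ℕ) (i : ι) : y (l + 1) i ≤ (M *ᵥ y l) i + 0 := by
    simp only [y, mulVec_sub, mulVec_const hM, Pi.sub_apply]
    linarith [hs l, hlow l i]
  have hy : DecaysExponentially y :=
    decaysExponentially_of_damped_iteration hM hprim le_rfl one_pos
      (fun l i => sub_nonneg.2 (himax l i)) (fun l => le_rfl)
      (fun l => ⟨imax l, by simp only [y, s, Pi.sub_apply, sub_self, zero_mul, le_refl]⟩) .zero hMy
  have hincr : DecaysExponentially fun l => s (l + 1) - s l := by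
    refine hy.norm.of_norm_le (.of_forall fun l => abs_le.2 ⟨?_, ?_⟩)
    · have hx : s l - ‖y l‖ ≤ (M *ᵥ x l) (imax l) := const_le_mulVec hM (fun i => by
        linarith [show s l - x l i ≤ ‖y l‖ from (le_abs_self _).trans (norm_le_pi_norm (y l) i)]) _
      linarith [hlow l (imax l), himax (l + 1) (imax l)]
    · linarith [hs l, norm_nonneg (y l)]
  obtain ⟨q, hq⟩ := exists_decaysExponentially_sub_of_increments hincr
  have hxq : DecaysExponentially fun l => x l - fun _ => q := by
    convert (decaysExponentially_pi_iff.2 fun _ : ι => hq).sub hy using 2 with l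
    ext i
    simp [y]
  refine ⟨q, fun l m hm => ?_, hxq⟩
  have hpersist (k : ℕ) : ∀ i, m ≤ x (l + k) i := by
    induction k with
    | zero => exact hm
    | succ k ih => exact fun i => (const_le_mulVec hM ih i).trans (hlow _ i)
  obtain ⟨i⟩ := ‹Nonempty ι›
  have hlim : Tendsto (fun l => x l i) atTop (𝓝 q) :=
    tendsto_sub_nhds_zero_iff.1 (decaysExponentially_pi_iff.1 hxq i).tendsto_zero
  refine ge_of_tendsto hlim ((eventually_ge_atTop l).mono fun n hn => ?_)
  obtain ⟨k, rfl⟩ := Nat.exists_eq_add_of_le hn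
  exact hpersist k i

end MonotoneIteration

end Stochastic

section Spectrum

variable {ι : Type*} [Fintype ι] [DecidableEq ι]

theorem charpoly_smul_add_smul_one {κ : Type*} [Fintype κ] {M : Matrix ι ι ℝ} {ev : κ → ℝ}
    (hM : M.charpoly = ∏ i, (Polynomial.X - Polynomial.C (ev i)))
    (hκ : Fintype.card κ = Fintype.card ι) {a : ℝ} (ha : a ≠ 0) (b : ℝ) :
    (a • M + b • (1 : Matrix ι ι ℝ)).charpoly =
      ∏ i, (Polynomial.X - Polynomial.C (a * ev i + b)) := by
  refine Polynomial.funext fun t => ?_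
  have hscale : scalar ι t - (a • M + b • (1 : Matrix ι ι ℝ)) =
      a • (scalar ι ((t - b) / a) - M) := by
    rw [smul_sub, ← sub_sub, sub_right_comm]
    congr 1
    simp only [scalar_apply, ← smul_one_eq_diagonal, smul_smul, ← sub_smul]
    rw [mul_div_cancel₀ _ ha]
  rw [eval_charpoly, hscale, det_smul, ← eval_charpoly, hM, Polynomial.eval_prod,
    Polynomial.eval_prod, ← hκ, ← Finset.card_univ, ← Finset.prod_const, ← Finset.prod_mul_distrib]
  refine Finset.prod_congr rfl fun i _ => ?_
  simp only [Polynomial.eval_sub, Polynomial.eval_X, Polynomial.eval_C]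
  field_simp
  ring

theorem IsSecondLargestEigenvalue.smul_add_smul_one {M : Matrix ι ι ℝ} {μ : ℝ}
    (hμ : IsSecondLargestEigenvalue M μ) {a : ℝ} (ha : 0 < a) (b : ℝ) :
    IsSecondLargestEigenvalue (a • M + b • (1 : Matrix ι ι ℝ)) (a * μ + b) := by
  obtain ⟨ev, hanti, hchar, hcard, rfl⟩ := hμ
  refine ⟨fun i => a * ev i + b, fun i j hij => ?_,
    charpoly_smul_add_smul_one hchar (Fintype.card_fin _) ha.ne' b, hcard, rfl⟩
  have hev := hanti hij
  dsimp only
  gcongr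

theorem isSecondLargestEigenvalue_eigenvalues₀ {B : Matrix ι ι ℝ} (hB : B.IsHermitian)
    (hcard : 1 < Fintype.card ι) :
    IsSecondLargestEigenvalue B (hB.eigenvalues₀ ⟨1, hcard⟩) :=
  ⟨hB.eigenvalues₀, hB.eigenvalues₀_antitone, hB.charpoly_eq.trans
    (Fintype.prod_equiv (Fintype.equivOfCardEq (Fintype.card_fin _)).symm _ _ fun _ => rfl),
    hcard, rfl⟩

theorem eigenvalues₀_one_lt {B : Matrix ι ι ℝ} (hB : B.IsHermitian) {c : ℝ} {s : ι → ℝ}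
    (hs : ∀ μ v, c ≤ μ → B *ᵥ v = μ • v → ∃ a : ℝ, v = a • s) (hcard : 1 < Fintype.card ι) :
    hB.eigenvalues₀ ⟨1, hcard⟩ < c := by
  by_contra! hge
  set e : Fin (Fintype.card ι) ≃ ι := Fintype.equivOfCardEq (Fintype.card_fin _)
  have hev (k : Fin (Fintype.card ι)) : hB.eigenvalues (e k) = hB.eigenvalues₀ k := by
    simp only [Matrix.IsHermitian.eigenvalues, e, Equiv.symm_apply_apply]
  have hspan (k : Fin (Fintype.card ι)) (hk : k ≤ ⟨1, hcard⟩) :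
      ∃ a : ℝ, ⇑(hB.eigenvectorBasis (e k)) = a • s :=
    hs _ _ ((hge.trans (hB.eigenvalues₀_antitone hk)).trans_eq (hev k).symm)
      (hB.mulVec_eigenvectorBasis (e k))
  obtain ⟨a₀, h₀⟩ := hspan ⟨0, by omega⟩ (by simp)
  obtain ⟨a₁, h₁⟩ := hspan ⟨1, hcard⟩ le_rfl
  have hne : e ⟨0, by omega⟩ ≠ e ⟨1, hcard⟩ := by simp
  have hli := (LinearIndepOn.pair_iff _ hne).1
    (hB.eigenvectorBasis.orthonormal.linearIndependent.linearIndepOn {_, _})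
  have hzero (k : Fin (Fintype.card ι)) (h : ⇑(hB.eigenvectorBasis (e k)) = (0 : ℝ) • s) : False :=
    hB.eigenvectorBasis.orthonormal.ne_zero (e k) (by ext i; simpa using congrFun h i)
  have ha₁ : a₁ = 0 := (hli a₁ (-a₀) (by
    ext i
    simp only [PiLp.add_apply, PiLp.smul_apply, h₀, h₁, Pi.smul_apply, smul_eq_mul, PiLp.zero_apply]
    ring)).1
  exact hzero _ (ha₁ ▸ h₁)

section DiagonalConjugation

variable {s : ι → ℝ} (M : Matrix ι ι ℝ)

theorem diagonal_inv_mul_diagonal (hs : ∀ i, s i ≠ 0) :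
    diagonal (fun i => (s i)⁻¹) * diagonal s = 1 := by
  rw [diagonal_mul_diagonal, ← diagonal_one]
  congr 1
  funext i
  exact inv_mul_cancel₀ (hs i)

theorem charpoly_diagonal_conj (hs : ∀ i, s i ≠ 0) :
    (diagonal s * M * diagonal fun i => (s i)⁻¹).charpoly = M.charpoly := by
  rw [charpoly_mul_comm, ← mul_assoc, diagonal_inv_mul_diagonal hs, one_mul]

variable {M}

theorem isHermitian_diagonal_conj (hs : ∀ i, s i ≠ 0)
    (hrev : ∀ i j, s i ^ 2 * M i j = s j ^ 2 * M j i) :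
    (diagonal s * M * diagonal fun i => (s i)⁻¹).IsHermitian := by
  ext i j
  rw [conjTranspose_apply, star_trivial, mul_diagonal, mul_diagonal, diagonal_mul, diagonal_mul,
    ← div_eq_mul_inv, ← div_eq_mul_inv, div_eq_div_iff (hs i) (hs j)]
  linarith [hrev i j]

theorem mulVec_diagonal_inv_mulVec (hs : ∀ i, s i ≠ 0) {v : ι → ℝ} {μ : ℝ}
    (hv : (diagonal s * M * diagonal fun i => (s i)⁻¹) *ᵥ v = μ • v) :
    M *ᵥ (diagonal (fun i => (s i)⁻¹) *ᵥ v) = μ • (diagonal (fun i => (s i)⁻¹) *ᵥ v) := by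
  rw [← mulVec_smul, ← hv, mulVec_mulVec, mulVec_mulVec, mul_assoc, ← mul_assoc,
    diagonal_inv_mul_diagonal hs, one_mul]

end DiagonalConjugation

/-- Reversibility makes `M` similar to a symmetric matrix, whose eigenvectors for eigenvalues `≥ 1`
are all proportional to `√w`; two orthogonal ones cannot be. -/
theorem exists_isSecondLargestEigenvalue_lt_one {M : Matrix ι ι ℝ} (hM : M ∈ rowStochastic ℝ ι)
    (hprim : M.IsPrimitive) {w : ι → ℝ} (hw : ∀ i, 0 < w i)
    (hrev : ∀ i j, w i * M i j = w j * M j i) (hcard : 1 < Fintype.card ι) :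
    ∃ μ < 1, IsSecondLargestEigenvalue M μ := by
  have : Nonempty ι := Fintype.card_pos_iff.1 (one_pos.trans hcard)
  have hs (i : ι) : √(w i) ≠ 0 := (Real.sqrt_pos.2 (hw i)).ne'
  set B : Matrix ι ι ℝ := diagonal (fun i => √(w i)) * M * diagonal fun i => (√(w i))⁻¹
  have hB : B.IsHermitian := isHermitian_diagonal_conj hs fun i j => by
    rw [Real.sq_sqrt (hw i).le, Real.sq_sqrt (hw j).le, hrev]
  have hspan (μ : ℝ) (v : ι → ℝ) (hμ : 1 ≤ μ) (hv : B *ᵥ v = μ • v) :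
      ∃ a : ℝ, v = a • fun i => √(w i) := by
    have hconst := eq_of_mulVec_eq_smul hM hprim hμ (mulVec_diagonal_inv_mulVec hs hv)
    simp only [mulVec_diagonal] at hconst
    obtain ⟨i₀⟩ := this
    refine ⟨(√(w i₀))⁻¹ * v i₀, funext fun i => ?_⟩
    rw [Pi.smul_apply, smul_eq_mul, ← hconst i i₀, mul_right_comm, inv_mul_cancel₀ (hs i), one_mul]
  refine ⟨_, eigenvalues₀_one_lt hB hspan hcard, ?_⟩
  obtain ⟨ev, hanti, hchar, hev⟩ := isSecondLargestEigenvalue_eigenvalues₀ hB hcard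
  exact ⟨ev, hanti, (charpoly_diagonal_conj M hs).symm.trans hchar, hev⟩

end Spectrum

section Aggregation

variable {V : Type*} [Fintype V] [DecidableEq V] (G : SimpleGraph V) [DecidableRel G.Adj]

theorem averagingMatrix_apply (u v : V) : averagingMatrix G u v =
    if v ∈ insert u (G.neighborFinset u) then 1 / ((G.degree u : ℝ) + 1) else 0 := rfl

theorem mem_insert_neighborFinset_comm (u v : V) :
    v ∈ insert u (G.neighborFinset u) ↔ u ∈ insert v (G.neighborFinset v) := by
  simp only [Finset.mem_insert, SimpleGraph.mem_neighborFinset, eq_comm, G.adj_comm]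

theorem card_insert_neighborFinset (u : V) :
    (insert u (G.neighborFinset u)).card = G.degree u + 1 := by
  rw [Finset.card_insert_of_notMem (G.notMem_neighborFinset_self u),
    G.card_neighborFinset_eq_degree]

theorem averagingMatrix_mem_rowStochastic : averagingMatrix G ∈ rowStochastic ℝ V := by
  refine mem_rowStochastic_iff_sum.2 ⟨fun u v => ?_, fun u => ?_⟩
  · rw [averagingMatrix_apply]
    split_ifs <;> positivity
  · simp only [averagingMatrix_apply]
    rw [Finset.sum_ite_mem, Finset.univ_inter, Finset.sum_const, nsmul_eq_mul,
      card_insert_neighborFinset, Nat.cast_succ, mul_one_div_cancel (by positivity)]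

theorem averagingMatrix_detailedBalance (u v : V) :
    ((G.degree u : ℝ) + 1) * averagingMatrix G u v =
      ((G.degree v : ℝ) + 1) * averagingMatrix G v u := by
  rw [averagingMatrix_apply, averagingMatrix_apply,
    if_congr (mem_insert_neighborFinset_comm G u v) rfl rfl]
  split_ifs
  · rw [mul_one_div_cancel (by positivity), mul_one_div_cancel (by positivity)]
  · rw [mul_zero, mul_zero]

theorem aggregation_apply (p q : V × V) :
    aggregation G p q = averagingMatrix G p.1 q.1 * averagingMatrix G p.2 q.2 := rfl

theorem aggregation_mem_rowStochastic : aggregation G ∈ rowStochastic ℝ (V × V) := by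
  have hP := averagingMatrix_mem_rowStochastic G
  refine mem_rowStochastic_iff_sum.2 ⟨fun p q => mul_nonneg (hP.1 _ _) (hP.1 _ _), fun p => ?_⟩
  simp only [aggregation_apply]
  rw [Fintype.sum_prod_type, ← Finset.sum_mul_sum, sum_row_of_mem_rowStochastic hP,
    sum_row_of_mem_rowStochastic hP, one_mul]

theorem aggregation_detailedBalance (p q : V × V) :
    ((G.degree p.1 : ℝ) + 1) * ((G.degree p.2 : ℝ) + 1) * aggregation G p q =
      ((G.degree q.1 : ℝ) + 1) * ((G.degree q.2 : ℝ) + 1) * aggregation G q p := by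
  rw [aggregation_apply, aggregation_apply, mul_mul_mul_comm, averagingMatrix_detailedBalance,
    averagingMatrix_detailedBalance G p.2, mul_mul_mul_comm]

theorem aggregation_diag_pos (p : V × V) : 0 < aggregation G p p := by
  have hself (u : V) : 0 < averagingMatrix G u u := by
    rw [averagingMatrix_apply, if_pos (Finset.mem_insert_self _ _)]
    positivity
  exact mul_pos (hself _) (hself _)

variable {G} {δ : ℝ}

theorem residualAggregation_mem_rowStochastic (hδ0 : 0 ≤ δ) (hδ1 : δ ≤ 1) :
    residualAggregation G δ ∈ rowStochastic ℝ (V × V) :=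
  convex_rowStochastic (aggregation_mem_rowStochastic G) (one_mem _) (sub_nonneg.2 hδ1) hδ0
    (sub_add_cancel _ _)

theorem residualAggregation_mulVec (x : V × V → ℝ) :
    residualAggregation G δ *ᵥ x = (1 - δ) • (aggregation G *ᵥ x) + δ • x := by
  rw [residualAggregation, add_mulVec, smul_mulVec, smul_mulVec, one_mulVec]

theorem residualAggregation_apply (p q : V × V) : residualAggregation G δ p q =
    (1 - δ) * aggregation G p q + δ * (1 : Matrix (V × V) (V × V) ℝ) p q := rfl

theorem pow_mul_pow_aggregation_le (hδ0 : 0 ≤ δ) (hδ1 : δ ≤ 1) (k : ℕ) (p q : V × V) :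
    (1 - δ) ^ k * (aggregation G ^ k) p q ≤ (residualAggregation G δ ^ k) p q := by
  have hA := (aggregation_mem_rowStochastic G).1
  have hle (p q : V × V) : (1 - δ) * aggregation G p q ≤ residualAggregation G δ p q :=
    le_add_of_nonneg_right (mul_nonneg hδ0 ((one_mem (rowStochastic ℝ (V × V))).1 p q))
  induction k generalizing p q with
  | zero => simp only [pow_zero, one_mul, le_refl]
  | succ k ih =>
    rw [pow_succ, pow_succ, pow_succ, mul_apply, mul_apply, Finset.mul_sum]
    refine Finset.sum_le_sum fun r _ => ?_
    rw [mul_mul_mul_comm]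
    exact mul_le_mul (ih p r) (hle r q) (mul_nonneg (sub_nonneg.2 hδ1) (hA r q))
      ((pow_mem (residualAggregation_mem_rowStochastic hδ0 hδ1) k).1 p r)

theorem residualAggregation_isPrimitive (hirr : (aggregation G).IsIrreducible) (hδ0 : 0 ≤ δ)
    (hδ1 : δ < 1) : (residualAggregation G δ).IsPrimitive := by
  obtain ⟨k, hk, hpos⟩ :=
    (isPrimitive_of_isIrreducible hirr (aggregation_diag_pos G)).exists_pos_pow
  refine ⟨(residualAggregation_mem_rowStochastic hδ0 hδ1.le).1, k, hk, fun p q => ?_⟩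
  exact (mul_pos (pow_pos (sub_pos.2 hδ1) k) (hpos p q)).trans_le
    (pow_mul_pow_aggregation_le hδ0 hδ1.le k p q)

theorem residualAggregation_detailedBalance (p q : V × V) :
    ((G.degree p.1 : ℝ) + 1) * ((G.degree p.2 : ℝ) + 1) * residualAggregation G δ p q =
      ((G.degree q.1 : ℝ) + 1) * ((G.degree q.2 : ℝ) + 1) * residualAggregation G δ q p := by
  rcases eq_or_ne p q with rfl | hpq
  · rfl
  · rw [residualAggregation_apply, residualAggregation_apply, one_apply_ne hpq,
      one_apply_ne hpq.symm]
    linear_combination (1 - δ) * aggregation_detailedBalance G p q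

theorem existsUnique_isStationaryDistribution [Nonempty V]
    (hirr : (aggregation G).IsIrreducible) (hδ0 : 0 ≤ δ) (hδ1 : δ < 1) :
    ∃! π, IsStationaryDistribution (residualAggregation G δ) π := by
  have hM := residualAggregation_mem_rowStochastic (G := G) hδ0 hδ1.le
  have hw (p : V × V) : 0 < ((G.degree p.1 : ℝ) + 1) * ((G.degree p.2 : ℝ) + 1) := by positivity
  have hstat := isStationaryDistribution_of_detailedBalance hM (fun p => (hw p).le)
    (Finset.sum_pos (fun p _ => hw p) Finset.univ_nonempty) residualAggregation_detailedBalance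
  exact ⟨_, hstat, fun _ hπ => hπ.unique hM (residualAggregation_isPrimitive hirr hδ0 hδ1) hstat⟩

theorem exists_isSecondLargestEigenvalue_aggregation [Nontrivial V]
    (hirr : (aggregation G).IsIrreducible) :
    ∃ μ < 1, IsSecondLargestEigenvalue (aggregation G) μ :=
  exists_isSecondLargestEigenvalue_lt_one (aggregation_mem_rowStochastic G)
    (isPrimitive_of_isIrreducible hirr (aggregation_diag_pos G)) (fun _ => by positivity)
    (aggregation_detailedBalance G) Fintype.one_lt_card

end Aggregation

section Recursion

variable {ι : Type*} {R : ℕ} {T D S : ℕ → ℕ → ι → ℝ} {q : ℝ}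

theorem exists_eventually_norm_le [Fintype ι]
    (hstep : ∀ l, ∀ r < R, ∀ i, T l (r + 1) i = T l r i * D l r i + S l r i)
    (hD : ∀ r < R, ∀ i, DecaysExponentially fun l => D l r i - 1)
    (hS : ∀ r < R, ∀ i, DecaysExponentially fun l => S l r i - q) (r : ℕ) (hr : r ≤ R) (b : ℝ)
    (hb : 1 < b) : ∃ B, 0 ≤ B ∧ ∀ᶠ l in atTop, ‖T l r‖ ≤ b * ‖T l 0‖ + B := by
  induction r generalizing b with
  | zero => exact ⟨0, le_rfl, .of_forall fun l => by nlinarith [norm_nonneg (T l 0)]⟩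
  | succ r ih =>
    have hb' : 1 < √b := Real.lt_sqrt_of_sq_lt (by simpa using hb)
    obtain ⟨B, hB, h⟩ := ih (by omega) _ hb'
    refine ⟨√b * B + (|q| + 1), by positivity, ?_⟩
    have hDlim : ∀ᶠ l in atTop, ∀ i, |D l r i - 1| < √b - 1 := eventually_all.2 fun i => by
      simpa using (hD r hr i).tendsto_zero.norm.eventually_lt_const
        (by rw [norm_zero]; exact sub_pos.2 hb')
    have hSlim : ∀ᶠ l in atTop, ∀ i, |S l r i - q| < 1 := eventually_all.2 fun i => by
      simpa using (hS r hr i).tendsto_zero.norm.eventually_lt_const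
        (by rw [norm_zero]; exact one_pos)
    filter_upwards [h, hDlim, hSlim] with l hT hD' hS'
    refine (pi_norm_le_iff_of_nonneg (by positivity)).2 fun i => ?_
    have hDle : |D l r i| ≤ √b := by
      linarith [abs_sub_abs_le_abs_sub (D l r i) 1, hD' i, abs_one (α := ℝ)]
    have hSle : |S l r i| ≤ |q| + 1 := by linarith [abs_sub_abs_le_abs_sub (S l r i) q, hS' i]
    rw [hstep l r hr i]
    calc |T l r i * D l r i + S l r i| ≤ |T l r i| * |D l r i| + |S l r i| := by
          rw [← abs_mul]
          exact abs_add_le _ _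
      _ ≤ (√b * ‖T l 0‖ + B) * √b + (|q| + 1) := by
          gcongr
          exact (norm_le_pi_norm (T l r) i).trans hT
      _ = b * ‖T l 0‖ + (√b * B + (|q| + 1)) := by
          linear_combination ‖T l 0‖ * Real.mul_self_sqrt (one_pos.trans hb).le

variable [Fintype ι] [DecidableEq ι] {M : Matrix ι ι ℝ}

theorem isSubexponential_of_recursion (hM : M ∈ rowStochastic ℝ ι)
    (hzero : ∀ l, T (l + 1) 0 = M *ᵥ T l R)
    (hstep : ∀ l, ∀ r < R, ∀ i, T l (r + 1) i = T l r i * D l r i + S l r i)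
    (hD : ∀ r < R, ∀ i, DecaysExponentially fun l => D l r i - 1)
    (hS : ∀ r < R, ∀ i, DecaysExponentially fun l => S l r i - q) {r : ℕ} (hr : r ≤ R) (i : ι) :
    IsSubexponential fun l => T l r i := by
  have hgrow := exists_eventually_norm_le hstep hD hS
  have h0 : IsSubexponential fun l => ‖T l 0‖ :=
    isSubexponential_of_forall_le (fun _ => norm_nonneg _) fun b hb => by
      obtain ⟨B, hB, h⟩ := hgrow R le_rfl b hb
      refine ⟨B, hB, h.mono fun l hl => ?_⟩
      rw [hzero]
      exact (norm_mulVec_le hM _).trans hl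
  intro b hb
  obtain ⟨B, -, h⟩ := hgrow r hr b hb
  have hconst : (fun _ : ℕ => B) =O[atTop] fun l : ℕ => b ^ l :=
    (isLittleO_const_left.2 (.inr
      (tendsto_norm_atTop_atTop.comp (tendsto_pow_atTop_atTop_of_one_lt hb)))).isBigO
  refine IsBigO.trans (IsBigO.of_bound 1 (h.mono fun l hl => ?_))
    (((h0 b hb).const_mul_left b).add hconst)
  rw [one_mul]
  exact (norm_le_pi_norm (T l r) i).trans (hl.trans (le_abs_self _))

theorem decaysExponentially_step_sub (hM : M ∈ rowStochastic ℝ ι)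
    (hzero : ∀ l, T (l + 1) 0 = M *ᵥ T l R)
    (hstep : ∀ l, ∀ r < R, ∀ i, T l (r + 1) i = T l r i * D l r i + S l r i)
    (hD : ∀ r < R, ∀ i, DecaysExponentially fun l => D l r i - 1)
    (hS : ∀ r < R, ∀ i, DecaysExponentially fun l => S l r i - q) (r : ℕ) (hr : r ≤ R) (i : ι) :
    DecaysExponentially fun l => T l r i - T l 0 i - r * q := by
  induction r with
  | zero => simpa using DecaysExponentially.zero (E := ℝ)
  | succ r ih =>
    have hprod := (hD r hr i).mul_isSubexponential
      (isSubexponential_of_recursion hM hzero hstep hD hS (Nat.le_of_succ_le hr) i)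
    convert (ih (Nat.le_of_succ_le hr)).add (hprod.add (hS r hr i)) using 2 with l
    rw [hstep l r hr i]
    push_cast
    ring

/-- The multiplicative errors `D - 1` are harmless because `T` grows subexponentially; after
subtracting the drift `R l q`, the sequence `T l 0` is an exponentially small perturbation of the
iteration of `M`. -/
theorem exists_decaysExponentially_sub_affine [Nonempty ι] (hM : M ∈ rowStochastic ℝ ι)
    (hprim : M.IsPrimitive) (hzero : ∀ l, T (l + 1) 0 = M *ᵥ T l R)
    (hstep : ∀ l, ∀ r < R, ∀ i, T l (r + 1) i = T l r i * D l r i + S l r i)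
    (hD : ∀ r < R, ∀ i, DecaysExponentially fun l => D l r i - 1)
    (hS : ∀ r < R, ∀ i, DecaysExponentially fun l => S l r i - q) :
    ∃ c : ℝ, ∀ r ≤ R, ∀ i, DecaysExponentially fun l => T l r i - (R * l * q + (c + r * q)) := by
  have hinner := decaysExponentially_step_sub hM hzero hstep hD hS
  have hdrift : DecaysExponentially fun l => M *ᵥ (T l R - T l 0 - fun _ => R * q) :=
    (decaysExponentially_pi_iff.2 (hinner R le_rfl)).norm.of_norm_le
      (.of_forall fun l => norm_mulVec_le hM _)
  obtain ⟨c, hc⟩ := exists_decaysExponentially_sub_const (x := fun l => T l 0 - fun _ => R * l * q)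
    hM hprim (by
      convert hdrift using 2 with l
      rw [hzero, mulVec_sub, mulVec_sub, mulVec_sub, mulVec_const hM, mulVec_const hM]
      funext j
      simp only [Pi.sub_apply]
      push_cast
      ring)
  refine ⟨c, fun r hr i => ?_⟩
  convert (decaysExponentially_pi_iff.1 hc i).add (hinner r hr i) using 2 with l
  simp only [Pi.sub_apply]
  ring

end Recursion

section GaussianPair

/-- `a`, `b` are the variances and `c` is the covariance of some pair of real random variables: the
matrix `[[a, c], [c, b]]` is positive semidefinite, here through its quadratic form. -/
def IsCovariance (a b c : ℝ) : Prop :=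
  ∀ s t : ℝ, 0 ≤ a * s ^ 2 + 2 * c * s * t + b * t ^ 2

namespace IsCovariance

variable {a b c : ℝ}

theorem symm (h : IsCovariance a b c) : IsCovariance b a c := fun s t => by
  linarith [h t s]

theorem left_nonneg (h : IsCovariance a b c) : 0 ≤ a := by
  simpa using h 1 0

theorem right_nonneg (h : IsCovariance a b c) : 0 ≤ b := h.symm.left_nonneg

theorem two_mul_le (h : IsCovariance a b c) : 2 * c ≤ a + b := by
  linarith [h 1 (-1)]

theorem posSemidef (h : IsCovariance a b c) : !![a, c; c, b].PosSemidef := by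
  refine PosSemidef.of_dotProduct_mulVec_nonneg ?_ fun x => ?_
  · ext i j
    fin_cases i <;> fin_cases j <;> rfl
  · simp only [dotProduct, mulVec, Fin.sum_univ_two, Pi.star_apply, star_trivial, of_apply,
      cons_val_zero, cons_val_one, cons_val', cons_val_fin_one]
    linarith [h (x 0) (x 1)]

end IsCovariance

/-- `𝔼[f(z₁) g(z₂)]` for a centred Gaussian pair with variances `a`, `b` and covariance `c`. -/
noncomputable def pairing (f g : ℝ → ℝ) (a b c : ℝ) : ℝ :=
  ∫ z : EuclideanSpace ℝ (Fin 2), f (z 0) * g (z 1) ∂(multivariateGaussian 0 !![a, c; c, b])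

/-- `(X, Y)` is a centred Gaussian pair under `μ` with variances `a`, `b` and covariance `c`. Stated
through the characteristic function, which makes linear images and independent sums immediate and
allows degenerate pairs. -/
structure IsGaussianPair {Ω : Type*} [MeasurableSpace Ω] (μ : Measure Ω) (X Y : Ω → ℝ)
    (a b c : ℝ) : Prop where
  measurable_left : Measurable X
  measurable_right : Measurable Y
  integral_exp (s t : ℝ) : ∫ ω, Complex.exp ((s * X ω + t * Y ω : ℝ) * Complex.I) ∂μ =
    Complex.exp ((-(a * s ^ 2 + 2 * c * s * t + b * t ^ 2) / 2 : ℝ))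

variable {Ω Ω' : Type*} [MeasurableSpace Ω] [MeasurableSpace Ω'] {μ : Measure Ω} {ν : Measure Ω'}
  {X Y : Ω → ℝ} {a b c : ℝ}

namespace IsGaussianPair

theorem symm (h : IsGaussianPair μ X Y a b c) : IsGaussianPair μ Y X b a c :=
  ⟨h.measurable_right, h.measurable_left, fun s t => by
    simpa only [add_comm, add_left_comm, mul_right_comm] using h.integral_exp t s⟩

theorem linear (h : IsGaussianPair μ X Y a b c) (p q p' q' : ℝ) :
    IsGaussianPair μ (fun ω => p * X ω + q * Y ω) (fun ω => p' * X ω + q' * Y ω)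
      (p ^ 2 * a + 2 * p * q * c + q ^ 2 * b) (p' ^ 2 * a + 2 * p' * q' * c + q' ^ 2 * b)
      (p * p' * a + (p * q' + q * p') * c + q * q' * b) := by
  have hX := h.measurable_left
  have hY := h.measurable_right
  refine ⟨by fun_prop, by fun_prop, fun s t => ?_⟩
  convert h.integral_exp (s * p + t * p') (s * q + t * q') using 5
  · ring_nf
  · ring

theorem diag (h : IsGaussianPair μ X Y a b c) : IsGaussianPair μ X X a a a := by
  simpa using h.linear 1 0 1 0

theorem neg (h : IsGaussianPair μ X Y a b c) :
    IsGaussianPair μ (fun ω => -X ω) (fun ω => -Y ω) a b c := by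
  simpa using h.linear (-1) 0 0 (-1)

theorem prod [SFinite μ] [SFinite ν] (h : IsGaussianPair μ X Y a b c) {X' Y' : Ω' → ℝ}
    {a' b' c' : ℝ} (h' : IsGaussianPair ν X' Y' a' b' c') :
    IsGaussianPair (μ.prod ν) (fun ω => X ω.1 + X' ω.2) (fun ω => Y ω.1 + Y' ω.2)
      (a + a') (b + b') (c + c') := by
  have hX := h.measurable_left
  have hY := h.measurable_right
  have hX' := h'.measurable_left
  have hY' := h'.measurable_right
  refine ⟨by fun_prop, by fun_prop, fun s t => ?_⟩
  have hexp (ω : Ω × Ω') : Complex.exp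
      ((s * (X ω.1 + X' ω.2) + t * (Y ω.1 + Y' ω.2) : ℝ) * Complex.I) =
      Complex.exp ((s * X ω.1 + t * Y ω.1 : ℝ) * Complex.I) *
        Complex.exp ((s * X' ω.2 + t * Y' ω.2 : ℝ) * Complex.I) := by
    rw [← Complex.exp_add]
    congr 1
    push_cast
    ring
  simp only [hexp]
  rw [integral_prod_mul (fun ω => Complex.exp ((s * X ω + t * Y ω : ℝ) * Complex.I))
      (fun ω => Complex.exp ((s * X' ω + t * Y' ω : ℝ) * Complex.I)),
    h.integral_exp, h'.integral_exp, ← Complex.exp_add, ← Complex.ofReal_add]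
  congr 2
  ring

theorem measurable_toLp (h : IsGaussianPair μ X Y a b c) :
    Measurable fun ω => (WithLp.toLp 2 ![X ω, Y ω] : EuclideanSpace ℝ (Fin 2)) := by
  refine (PiLp.continuous_toLp 2 _).measurable.comp (measurable_pi_lambda _ fun i => ?_)
  fin_cases i
  exacts [h.measurable_left, h.measurable_right]

variable [IsProbabilityMeasure μ]

theorem isCovariance (h : IsGaussianPair μ X Y a b c) : IsCovariance a b c := by
  intro s t
  have hle : ‖∫ ω, Complex.exp ((s * X ω + t * Y ω : ℝ) * Complex.I) ∂μ‖ ≤ 1 :=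
    (norm_integral_le_of_norm_le_const (C := 1)
      (.of_forall fun ω => (Complex.norm_exp_ofReal_mul_I _).le)).trans_eq (by simp)
  rw [h.integral_exp, ← Complex.ofReal_exp, Complex.norm_real, Real.norm_eq_abs, Real.abs_exp,
    Real.exp_le_one_iff] at hle
  linarith

theorem map_toLp (h : IsGaussianPair μ X Y a b c) :
    μ.map (fun ω => (WithLp.toLp 2 ![X ω, Y ω] : EuclideanSpace ℝ (Fin 2))) =
      multivariateGaussian 0 !![a, c; c, b] := by
  have := Measure.isProbabilityMeasure_map (μ := μ) h.measurable_toLp.aemeasurable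
  refine Measure.ext_of_charFun (funext fun x => ?_)
  have hinner (ω : Ω) : inner ℝ (WithLp.toLp 2 ![X ω, Y ω] : EuclideanSpace ℝ (Fin 2)) x =
      x 0 * X ω + x 1 * Y ω := by
    simp [PiLp.inner_apply]
  rw [charFun_multivariateGaussian h.isCovariance.posSemidef, charFun_apply,
    integral_map h.measurable_toLp.aemeasurable (by fun_prop)]
  simp only [hinner]
  rw [h.integral_exp]
  simp only [inner_zero_right, Complex.ofReal_zero, zero_mul, zero_sub, dotProduct, mulVec,
    Fin.sum_univ_two, of_apply, cons_val_zero, cons_val_one, cons_val', cons_val_fin_one]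
  push_cast
  ring_nf

theorem integral_eq_pairing (h : IsGaussianPair μ X Y a b c) {f g : ℝ → ℝ} (hf : Measurable f)
    (hg : Measurable g) : ∫ ω, f (X ω) * g (Y ω) ∂μ = pairing f g a b c := by
  rw [pairing, ← h.map_toLp, integral_map h.measurable_toLp.aemeasurable
    (Measurable.aestronglyMeasurable (by fun_prop))]
  rfl

theorem identDistrib_left (h : IsGaussianPair μ X Y a b c) :
    IdentDistrib X (fun x => √a * x) μ (gaussianReal 0 1) := by
  refine ⟨h.measurable_left.aemeasurable, by fun_prop, ?_⟩
  have := Measure.isProbabilityMeasure_map (μ := μ) h.measurable_left.aemeasurable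
  refine Measure.ext_of_charFun (funext fun t => ?_)
  rw [gaussianReal_map_const_mul, charFun_gaussianReal, charFun_apply_real,
    integral_map h.measurable_left.aemeasurable (by fun_prop)]
  have hexp := h.integral_exp t 0
  simp only [zero_mul, add_zero, mul_zero, ne_eq, OfNat.ofNat_ne_zero, not_false_eq_true,
    zero_pow, Complex.ofReal_mul] at hexp
  rw [hexp, NNReal.coe_mul, NNReal.coe_mk, Real.sq_sqrt h.isCovariance.left_nonneg]
  push_cast
  ring_nf

theorem identDistrib_right (h : IsGaussianPair μ X Y a b c) :
    IdentDistrib Y (fun x => √b * x) μ (gaussianReal 0 1) := h.symm.identDistrib_left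

end IsGaussianPair

theorem isGaussianPair_gaussianReal (p q : ℝ) :
    IsGaussianPair (gaussianReal 0 1) (fun x => p * x) (fun x => q * x) (p ^ 2) (q ^ 2)
      (p * q) := by
  refine ⟨by fun_prop, by fun_prop, fun s t => ?_⟩
  have hchar := charFun_gaussianReal (μ := 0) (v := 1) (s * p + t * q)
  rw [charFun_apply_real] at hchar
  convert hchar using 4
  · push_cast
    ring
  · push_cast
    ring

theorem isGaussianPair_multivariateGaussian {ι : Type*} [Fintype ι] [DecidableEq ι]
    {K : Matrix ι ι ℝ} (hK : K.PosSemidef) (u v : ι) :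
    IsGaussianPair (multivariateGaussian 0 K) (fun z => z u) (fun z => z v) (K u u) (K v v)
      (K u v) := by
  refine ⟨by fun_prop, by fun_prop, fun s t => ?_⟩
  have hsymm : K v u = K u v := by simpa using congrFun₂ hK.isHermitian u v
  have hchar := charFun_multivariateGaussian (μ := 0) hK
    (s • EuclideanSpace.single u 1 + t • EuclideanSpace.single v 1)
  rw [charFun_apply] at hchar
  refine Eq.trans ?_ (hchar.trans ?_)
  · simp [inner_add_right, inner_smul_right, EuclideanSpace.inner_single_right]
  · congr 1
    simp [add_dotProduct, mulVec_add, mulVec_smul, hsymm]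
    ring

theorem IsCovariance.isGaussianPair (h : IsCovariance a b c) :
    IsGaussianPair (multivariateGaussian 0 !![a, c; c, b])
      (fun z : EuclideanSpace ℝ (Fin 2) => z 0) (fun z => z 1) a b c := by
  simpa using isGaussianPair_multivariateGaussian h.posSemidef 0 1

theorem memLp_mul_gaussianReal (σ : ℝ) : MemLp (fun x => σ * x) 2 (gaussianReal 0 1) :=
  (memLp_id_gaussianReal 2).const_mul σ

theorem integral_sq_gaussianReal (σ : ℝ) : ∫ x, (σ * x) ^ 2 ∂(gaussianReal 0 1) = σ ^ 2 := by
  have hvar := variance_id_gaussianReal (μ := 0) (v := 1)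
  rw [variance_of_integral_eq_zero (by fun_prop) (by simp)] at hvar
  simp only [id_eq, NNReal.coe_one] at hvar
  simp only [mul_pow, integral_const_mul, hvar, mul_one]

namespace IsGaussianPair

variable [IsProbabilityMeasure μ]

theorem memLp_left (h : IsGaussianPair μ X Y a b c) : MemLp X 2 μ :=
  h.identDistrib_left.memLp_iff.2 (memLp_mul_gaussianReal _)

theorem memLp_right (h : IsGaussianPair μ X Y a b c) : MemLp Y 2 μ := h.symm.memLp_left

theorem integral_left_sq (h : IsGaussianPair μ X Y a b c) : ∫ ω, X ω ^ 2 ∂μ = a :=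
  (h.identDistrib_left.comp (measurable_id.pow_const 2)).integral_eq.trans <|
    (integral_sq_gaussianReal _).trans (Real.sq_sqrt h.isCovariance.left_nonneg)

theorem integral_sub_sq (h : IsGaussianPair μ X Y a b c) :
    ∫ ω, (X ω - Y ω) ^ 2 ∂μ = a + b - 2 * c := by
  convert (h.linear 1 (-1) 0 0).integral_left_sq using 3 <;> ring

theorem integral_mul (h : IsGaussianPair μ X Y a b c) : ∫ ω, X ω * Y ω ∂μ = c := by
  have hpolar (ω : Ω) : X ω * Y ω = (X ω ^ 2 + Y ω ^ 2 - (X ω - Y ω) ^ 2) / 2 := by ring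
  have hX := h.memLp_left.integrable_sq
  have hY := h.memLp_right.integrable_sq
  have hadd : Integrable (fun ω => X ω ^ 2 + Y ω ^ 2) μ := hX.add hY
  have hsub : Integrable (fun ω => (X ω - Y ω) ^ 2) μ :=
    (h.memLp_left.sub h.memLp_right).integrable_sq
  simp only [hpolar]
  rw [integral_div, integral_sub hadd hsub, integral_add hX hY, h.integral_left_sq,
    h.symm.integral_left_sq, h.integral_sub_sq]
  ring

end IsGaussianPair

end GaussianPair

section PSDKernel

variable {V : Type*}

/-- `K` is a positive semidefinite kernel on `V`: the matrix `(K (u, v))` is positive semidefinite,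
in particular symmetric. -/
def IsPSDKernel (K : V × V → ℝ) : Prop := (of fun u v => K (u, v)).PosSemidef

namespace IsPSDKernel

variable {K L : V × V → ℝ}

theorem symm (hK : IsPSDKernel K) (u v : V) : K (v, u) = K (u, v) := by
  simpa using congrFun₂ (PosSemidef.isHermitian hK) u v

theorem gram [Finite V] {E : Type*} [NormedAddCommGroup E] [InnerProductSpace ℝ E] (h : V → E) :
    IsPSDKernel (fun p : V × V => inner ℝ (h p.1) (h p.2)) :=
  posSemidef_gram ℝ h

theorem add (hK : IsPSDKernel K) (hL : IsPSDKernel L) : IsPSDKernel (K + L) :=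
  PosSemidef.add hK hL

theorem smul (hK : IsPSDKernel K) {c : ℝ} (hc : 0 ≤ c) : IsPSDKernel (c • K) :=
  PosSemidef.smul hK hc

theorem const [Finite V] {c : ℝ} (hc : 0 ≤ c) : IsPSDKernel (fun _ : V × V => c) := by
  simpa [hc] using gram fun _ : V => √c

theorem integral_mul [Finite V] {Ω : Type*} [MeasurableSpace Ω] {μ : Measure Ω} {g : V → Ω → ℝ}
    (hg : ∀ u, MemLp (g u) 2 μ) : IsPSDKernel fun p : V × V => ∫ ω, g p.1 ω * g p.2 ω ∂μ := by
  convert gram fun u => (hg u).toLp with p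
  rw [L2.inner_def]
  refine integral_congr_ae ?_
  filter_upwards [(hg p.1).coeFn_toLp, (hg p.2).coeFn_toLp] with ω h₁ h₂
  simp [h₁, h₂, mul_comm]

theorem gaussianPairing_eq (hK : IsPSDKernel K) (ψ : ℝ → ℝ) (u v : V) :
    gaussianPairing ψ K u v = pairing ψ ψ (K (u, u)) (K (v, v)) (K (u, v)) := by
  rw [gaussianPairing, hK.symm u v, pairing]

theorem mul [Finite V] (hK : IsPSDKernel K) (hL : IsPSDKernel L) : IsPSDKernel (K * L) :=
  PosSemidef.hadamard hK hL

theorem isGaussianPair [Fintype V] [DecidableEq V] (hK : IsPSDKernel K) (u v : V) :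
    IsGaussianPair (multivariateGaussian 0 (of fun u v => K (u, v))) (fun z => z u) (fun z => z v)
      (K (u, u)) (K (v, v)) (K (u, v)) :=
  isGaussianPair_multivariateGaussian hK u v

variable [Finite V]

theorem isCovariance (hK : IsPSDKernel K) (u v : V) :
    IsCovariance (K (u, u)) (K (v, v)) (K (u, v)) := by
  classical
  have := Fintype.ofFinite V
  exact (hK.isGaussianPair u v).isCovariance

theorem diag_nonneg (hK : IsPSDKernel K) (u : V) : 0 ≤ K (u, u) :=
  (hK.isCovariance u u).left_nonneg

theorem apply_le (hK : IsPSDKernel K) {B : ℝ} (hB : ∀ u, K (u, u) ≤ B) (p : V × V) : K p ≤ B := by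
  linarith [(hK.isCovariance p.1 p.2).two_mul_le, hB p.1, hB p.2]

theorem neg_le_apply (hK : IsPSDKernel K) {B : ℝ} (hB : ∀ u, K (u, u) ≤ B) (p : V × V) :
    -B ≤ K p := by
  linarith [hK.isCovariance p.1 p.2 1 1, hB p.1, hB p.2]

theorem gaussianPairing (hK : IsPSDKernel K) {ψ : ℝ → ℝ} (hψ : Measurable ψ)
    (hψ2 : ∀ σ, MemLp (fun x => ψ (σ * x)) 2 (gaussianReal 0 1)) :
    IsPSDKernel (fun p : V × V => gaussianPairing ψ K p.1 p.2) := by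
  classical
  have := Fintype.ofFinite V
  convert integral_mul fun u =>
    ((hK.isGaussianPair u u).identDistrib_left.comp hψ).memLp_iff.2 (hψ2 _) with p
  rw [hK.gaussianPairing_eq]
  exact ((hK.isGaussianPair p.1 p.2).integral_eq_pairing hψ hψ).symm

omit [Finite V]

variable [Fintype V] [DecidableEq V] {G : SimpleGraph V} [DecidableRel G.Adj]

-- With `S` the averaging matrix, aggregation is the congruence `K ↦ S K Sᵀ`.
theorem aggregation (hK : IsPSDKernel K) : IsPSDKernel (aggregation G *ᵥ K) := by
  rw [IsPSDKernel]
  convert PosSemidef.mul_mul_conjTranspose_same hK (averagingMatrix G) using 1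
  ext u v
  simp only [of_apply, mulVec, dotProduct, aggregation_apply, mul_apply, conjTranspose_apply,
    star_trivial, Finset.sum_mul]
  rw [Fintype.sum_prod_type, Finset.sum_comm]
  exact Finset.sum_congr rfl fun i _ => Finset.sum_congr rfl fun j _ => by ring

theorem residualAggregation {δ : ℝ} (hδ0 : 0 ≤ δ) (hδ1 : δ ≤ 1) (hK : IsPSDKernel K) :
    IsPSDKernel (residualAggregation G δ *ᵥ K) := by
  rw [residualAggregation_mulVec]
  exact (hK.aggregation.smul (sub_nonneg.2 hδ1)).add (hK.smul hδ0)

end IsPSDKernel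

end PSDKernel

section Kernels

variable {V : Type*} [Fintype V] {A : Matrix (V × V) (V × V) ℝ} {φ : ℝ → ℝ} {σw σb : ℝ} {R d : ℕ}
  {h : V → EuclideanSpace ℝ (Fin d)}

theorem gpk_zero_zero : gpk A φ σw σb R h 0 0 = fun p => inner ℝ (h p.1) (h p.2) := by
  rw [gpk]

theorem gpk_succ_zero (l : ℕ) : gpk A φ σw σb R h (l + 1) 0 = A *ᵥ gpk A φ σw σb R h l R := by
  rw [gpk]

theorem gpk_succ (l r : ℕ) : gpk A φ σw σb R h l (r + 1) = fun p =>
    σw ^ 2 * gaussianPairing φ (gpk A φ σw σb R h l r) p.1 p.2 + σb ^ 2 := by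
  rw [gpk]

theorem gntk_succ_zero (l : ℕ) : gntk A φ σw σb R h (l + 1) 0 = A *ᵥ gntk A φ σw σb R h l R := by
  rw [gntk]

theorem gntk_succ (l r : ℕ) : gntk A φ σw σb R h l (r + 1) = fun p =>
    gntk A φ σw σb R h l r p * gpkDeriv A φ σw σb R h l r p + gpk A φ σw σb R h l (r + 1) p := by
  rw [gntk]

theorem layer_induction {P : ℕ → ℕ → Prop} (R : ℕ) (zero : P 0 0)
    (propagate : ∀ l, P l R → P (l + 1) 0) (layer : ∀ l r, P l r → P l (r + 1)) (l r : ℕ) :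
    P l r := by
  have hrow (l : ℕ) (hl : P l 0) (r : ℕ) : P l r := by
    induction r with
    | zero => exact hl
    | succ r ih => exact layer l r ih
  refine hrow l ?_ r
  induction l with
  | zero => exact zero
  | succ l ih => exact propagate l (hrow l ih R)

theorem isPSDKernel_gpk (hA : ∀ K, IsPSDKernel K → IsPSDKernel (A *ᵥ K)) (hφ : Measurable φ)
    (hφ2 : ∀ σ, MemLp (fun x => φ (σ * x)) 2 (gaussianReal 0 1)) (l r : ℕ) :
    IsPSDKernel (gpk A φ σw σb R h l r) := by
  refine layer_induction (P := fun l r => IsPSDKernel (gpk A φ σw σb R h l r)) R ?_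
    (fun l hl => ?_) (fun l r hr => ?_) l r
  · simpa only [gpk_zero_zero] using .gram h
  · simpa only [gpk_succ_zero] using hA _ hl
  · rw [gpk_succ]
    exact ((hr.gaussianPairing hφ hφ2).smul (sq_nonneg σw)).add (.const (sq_nonneg σb))

theorem exists_gntk_asymptotics [Nonempty V] [DecidableEq V] (hA : A ∈ rowStochastic ℝ (V × V))
    (hprim : A.IsPrimitive) {π : V × V → ℝ} (hπ : IsStationaryDistribution A π) {q : ℝ}
    (hgpk : ∀ r < R, ∀ p, DecaysExponentially fun l => gpk A φ σw σb R h l (r + 1) p - q)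
    (hderiv : ∀ r < R, ∀ p, DecaysExponentially fun l => gpkDeriv A φ σw σb R h l r p - 1) :
    ∃ α C : ℝ, 0 < α ∧ α < 1 ∧ 0 < C ∧
      ∃ v : V × V → ℝ, ∀ r ≤ R, ∃ v' : V × V → ℝ, ∀ (l : ℕ) (u u' : V),
        |gntk A φ σw σb R h l r (u, u') - π ⬝ᵥ (((R : ℝ) * (l : ℝ)) • v + v')| ≤ C * α ^ l := by
  obtain ⟨c, hc⟩ := exists_decaysExponentially_sub_affine (T := gntk A φ σw σb R h)
    (D := gpkDeriv A φ σw σb R h) (S := fun l r => gpk A φ σw σb R h l (r + 1)) hA hprim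
    gntk_succ_zero (fun l r _ p => by rw [gntk_succ]) hderiv hgpk
  have hsum : DecaysExponentially fun l => ∑ r ∈ Finset.range (R + 1), ∑ p,
      ‖gntk A φ σw σb R h l r p - (R * l * q + (c + r * q))‖ :=
    .sum fun r hr => .sum fun p _ => (hc r (Finset.mem_range_succ_iff.1 hr) p).norm
  obtain ⟨α, C, hα0, hα1, hC, hle⟩ := hsum.exists_forall_le
  refine ⟨α, C, hα0, hα1, hC, fun _ => q, fun r hr => ⟨fun _ => c + r * q, fun l u u' => ?_⟩⟩
  rw [dotProduct_add, dotProduct_smul, hπ.dotProduct_const, hπ.dotProduct_const, smul_eq_mul]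
  refine le_trans ?_ ((Real.le_norm_self _).trans (hle l))
  have hp := Finset.single_le_sum (fun p _ => norm_nonneg
    (gntk A φ σw σb R h l r p - (R * l * q + (c + r * q)))) (Finset.mem_univ (u, u'))
  have hr' := Finset.single_le_sum (f := fun r : ℕ => ∑ p,
    ‖gntk A φ σw σb R h l r p - (R * l * q + (c + r * q))‖)
    (fun r _ => Finset.sum_nonneg fun p _ => norm_nonneg _) (Finset.mem_range_succ_iff.2 hr)
  exact hp.trans hr'

end Kernels

section ReLU

theorem measurable_relu : Measurable relu := by
  unfold relu
  fun_prop

theorem relu_nonneg (x : ℝ) : 0 ≤ relu x := le_max_left _ _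

theorem abs_relu_le (x : ℝ) : |relu x| ≤ |x| := by
  rw [abs_of_nonneg (relu_nonneg x)]
  exact max_le (abs_nonneg x) (le_abs_self x)

theorem relu_eq (x : ℝ) : relu x = (x + |x|) / 2 := by
  rcases le_total 0 x with hx | hx
  · rw [relu, max_eq_right hx, abs_of_nonneg hx, add_self_div_two]
  · rw [relu, max_eq_left hx, abs_of_nonpos hx, add_neg_cancel, zero_div]

theorem relu_sq_add_relu_neg_sq (x : ℝ) : relu x ^ 2 + relu (-x) ^ 2 = x ^ 2 := by
  rw [relu_eq, relu_eq, abs_neg]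
  linear_combination (1 / 2) * sq_abs x

theorem mul_le_relu_mul_relu (x y : ℝ) : x * y ≤ relu x * relu y + relu (-x) * relu (-y) := by
  simp only [relu_eq, abs_neg]
  linarith [le_abs_self (x * y), abs_mul x y]

theorem deriv_relu : deriv relu = (Set.Ioi 0).indicator 1 := by
  funext x
  rcases lt_trichotomy x 0 with hx | rfl | hx
  · have hzero : relu =ᶠ[𝓝 x] fun _ => 0 := by
      filter_upwards [gt_mem_nhds hx] with y hy using max_eq_left hy.le
    simp [hzero.deriv_eq, hx.le]
  · have hnd : ¬ DifferentiableAt ℝ relu 0 := fun hd => not_differentiableAt_abs_zero <|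
      ((hd.const_mul 2).sub differentiableAt_id).congr_of_eventuallyEq <|
        .of_forall fun y => by
          simp [relu_eq, mul_div_cancel₀]
    simp [deriv_zero_of_not_differentiableAt hnd]
  · have hid : relu =ᶠ[𝓝 x] id := by
      filter_upwards [lt_mem_nhds hx] with y hy using max_eq_right hy.le
    simp [hid.deriv_eq, hx]

theorem measureReal_Ioi_gaussianReal : (gaussianReal 0 1).real (Set.Ioi 0) = 1 / 2 := by
  have := nullSingletonClass_gaussianReal (μ := 0) one_ne_zero
  have hneg : (gaussianReal 0 1).real (Set.Iio 0) = (gaussianReal 0 1).real (Set.Ioi 0) := by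
    have hmap := gaussianReal_map_neg (μ := 0) (v := 1)
    rw [neg_zero] at hmap
    conv_lhs => rw [← hmap, map_measureReal_apply measurable_neg measurableSet_Iio]
    simp
  have hcompl := probReal_add_probReal_compl (μ := gaussianReal 0 1) (s := Set.Ioi (0 : ℝ))
    measurableSet_Ioi
  rw [Set.compl_Ioi, ← measureReal_congr Iio_ae_eq_Iic, hneg] at hcompl
  linarith

theorem gaussianPDF_standard_le_one (x : ℝ) : gaussianPDF 0 1 x ≤ 1 := by
  rw [gaussianPDF, ENNReal.ofReal_le_one, gaussianPDFReal]
  refine mul_le_one₀ (inv_le_one_of_one_le₀ ?_) (Real.exp_pos _).le (Real.exp_le_one_iff.2 ?_)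
  · rw [Real.one_le_sqrt, NNReal.coe_one]
    linarith [Real.pi_gt_three]
  · rw [NNReal.coe_one]
    linarith [sq_nonneg (x - 0)]

theorem measureReal_Ioc_gaussianReal_le {s : ℝ} (hs : 0 ≤ s) :
    (gaussianReal 0 1).real (Set.Ioc 0 s) ≤ s := by
  refine ENNReal.toReal_le_of_le_ofReal hs ?_
  rw [gaussianReal_apply _ one_ne_zero]
  exact (setLIntegral_mono measurable_const fun x _ => gaussianPDF_standard_le_one x).trans_eq
    (by simp)

namespace IsGaussianPair

variable {Ω : Type*} [MeasurableSpace Ω] {μ : Measure Ω} {X Y : Ω → ℝ} {a b c : ℝ}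
  [IsProbabilityMeasure μ]

theorem memLp_relu_left (h : IsGaussianPair μ X Y a b c) : MemLp (fun ω => relu (X ω)) 2 μ :=
  h.memLp_left.of_le (measurable_relu.comp h.measurable_left).aestronglyMeasurable
    (.of_forall fun _ => abs_relu_le _)

theorem integrable_relu_mul (h : IsGaussianPair μ X Y a b c) :
    Integrable (fun ω => relu (X ω) * relu (Y ω)) μ :=
  h.memLp_relu_left.integrable_mul h.symm.memLp_relu_left

theorem pairing_relu_nonneg (h : IsGaussianPair μ X Y a b c) : 0 ≤ pairing relu relu a b c := by
  rw [← h.integral_eq_pairing measurable_relu measurable_relu]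
  exact integral_nonneg fun ω => mul_nonneg (relu_nonneg _) (relu_nonneg _)

-- Both inequalities below average a pointwise relation over `(X, Y)` and `(-X, -Y)`, which have the
-- same law.
theorem le_two_mul_pairing_relu (h : IsGaussianPair μ X Y a b c) :
    c ≤ 2 * pairing relu relu a b c := by
  have hmono := integral_mono (h.memLp_left.integrable_mul h.memLp_right)
    (h.integrable_relu_mul.add h.neg.integrable_relu_mul) fun ω => mul_le_relu_mul_relu (X ω) (Y ω)
  rw [integral_add' h.integrable_relu_mul h.neg.integrable_relu_mul,
    h.integral_eq_pairing measurable_relu measurable_relu,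
    h.neg.integral_eq_pairing measurable_relu measurable_relu, ← two_mul] at hmono
  exact h.integral_mul.symm.trans_le hmono

theorem two_mul_pairing_relu_self (h : IsGaussianPair μ X Y a b c) :
    2 * pairing relu relu a a a = a := by
  have hsq := h.integral_left_sq
  simp only [← relu_sq_add_relu_neg_sq (X _), sq (relu _)] at hsq
  rwa [integral_add h.diag.integrable_relu_mul h.neg.diag.integrable_relu_mul,
    h.diag.integral_eq_pairing measurable_relu measurable_relu,
    h.neg.diag.integral_eq_pairing measurable_relu measurable_relu, ← two_mul] at hsq

theorem measureReal_left_pos (h : IsGaussianPair μ X Y a b c) (ha : 0 < a) :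
    μ.real {ω | 0 < X ω} = 1 / 2 := by
  rw [← measureReal_Ioi_gaussianReal]
  refine congrArg ENNReal.toReal
    ((h.identDistrib_left.measure_mem_eq measurableSet_Ioi).trans (congrArg _ ?_))
  ext x
  exact mul_pos_iff_of_pos_left (Real.sqrt_pos.2 ha)

theorem measureReal_left_Ioc_le (h : IsGaussianPair μ X Y a b c) (ha : 0 < a) {t : ℝ}
    (ht : 0 ≤ t) : μ.real {ω | X ω ∈ Set.Ioc 0 t} ≤ t / √a := by
  have hsqrt := Real.sqrt_pos.2 ha
  refine le_of_eq_of_le ?_ (measureReal_Ioc_gaussianReal_le (div_nonneg ht hsqrt.le))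
  refine congrArg ENNReal.toReal
    ((h.identDistrib_left.measure_mem_eq measurableSet_Ioc).trans (congrArg _ ?_))
  ext x
  simp [le_div_iff₀' hsqrt, hsqrt]

theorem measureReal_le_abs_sub_le (h : IsGaussianPair μ X Y a b c) {t : ℝ} (ht : 0 < t) :
    μ.real {ω | t ≤ |X ω - Y ω|} ≤ (a + b - 2 * c) / t ^ 2 := by
  rw [le_div_iff₀' (by positivity), ← h.integral_sub_sq]
  have hset : {ω | t ≤ |X ω - Y ω|} = {ω | t ^ 2 ≤ (X ω - Y ω) ^ 2} := by
    ext ω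
    rw [Set.mem_ofPred, Set.mem_ofPred, sq_le_sq, abs_of_pos ht]
  rw [hset]
  exact mul_meas_ge_le_integral_of_nonneg (.of_forall fun ω => sq_nonneg (X ω - Y ω))
    (h.memLp_left.sub h.memLp_right).integrable_sq (t ^ 2)

theorem pairing_deriv_relu (h : IsGaussianPair μ X Y a b c) :
    pairing (deriv relu) (deriv relu) a b c = μ.real {ω | 0 < X ω ∧ 0 < Y ω} := by
  have hX : MeasurableSet {ω | 0 < X ω} := measurableSet_lt measurable_const h.measurable_left
  have hY : MeasurableSet {ω | 0 < Y ω} := measurableSet_lt measurable_const h.measurable_right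
  rw [← h.integral_eq_pairing (measurable_deriv _) (measurable_deriv _), deriv_relu, Set.ofPred_and,
    ← integral_indicator_one (hX.inter hY), Set.inter_indicator_one]
  rfl

-- The signs of `X` and `Y` differ only if `X` is small or `X - Y` is large.
theorem abs_two_mul_pairing_deriv_relu_sub_one_le (h : IsGaussianPair μ X Y a b c) (ha : 0 < a)
    {t : ℝ} (ht : 0 < t) : |2 * pairing (deriv relu) (deriv relu) a b c - 1| ≤
      2 * (t / √a + (a + b - 2 * c) / t ^ 2) := by
  have hsub : {ω | 0 < X ω ∧ 0 < Y ω} ⊆ {ω | 0 < X ω} := fun ω hω => hω.1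
  have hcover : {ω | 0 < X ω} ⊆
      {ω | 0 < X ω ∧ 0 < Y ω} ∪ ({ω | X ω ∈ Set.Ioc 0 t} ∪ {ω | t ≤ |X ω - Y ω|}) := by
    intro ω (hX : 0 < X ω)
    by_cases hY : 0 < Y ω
    · exact .inl ⟨hX, hY⟩
    · rcases le_or_gt (X ω) t with hle | hlt
      · exact .inr (.inl ⟨hX, hle⟩)
      · have hdiff : t ≤ X ω - Y ω := by linarith
        exact .inr (.inr (hdiff.trans (le_abs_self _)))
  have hle := measureReal_mono (μ := μ) hsub
  have hge := (measureReal_mono (μ := μ) hcover).trans ((measureReal_union_le _ _).trans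
    (add_le_add_right (measureReal_union_le _ _) _))
  rw [h.measureReal_left_pos ha, ← h.pairing_deriv_relu] at hle hge
  rw [abs_le]
  constructor <;> linarith [h.measureReal_left_Ioc_le ha ht.le, h.measureReal_le_abs_sub_le ht]

end IsGaussianPair

theorem memLp_relu_mul_gaussianReal (σ : ℝ) :
    MemLp (fun x => relu (σ * x)) 2 (gaussianReal 0 1) :=
  (isGaussianPair_gaussianReal σ σ).memLp_relu_left

theorem IsEdgeOfChaos.relu_eq {σw σb : ℝ} (h : IsEdgeOfChaos relu σw σb) :
    σw ^ 2 = 2 ∧ σb ^ 2 = 0 := by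
  obtain ⟨q, hq, hfix, hslope⟩ := h
  have hpair := isGaussianPair_gaussianReal √q √q
  simp only [sq (relu _), sq (deriv relu _)] at hfix hslope
  rw [hpair.integral_eq_pairing (measurable_deriv _) (measurable_deriv _), hpair.pairing_deriv_relu]
    at hslope
  simp only [and_self, hpair.measureReal_left_pos (by positivity)] at hslope
  rw [hpair.integral_eq_pairing measurable_relu measurable_relu, ← sq, Real.sq_sqrt hq.le] at hfix
  have hself := hpair.two_mul_pairing_relu_self
  rw [Real.sq_sqrt hq.le] at hself
  have hw : σw ^ 2 = 2 := by linarith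
  exact ⟨hw, by rw [hw] at hfix; linarith⟩

end ReLU

section ReLUKernel

theorem decaysExponentially_two_mul_pairing_deriv_relu_sub_one {a b c : ℕ → ℝ} {q : ℝ}
    (h : ∀ l, IsCovariance (a l) (b l) (c l)) (hq : 0 < q)
    (ha : DecaysExponentially fun l => a l - q) (hb : DecaysExponentially fun l => b l - q)
    (hc : DecaysExponentially fun l => c l - q) :
    DecaysExponentially fun l =>
      2 * pairing (deriv relu) (deriv relu) (a l) (b l) (c l) - 1 := by
  obtain ⟨α, C, hα0, hα1, hC, hgap⟩ := ((ha.add hb).sub (hc.const_mul 2)).exists_forall_le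
  set ε : ℕ → ℝ := fun l => C * α ^ l
  have hε l : 0 < ε l := mul_pos hC (pow_pos hα0 l)
  have hεdecay : DecaysExponentially ε :=
    .of_forall_le hα0 hα1 fun l => (Real.norm_of_nonneg (hε l).le).le
  refine DecaysExponentially.of_norm_le
    (((hεdecay.sqrt.sqrt.const_mul (√(q / 2))⁻¹).add hεdecay.sqrt).const_mul 2) ?_
  filter_upwards [ha.tendsto_zero.eventually (lt_mem_nhds (neg_lt_zero.2 (half_pos hq)))] with l hl
  have hale : q / 2 ≤ a l := by linarith
  have hsqrt := Real.sqrt_pos.2 (hε l)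
  have hgap' : a l + b l - 2 * c l ≤ √(ε l) * √(ε l) := by
    rw [Real.mul_self_sqrt (hε l).le]
    linarith [(Real.le_norm_self _).trans (hgap l)]
  -- The threshold `t = ε ^ (1 / 4)` makes both error terms powers of `ε`.
  refine ((h l).isGaussianPair.abs_two_mul_pairing_deriv_relu_sub_one_le (by linarith)
    (Real.sqrt_pos.2 hsqrt)).trans ?_
  gcongr 2 * (?_ + ?_)
  · rw [inv_mul_eq_div]
    gcongr
  · rw [Real.sq_sqrt hsqrt.le]
    exact div_le_of_le_mul₀ hsqrt.le hsqrt.le hgap'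

variable {V : Type*} [Fintype V] {A : Matrix (V × V) (V × V) ℝ} {σw σb : ℝ} {R d : ℕ}
  {h : V → EuclideanSpace ℝ (Fin d)}

section

variable (hchaos : IsEdgeOfChaos relu σw σb) (hpsd : ∀ K, IsPSDKernel K → IsPSDKernel (A *ᵥ K))
include hpsd

theorem isPSDKernel_gpk_relu (l r : ℕ) : IsPSDKernel (gpk A relu σw σb R h l r) :=
  isPSDKernel_gpk hpsd measurable_relu memLp_relu_mul_gaussianReal l r

include hchaos

theorem gpk_relu_succ (l r : ℕ) (u v : V) : gpk A relu σw σb R h l (r + 1) (u, v) =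
    2 * pairing relu relu (gpk A relu σw σb R h l r (u, u)) (gpk A relu σw σb R h l r (v, v))
      (gpk A relu σw σb R h l r (u, v)) := by
  simp only [gpk_succ, hchaos.relu_eq, add_zero,
    (isPSDKernel_gpk_relu hpsd l r).gaussianPairing_eq]

theorem monotone_gpk_relu (l : ℕ) : Monotone (gpk A relu σw σb R h l) :=
  monotone_nat_of_le_succ fun r p => by
    rw [gpk_relu_succ hchaos hpsd]
    exact ((isPSDKernel_gpk_relu hpsd l r).isCovariance p.1 p.2).isGaussianPair
      |>.le_two_mul_pairing_relu

theorem gpk_relu_diag (l r : ℕ) (u : V) :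
    gpk A relu σw σb R h l r (u, u) = gpk A relu σw σb R h l 0 (u, u) := by
  induction r with
  | zero => rfl
  | succ r ih =>
    rw [gpk_relu_succ hchaos hpsd, ← ih]
    exact ((isPSDKernel_gpk_relu hpsd l r).isCovariance u u).isGaussianPair
      |>.two_mul_pairing_relu_self

theorem gpk_relu_le {b : ℝ} {l : ℕ} (hb : ∀ p, gpk A relu σw σb R h l 0 p ≤ b) (r : ℕ) (p : V × V) :
    gpk A relu σw σb R h l r p ≤ b :=
  (isPSDKernel_gpk_relu hpsd l r).apply_le
    (fun u => (gpk_relu_diag hchaos hpsd l r u).trans_le (hb (u, u))) p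

theorem gpk_relu_nonneg (l r : ℕ) (p : V × V) : 0 ≤ gpk A relu σw σb R h l (r + 1) p := by
  rw [gpk_relu_succ hchaos hpsd]
  exact mul_nonneg two_pos.le
    ((isPSDKernel_gpk_relu hpsd l r).isCovariance p.1 p.2).isGaussianPair.pairing_relu_nonneg

theorem mulVec_gpk_relu_le (l r : ℕ) :
    A *ᵥ gpk A relu σw σb R h l R ≤ gpk A relu σw σb R h (l + 1) r :=
  (gpk_succ_zero l).symm.trans_le (monotone_gpk_relu hchaos hpsd (l + 1) zero_le)

theorem gpk_relu_zero (l r : ℕ) :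
    gpk A relu σw σb R (0 : V → EuclideanSpace ℝ (Fin d)) l r = 0 := by
  refine layer_induction
    (P := fun l r => gpk A relu σw σb R (0 : V → EuclideanSpace ℝ (Fin d)) l r = 0) R ?_
    (fun l hl => ?_) (fun l r hr => funext fun p => ?_) l r
  · simp only [gpk_zero_zero, Pi.zero_apply, inner_zero_left]
    rfl
  · rw [gpk_succ_zero, hl, mulVec_zero]
  · rw [gpk_relu_succ hchaos hpsd, hr]
    have hzero : IsCovariance 0 0 0 := fun s t => by simp
    exact hzero.isGaussianPair.two_mul_pairing_relu_self

theorem gntk_relu_zero (l r : ℕ) :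
    gntk A relu σw σb R (0 : V → EuclideanSpace ℝ (Fin d)) l r = 0 := by
  have hgpk l r := gpk_relu_zero hchaos hpsd (R := R) (d := d) l r
  refine layer_induction
    (P := fun l r => gntk A relu σw σb R (0 : V → EuclideanSpace ℝ (Fin d)) l r = 0) R ?_
    (fun l hl => ?_) (fun l r hr => funext fun p => ?_) l r
  · rw [gntk, hgpk]
  · rw [gntk_succ_zero, hl, mulVec_zero]
  · simp only [gntk_succ, hr, hgpk, Pi.zero_apply, zero_mul, add_zero]

end

variable [DecidableEq V]

theorem exists_decaysExponentially_gpk_relu [Nonempty V] (hchaos : IsEdgeOfChaos relu σw σb)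
    (hpsd : ∀ K, IsPSDKernel K → IsPSDKernel (A *ᵥ K)) (hA : A ∈ rowStochastic ℝ (V × V))
    (hprim : A.IsPrimitive) :
    ∃ q, (∀ l m, (∀ p, m ≤ gpk A relu σw σb R h l R p) → m ≤ q) ∧
      ∀ r p, DecaysExponentially fun l => gpk A relu σw σb R h l r p - q := by
  have hbound (l r : ℕ) (b : ℝ) (hb : ∀ p, gpk A relu σw σb R h l R p ≤ b) :
      ∀ p, gpk A relu σw σb R h (l + 1) r p ≤ b :=
    gpk_relu_le hchaos hpsd (by simpa only [gpk_succ_zero] using mulVec_le_const hA hb) r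
  obtain ⟨q, hq, hdecay⟩ := exists_decaysExponentially_of_monotone_iteration hA hprim
    (fun l => mulVec_gpk_relu_le hchaos hpsd l R) (fun l => hbound l R)
  refine ⟨q, hq, fun r p =>
    .of_comp_add_nat (k := 1) (hdecay.norm.of_norm_le (.of_forall fun l => ?_))⟩
  set ε := ‖gpk A relu σw σb R h l R - fun _ => q‖
  have hε (p : V × V) : |gpk A relu σw σb R h l R p - q| ≤ ε :=
    norm_le_pi_norm (gpk A relu σw σb R h l R - fun _ => q) p
  have hlow : q - ε ≤ gpk A relu σw σb R h (l + 1) r p :=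
    (const_le_mulVec hA (fun p => by linarith [(abs_le.1 (hε p)).1]) p).trans
      (mulVec_gpk_relu_le hchaos hpsd l r p)
  have hup : gpk A relu σw σb R h (l + 1) r p ≤ q + ε :=
    hbound l r _ (fun p => by linarith [(abs_le.1 (hε p)).2]) p
  exact abs_le.2 ⟨by linarith, by linarith⟩

theorem gpk_relu_limit_pos (hchaos : IsEdgeOfChaos relu σw σb)
    (hpsd : ∀ K, IsPSDKernel K → IsPSDKernel (A *ᵥ K)) (hA : A ∈ rowStochastic ℝ (V × V))
    (hprim : A.IsPrimitive) (hR : 0 < R) (hh : h ≠ 0) {q : ℝ}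
    (hq : ∀ l m, (∀ p, m ≤ gpk A relu σw σb R h l R p) → m ≤ q) : 0 < q := by
  obtain ⟨u, hu⟩ := Function.ne_iff.1 hh
  obtain ⟨k, -, c, hc, hpow⟩ := exists_pow_lower_bound hprim
  set x : ℕ → V × V → ℝ := fun l => gpk A relu σw σb R h l R
  have hx0 : 0 ≤ x 0 := fun p => by
    obtain ⟨r, rfl⟩ := Nat.exists_eq_add_of_lt hR
    exact gpk_relu_nonneg hchaos hpsd 0 _ p
  have hxu : x 0 (u, u) = ‖h u‖ ^ 2 := by
    simp only [x, gpk_relu_diag hchaos hpsd, gpk_zero_zero, real_inner_self_eq_norm_sq]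
  have hlow (p : V × V) : c * x 0 (u, u) ≤ x k p :=
    calc c * x 0 (u, u) ≤ (A ^ k) p (u, u) * x 0 (u, u) :=
          mul_le_mul_of_nonneg_right (hpow p (u, u)) (hx0 _)
      _ ≤ (A ^ k *ᵥ x 0) p :=
          Finset.single_le_sum (f := fun j => (A ^ k) p j * x 0 j)
            (fun j _ => mul_nonneg (pow_apply_nonneg hA.1 k p j) (hx0 j)) (Finset.mem_univ _)
      _ ≤ x k p := pow_mulVec_le_of_mulVec_le hA.1
          (fun l => mulVec_gpk_relu_le hchaos hpsd l R) k p
  refine lt_of_lt_of_le ?_ (hq k _ hlow)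
  rw [hxu]
  exact mul_pos hc (pow_pos (norm_pos_iff.2 hu) 2)

theorem exists_gntk_relu_asymptotics [Nonempty V] (hchaos : IsEdgeOfChaos relu σw σb)
    (hpsd : ∀ K, IsPSDKernel K → IsPSDKernel (A *ᵥ K)) (hA : A ∈ rowStochastic ℝ (V × V))
    (hprim : A.IsPrimitive) {π : V × V → ℝ} (hπ : IsStationaryDistribution A π) :
    ∃ α C : ℝ, 0 < α ∧ α < 1 ∧ 0 < C ∧
      ∃ v : V × V → ℝ, ∀ r ≤ R, ∃ v' : V × V → ℝ, ∀ (l : ℕ) (u u' : V),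
        |gntk A relu σw σb R h l r (u, u') - π ⬝ᵥ (((R : ℝ) * (l : ℝ)) • v + v')| ≤
          C * α ^ l := by
  rcases eq_or_ne h 0 with rfl | hh
  · refine ⟨1 / 2, 1, by norm_num, by norm_num, one_pos, 0, fun r _ => ⟨0, fun l u u' => ?_⟩⟩
    rw [gntk_relu_zero hchaos hpsd]
    simp
  obtain ⟨q, hlow, hdecay⟩ := exists_decaysExponentially_gpk_relu (h := h) hchaos hpsd hA hprim
  refine exists_gntk_asymptotics hA hprim hπ (fun r _ => hdecay (r + 1)) fun r hr p => ?_
  have hq : 0 < q := gpk_relu_limit_pos hchaos hpsd hA hprim (pos_of_gt hr) hh hlow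
  have hpsd' l := isPSDKernel_gpk_relu (A := A) (σw := σw) (σb := σb) (R := R) (h := h) hpsd l r
  simp only [gpkDeriv, hchaos.relu_eq.1, fun l =>
    (hpsd' l).gaussianPairing_eq (deriv relu) p.1 p.2]
  exact decaysExponentially_two_mul_pairing_deriv_relu_sub_one
    (fun l => (hpsd' l).isCovariance p.1 p.2) hq (hdecay r _) (hdecay r _) (hdecay r _)

end ReLUKernel

section Stein

/-- `f` is bounded and continuously differentiable, with bounded derivative `f'`: the regularity
under which the Gaussian integrations by parts below are carried out. -/
structure IsBoundedC1 (f f' : ℝ → ℝ) : Prop where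
  hasDerivAt (x : ℝ) : HasDerivAt f (f' x) x
  continuous_deriv : Continuous f'
  exists_abs_le : ∃ B, ∀ x, |f x| ≤ B
  exists_abs_deriv_le : ∃ B, ∀ x, |f' x| ≤ B

namespace IsBoundedC1

variable {f f' : ℝ → ℝ}

theorem continuous (hf : IsBoundedC1 f f') : Continuous f :=
  continuous_iff_continuousAt.2 fun x => (hf.hasDerivAt x).continuousAt

theorem comp_affine (hf : IsBoundedC1 f f') (p q : ℝ) :
    IsBoundedC1 (fun x => f (p + q * x)) fun x => q * f' (p + q * x) where
  hasDerivAt x := by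
    have haffine : HasDerivAt (fun x => p + q * x) q x := by
      simpa using ((hasDerivAt_id x).const_mul q).const_add p
    exact ((hf.hasDerivAt _).comp x haffine).congr_deriv (mul_comm _ _)
  continuous_deriv := by
    have := hf.continuous_deriv
    fun_prop
  exists_abs_le := hf.exists_abs_le.imp fun B hB x => hB _
  exists_abs_deriv_le := by
    obtain ⟨B, hB⟩ := hf.exists_abs_deriv_le
    refine ⟨|q| * B, fun x => ?_⟩
    rw [abs_mul]
    gcongr
    exact hB _

variable {Ω : Type*} [MeasurableSpace Ω] {μ : Measure Ω} {X : Ω → ℝ}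

theorem integrable_comp [IsFiniteMeasure μ] (hf : IsBoundedC1 f f') (hX : Measurable X) :
    Integrable (fun ω => f (X ω)) μ := by
  obtain ⟨B, hB⟩ := hf.exists_abs_le
  exact .of_bound (hf.continuous.measurable.comp hX).aestronglyMeasurable B
    (.of_forall fun ω => hB _)

theorem integrable_deriv_comp [IsFiniteMeasure μ] (hf : IsBoundedC1 f f') (hX : Measurable X) :
    Integrable (fun ω => f' (X ω)) μ := by
  obtain ⟨B, hB⟩ := hf.exists_abs_deriv_le
  exact .of_bound (hf.continuous_deriv.measurable.comp hX).aestronglyMeasurable B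
    (.of_forall fun ω => hB _)

theorem integrable_comp_mul (hf : IsBoundedC1 f f') (hX : Measurable X) {Y : Ω → ℝ}
    (hY : Integrable Y μ) : Integrable (fun ω => f (X ω) * Y ω) μ := by
  obtain ⟨B, hB⟩ := hf.exists_abs_le
  exact hY.bdd_mul (hf.continuous.measurable.comp hX).aestronglyMeasurable
    (.of_forall fun ω => hB _)

theorem integrable_deriv_comp_mul (hf : IsBoundedC1 f f') (hX : Measurable X) {Y : Ω → ℝ}
    (hY : Integrable Y μ) : Integrable (fun ω => f' (X ω) * Y ω) μ := by
  obtain ⟨B, hB⟩ := hf.exists_abs_deriv_le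
  exact hY.bdd_mul (hf.continuous_deriv.measurable.comp hX).aestronglyMeasurable
    (.of_forall fun ω => hB _)

end IsBoundedC1

theorem integrable_gaussianPDFReal_mul {g : ℝ → ℝ} (hg : Integrable g (gaussianReal 0 1)) :
    Integrable fun x => gaussianPDFReal 0 1 x * g x := by
  rw [gaussianReal_of_var_ne_zero 0 one_ne_zero,
    integrable_withDensity_iff_integrable_smul' (measurable_gaussianPDF 0 1)
      (.of_forall fun _ => gaussianPDF_lt_top)] at hg
  simpa [toReal_gaussianPDF] using hg

theorem hasDerivAt_gaussianPDFReal (x : ℝ) :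
    HasDerivAt (gaussianPDFReal 0 1) (-(x * gaussianPDFReal 0 1 x)) x := by
  have hexponent : HasDerivAt (fun x : ℝ => -(x - 0) ^ 2 / (2 * ((1 : NNReal) : ℝ))) (-x) x := by
    refine ((((hasDerivAt_id' x).sub_const 0).fun_pow 2).fun_neg.div_const
      (2 * ((1 : NNReal) : ℝ))).congr_deriv ?_
    push_cast
    ring
  refine (hexponent.exp.const_mul (√(2 * Real.pi * ((1 : NNReal) : ℝ)))⁻¹).congr_deriv ?_
  unfold gaussianPDFReal
  ring

theorem integrable_id_gaussianReal : Integrable (fun x : ℝ => x) (gaussianReal 0 1) :=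
  (memLp_id_gaussianReal 1).integrable le_rfl

/-- Integration by parts against the Gaussian density `ρ`, for which `ρ' = -xρ`. -/
theorem IsBoundedC1.integral_mul_gaussianReal {f f' : ℝ → ℝ} (hf : IsBoundedC1 f f') :
    ∫ x, f x * x ∂(gaussianReal 0 1) = ∫ x, f' x ∂(gaussianReal 0 1) := by
  have hparts := integral_mul_deriv_eq_deriv_mul_of_integrable (u := f) (u' := f')
    (v := gaussianPDFReal 0 1) (v' := fun x => -(x * gaussianPDFReal 0 1 x))
    (fun x _ => hf.hasDerivAt x) (fun x _ => hasDerivAt_gaussianPDFReal x)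
    ((integrable_gaussianPDFReal_mul
      (hf.integrable_comp_mul measurable_id integrable_id_gaussianReal)).neg.congr
        (.of_forall fun x => by simp only [Pi.neg_apply, Pi.mul_apply, id_eq]; ring))
    ((integrable_gaussianPDFReal_mul (hf.integrable_deriv_comp measurable_id)).congr
      (.of_forall fun x => mul_comm _ _))
    ((integrable_gaussianPDFReal_mul (hf.integrable_comp measurable_id)).congr
      (.of_forall fun x => mul_comm _ _))
  rw [integral_gaussianReal_eq_integral_smul one_ne_zero,
    integral_gaussianReal_eq_integral_smul one_ne_zero]
  have hdensity (x : ℝ) :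
      gaussianPDFReal 0 1 x • (f x * x) = -(f x * -(x * gaussianPDFReal 0 1 x)) := by
    rw [smul_eq_mul]
    ring
  simp only [hdensity]
  rw [integral_neg, hparts, neg_neg]
  simp only [smul_eq_mul, mul_comm]

theorem IsBoundedC1.integral_comp_mul_gaussianReal {f f' : ℝ → ℝ} (hf : IsBoundedC1 f f') (σ : ℝ) :
    ∫ x, f (σ * x) * x ∂(gaussianReal 0 1) = σ * ∫ x, f' (σ * x) ∂(gaussianReal 0 1) := by
  simpa only [zero_add, integral_const_mul] using (hf.comp_affine 0 σ).integral_mul_gaussianReal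

namespace IsCovariance

variable {a b c : ℝ}

theorem sq_le (h : IsCovariance a b c) : c ^ 2 ≤ a * b := by
  simpa [det_fin_two, sq] using h.posSemidef.det_nonneg

theorem sq_div_le (h : IsCovariance a b c) : c ^ 2 / a ≤ b :=
  div_le_of_le_mul₀ h.left_nonneg h.right_nonneg (h.sq_le.trans_eq (mul_comm a b))

theorem isGaussianPair_gaussianReal (h : IsCovariance a b c) :
    IsGaussianPair (gaussianReal 0 1) (fun x => √a * x) (fun x => c / √a * x) a (c ^ 2 / a) c := by
  convert GNTK.isGaussianPair_gaussianReal (√a) (c / √a) using 1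
  · rw [Real.sq_sqrt h.left_nonneg]
  · rw [div_pow, Real.sq_sqrt h.left_nonneg]
  · rcases h.left_nonneg.eq_or_lt with rfl | ha
    · simpa using h.sq_le
    · rw [mul_div_cancel₀ _ (Real.sqrt_pos.2 ha).ne']

theorem isGaussianPair_prod_gaussianReal (h : IsCovariance a b c) :
    IsGaussianPair ((gaussianReal 0 1).prod (gaussianReal 0 1)) (fun p => √a * p.1)
      (fun p => c / √a * p.1 + √(b - c ^ 2 / a) * p.2) a b c := by
  have hprod := h.isGaussianPair_gaussianReal.prod
    (GNTK.isGaussianPair_gaussianReal 0 √(b - c ^ 2 / a))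
  rw [Real.sq_sqrt (sub_nonneg.2 h.sq_div_le), add_sub_cancel] at hprod
  simpa using hprod

end IsCovariance

theorem IsGaussianPair.integral_comp_mul {Ω : Type*} [MeasurableSpace Ω] {μ : Measure Ω}
    [IsProbabilityMeasure μ] {X Y : Ω → ℝ} {a b c : ℝ} (h : IsGaussianPair μ X Y a b c)
    {f f' : ℝ → ℝ} (hf : IsBoundedC1 f f') :
    ∫ ω, f (X ω) * Y ω ∂μ = c * ∫ ω, f' (X ω) ∂μ := by
  have hX : ∫ ω, f' (X ω) ∂μ = ∫ x, f' (√a * x) ∂(gaussianReal 0 1) :=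
    (h.identDistrib_left.comp hf.continuous_deriv.measurable).integral_eq
  have hrealize := h.isCovariance.isGaussianPair_prod_gaussianReal
  have hf' := hf.continuous.measurable
  rw [hX]
  calc ∫ ω, f (X ω) * Y ω ∂μ
    _ = ∫ p : ℝ × ℝ, f (√a * p.1) * (c / √a * p.1 + √(b - c ^ 2 / a) * p.2)
          ∂((gaussianReal 0 1).prod (gaussianReal 0 1)) :=
      (h.integral_eq_pairing hf' measurable_id).trans
        (hrealize.integral_eq_pairing hf' measurable_id).symm
    _ = ∫ p : ℝ × ℝ, (c / √a * (f (√a * p.1) * p.1 * 1) +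
          √(b - c ^ 2 / a) * (f (√a * p.1) * p.2))
          ∂((gaussianReal 0 1).prod (gaussianReal 0 1)) := by
      congr with p
      ring
    _ = c / √a * ∫ x, f (√a * x) * x ∂(gaussianReal 0 1) := by
      have hfst := hf.integrable_comp_mul (measurable_const_mul (√a)) integrable_id_gaussianReal
      have hsnd := (hf.integrable_comp (μ := gaussianReal 0 1)
        (measurable_const_mul (√a))).mul_prod integrable_id_gaussianReal
      rw [integral_add ((hfst.mul_prod (integrable_const 1)).const_mul _) (hsnd.const_mul _),
        integral_const_mul, integral_const_mul,
        integral_prod_mul (fun x => f (√a * x) * x) (fun _ => (1 : ℝ)),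
        integral_prod_mul (fun x => f (√a * x)) (fun x : ℝ => x)]
      simp
    _ = c * ∫ x, f' (√a * x) ∂(gaussianReal 0 1) := by
      rw [hf.integral_comp_mul_gaussianReal]
      rcases h.isCovariance.left_nonneg.eq_or_lt with rfl | ha
      · obtain rfl : c = 0 := by
          simpa using h.isCovariance.sq_le
        simp
      · rw [← mul_assoc, div_mul_cancel₀ _ (Real.sqrt_pos.2 ha).ne']

end Stein

section Price

variable {Ω : Type*} [MeasurableSpace Ω] {μ : Measure Ω} {X Y : Ω → ℝ} {f f' g g' : ℝ → ℝ}
  {a b c : ℝ}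

namespace IsGaussianPair

theorem rotate_right [SFinite μ] (h : IsGaussianPair μ X Y a b c) (s : ℝ) :
    IsGaussianPair (μ.prod μ) (fun p => X p.1) (fun p => Real.cos s * Y p.1 + Real.sin s * Y p.2)
      a b (Real.cos s * c) := by
  have hs := Real.cos_sq_add_sin_sq s
  convert (h.linear 1 0 0 (Real.cos s)).prod (h.linear 0 0 0 (Real.sin s)) using 1
  · simp
  · simp
  · ring
  · linear_combination (-b) * hs
  · ring

theorem rotate_left [SFinite μ] (h : IsGaussianPair μ X Y a b c) (s : ℝ) :
    IsGaussianPair (μ.prod μ) (fun p => Real.cos s * X p.1 - Real.sin s * X p.2) (fun p => Y p.1)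
      a b (Real.cos s * c) := by
  simpa [sub_eq_add_neg] using (h.symm.rotate_right (-s)).symm

variable [IsProbabilityMeasure μ]

theorem hasDerivAt_pairing_rotate (h : IsGaussianPair μ X Y a b c) (hf : IsBoundedC1 f f')
    (hg : IsBoundedC1 g g') (s : ℝ) :
    HasDerivAt (fun s => pairing f g a b (Real.cos s * c))
      (∫ p, f (X p.1) * (g' (Real.cos s * Y p.1 + Real.sin s * Y p.2) *
        (-Real.sin s * Y p.1 + Real.cos s * Y p.2)) ∂(μ.prod μ)) s := by
  obtain ⟨B, hB⟩ := hf.exists_abs_le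
  obtain ⟨B', hB'⟩ := hg.exists_abs_deriv_le
  have hB0 : 0 ≤ B := (abs_nonneg _).trans (hB 0)
  have hB0' : 0 ≤ B' := (abs_nonneg _).trans (hB' 0)
  have hX := h.measurable_left
  have hY := h.measurable_right
  have hYint : Integrable (fun ω => |Y ω|) μ := (h.memLp_right.integrable one_le_two).abs
  have hfm := hf.continuous.measurable
  have hgm := hg.continuous.measurable
  have hgm' := hg.continuous_deriv.measurable
  simp only [← fun s => (h.rotate_right s).integral_eq_pairing hfm hgm]
  have hbound : Integrable (fun p : Ω × Ω => B * (B' * (|Y p.1| + |Y p.2|))) (μ.prod μ) :=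
    (((hYint.comp_fst μ).add (hYint.comp_snd μ)).const_mul _).const_mul _
  have hint : Integrable (fun p : Ω × Ω =>
      f (X p.1) * g (Real.cos s * Y p.1 + Real.sin s * Y p.2)) (μ.prod μ) :=
    hf.integrable_comp_mul (by fun_prop) (hg.integrable_comp (by fun_prop))
  refine (hasDerivAt_integral_of_dominated_loc_of_deriv_le (s := Set.univ)
    (F := fun s p => f (X p.1) * g (Real.cos s * Y p.1 + Real.sin s * Y p.2))
    (F' := fun s p => f (X p.1) * (g' (Real.cos s * Y p.1 + Real.sin s * Y p.2) *
      (-Real.sin s * Y p.1 + Real.cos s * Y p.2)))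
    Filter.univ_mem (.of_forall fun s => Measurable.aestronglyMeasurable (by fun_prop)) hint
    (Measurable.aestronglyMeasurable (by fun_prop)) (.of_forall fun p s _ => ?_) hbound
    (.of_forall fun p s _ => ?_)).2
  · rw [Real.norm_eq_abs, abs_mul, abs_mul]
    gcongr
    · exact hB _
    · exact hB' _
    · refine (abs_add_le _ _).trans ?_
      rw [abs_mul, abs_mul, abs_neg]
      exact add_le_add (mul_le_of_le_one_left (abs_nonneg _) (Real.abs_sin_le_one s))
        (mul_le_of_le_one_left (abs_nonneg _) (Real.abs_cos_le_one s))
  · exact ((hg.hasDerivAt _).comp s (((Real.hasDerivAt_cos s).mul_const _).add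
      ((Real.hasDerivAt_sin s).mul_const _))).const_mul _

theorem integral_rotate_mul (h : IsGaussianPair μ X Y a b c) (hf : IsBoundedC1 f f')
    (hg : IsBoundedC1 g g') (s : ℝ) :
    ∫ p, f (Real.cos s * X p.1 - Real.sin s * X p.2) * (g' (Y p.1) * Y p.2) ∂(μ.prod μ) =
      -Real.sin s * c * pairing f' g' a b (Real.cos s * c) := by
  have hX := h.measurable_left
  have hY := h.measurable_right
  have hYint : Integrable Y μ := h.memLp_right.integrable one_le_two
  have hYfst : Measurable fun p : Ω × Ω => Y p.1 := by fun_prop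
  have hstein (ω : Ω) : ∫ ω', f (Real.cos s * X ω - Real.sin s * X ω') * Y ω' ∂μ =
      -Real.sin s * c * ∫ ω', f' (Real.cos s * X ω - Real.sin s * X ω') ∂μ := by
    have := h.integral_comp_mul (hf.comp_affine (Real.cos s * X ω) (-Real.sin s))
    simp only [neg_mul, ← sub_eq_add_neg, integral_neg, integral_const_mul] at this ⊢
    linarith
  rw [← (h.rotate_left s).integral_eq_pairing hf.continuous_deriv.measurable
      hg.continuous_deriv.measurable,
    integral_prod _ (hf.integrable_comp_mul (by fun_prop)
      (hg.integrable_deriv_comp_mul hYfst (hYint.comp_snd μ))),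
    integral_prod _ (hf.integrable_deriv_comp_mul (by fun_prop)
      (hg.integrable_deriv_comp hYfst)), ← integral_const_mul]
  congr with ω
  calc ∫ ω', f (Real.cos s * X ω - Real.sin s * X ω') * (g' (Y ω) * Y ω') ∂μ
    _ = g' (Y ω) * ∫ ω', f (Real.cos s * X ω - Real.sin s * X ω') * Y ω' ∂μ := by
      rw [← integral_const_mul]
      congr with ω'
      ring
    _ = _ := by
      simp only [hstein, integral_mul_const]
      ring

end IsGaussianPair

namespace IsCovariance

theorem continuous_pairing_cos (h : IsCovariance a b c) (hf : Continuous f) (hg : Continuous g)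
    {B B' : ℝ} (hB : ∀ x, |f x| ≤ B) (hB' : ∀ x, |g x| ≤ B') :
    Continuous fun s => pairing f g a b (Real.cos s * c) := by
  simp only [← fun s => (h.isGaussianPair.rotate_right s).integral_eq_pairing hf.measurable
    hg.measurable]
  refine continuous_of_dominated (bound := fun _ => B * B')
    (fun s => Continuous.aestronglyMeasurable (by fun_prop)) (fun s => .of_forall fun p => ?_)
    (integrable_const _) (.of_forall fun p => by fun_prop)
  rw [Real.norm_eq_abs, abs_mul]
  exact mul_le_mul (hB _) (hB' _) (abs_nonneg _) ((abs_nonneg _).trans (hB 0))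

/-- Rotating two independent copies of the pair by the angle `s` turns the derivative at `s` into an
integral to which Stein's identity applies in the second copy. -/
theorem hasDerivAt_pairing_cos (h : IsCovariance a b c) (hf : IsBoundedC1 f f')
    (hg : IsBoundedC1 g g') (s : ℝ) :
    HasDerivAt (fun s => pairing f g a b (Real.cos s * c))
      (-Real.sin s * c * pairing f' g' a b (Real.cos s * c)) s := by
  refine (h.isGaussianPair.hasDerivAt_pairing_rotate hf hg s).congr_deriv ?_
  rw [← h.isGaussianPair.integral_rotate_mul hf hg s]
  set μ := multivariateGaussian (0 : EuclideanSpace ℝ (Fin 2)) !![a, c; c, b] with hμ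
  have hrotate : (μ.prod μ).map (ContinuousLinearMap.rotation s) = μ.prod μ :=
    IsGaussian.map_rotation_eq_self (by simp [hμ]) s
  have hfm := hf.continuous.measurable
  have hgm' := hg.continuous_deriv.measurable
  nth_rw 2 [← hrotate]
  rw [integral_map (by fun_prop) (Measurable.aestronglyMeasurable (by fun_prop))]
  congr with p
  simp only [ContinuousLinearMap.rotation_apply, PiLp.add_apply, PiLp.smul_apply, smul_eq_mul]
  congr 2
  linear_combination (-(p.1 0)) * Real.cos_sq_add_sin_sq s

theorem pairing_eq_add_mul_integral (h : IsCovariance a b c) (hf : IsBoundedC1 f f')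
    (hg : IsBoundedC1 g g') :
    pairing f g a b c = pairing f g a b 0 +
      c * ∫ s in (0 : ℝ)..(Real.pi / 2), Real.sin s * pairing f' g' a b (Real.cos s * c) := by
  obtain ⟨B, hB⟩ := hf.exists_abs_deriv_le
  obtain ⟨B', hB'⟩ := hg.exists_abs_deriv_le
  have hcont := h.continuous_pairing_cos hf.continuous_deriv hg.continuous_deriv hB hB'
  have hderiv (s : ℝ) : -Real.sin s * c * pairing f' g' a b (Real.cos s * c) =
      -c * (Real.sin s * pairing f' g' a b (Real.cos s * c)) := by ring
  have hftc := intervalIntegral.integral_eq_sub_of_hasDerivAt (a := 0) (b := Real.pi / 2)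
    (fun s _ => h.hasDerivAt_pairing_cos hf hg s)
    (Continuous.intervalIntegrable (by fun_prop) _ _)
  simp only [hderiv, intervalIntegral.integral_const_mul, Real.cos_pi_div_two, Real.cos_zero,
    zero_mul, one_mul] at hftc
  linarith

end IsCovariance

end Price

section Tanh

theorem hasDerivAt_tanh (x : ℝ) : HasDerivAt Real.tanh (1 - Real.tanh x ^ 2) x := by
  have hcosh := (Real.cosh_pos x).ne'
  have hquot : Real.tanh = fun x => Real.sinh x / Real.cosh x :=
    funext Real.tanh_eq_sinh_div_cosh
  rw [hquot]
  refine ((Real.hasDerivAt_sinh x).fun_div (Real.hasDerivAt_cosh x) hcosh).congr_deriv ?_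
  field_simp

theorem deriv_tanh (x : ℝ) : deriv Real.tanh x = 1 - Real.tanh x ^ 2 := (hasDerivAt_tanh x).deriv

theorem continuous_tanh : Continuous Real.tanh :=
  continuous_iff_continuousAt.2 fun x => (hasDerivAt_tanh x).continuousAt

theorem continuous_deriv_tanh : Continuous (deriv Real.tanh) := by
  have := continuous_tanh
  rw [funext deriv_tanh]
  fun_prop

theorem abs_tanh_le_one (x : ℝ) : |Real.tanh x| ≤ 1 := (Real.abs_tanh_lt_one x).le

theorem deriv_tanh_pos (x : ℝ) : 0 < deriv Real.tanh x := by
  rw [deriv_tanh]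
  exact sub_pos.2 (Real.tanh_sq_lt_one x)

theorem deriv_tanh_le_one (x : ℝ) : deriv Real.tanh x ≤ 1 := by
  rw [deriv_tanh]
  exact sub_le_self 1 (sq_nonneg _)

theorem abs_deriv_tanh_le_one (x : ℝ) : |deriv Real.tanh x| ≤ 1 :=
  (abs_of_pos (deriv_tanh_pos x)).trans_le (deriv_tanh_le_one x)

theorem isBoundedC1_tanh : IsBoundedC1 Real.tanh (deriv Real.tanh) where
  hasDerivAt x := (hasDerivAt_tanh x).differentiableAt.hasDerivAt
  continuous_deriv := continuous_deriv_tanh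
  exists_abs_le := ⟨1, abs_tanh_le_one⟩
  exists_abs_deriv_le := ⟨1, abs_deriv_tanh_le_one⟩

theorem strictMono_tanh : StrictMono Real.tanh := strictMono_of_deriv_pos deriv_tanh_pos

theorem tanh_nonneg {x : ℝ} (hx : 0 ≤ x) : 0 ≤ Real.tanh x := by
  simpa using strictMono_tanh.monotone hx

theorem tanh_abs (x : ℝ) : Real.tanh |x| = |Real.tanh x| := by
  rcases le_total 0 x with hx | hx
  · rw [abs_of_nonneg hx, abs_of_nonneg (tanh_nonneg hx)]
  · have := tanh_nonneg (neg_nonneg.2 hx)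
    rw [Real.tanh_neg] at this
    rw [abs_of_nonpos hx, Real.tanh_neg, abs_of_nonpos (neg_nonneg.1 this)]

theorem tanh_sq_le_tanh_sq {x y : ℝ} (h : |x| ≤ |y|) : Real.tanh x ^ 2 ≤ Real.tanh y ^ 2 := by
  rw [sq_le_sq, ← tanh_abs, ← tanh_abs]
  exact strictMono_tanh.monotone h

theorem mul_tanh_le_tanh_mul {s x : ℝ} (hs0 : 0 ≤ s) (hs1 : s ≤ 1) (hx : 0 ≤ x) :
    s * Real.tanh x ≤ Real.tanh (s * x) := by
  have hderiv (x : ℝ) : HasDerivAt (fun x => Real.tanh (s * x) - s * Real.tanh x)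
      (s * (Real.tanh x ^ 2 - Real.tanh (s * x) ^ 2)) x :=
    (((hasDerivAt_tanh (s * x)).comp x ((hasDerivAt_id' x).const_mul s)).sub
      ((hasDerivAt_tanh x).const_mul s)).congr_deriv (by ring)
  have hmono : MonotoneOn (fun x => Real.tanh (s * x) - s * Real.tanh x) (Set.Ici 0) := by
    refine monotoneOn_of_deriv_nonneg (convex_Ici 0)
      (fun x _ => (hderiv x).continuousAt.continuousWithinAt)
      (fun x _ => (hderiv x).differentiableAt.differentiableWithinAt) fun x _ => ?_
    rw [(hderiv x).deriv]
    refine mul_nonneg hs0 (sub_nonneg.2 (tanh_sq_le_tanh_sq ?_))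
    rw [abs_mul, abs_of_nonneg hs0]
    exact mul_le_of_le_one_left (abs_nonneg x) hs1
  simpa using hmono Set.self_mem_Ici hx hx

theorem sq_mul_tanh_sq_le {s : ℝ} (hs0 : 0 ≤ s) (hs1 : s ≤ 1) (x : ℝ) :
    s ^ 2 * Real.tanh x ^ 2 ≤ Real.tanh (s * x) ^ 2 := by
  rw [← mul_pow, sq_le_sq, abs_mul, ← tanh_abs, ← tanh_abs, abs_mul, abs_of_nonneg hs0]
  exact mul_tanh_le_tanh_mul hs0 hs1 (abs_nonneg x)

theorem tanh_add_add_tanh_sub (x y : ℝ) : Real.tanh (x + y) + Real.tanh (x - y) =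
    2 * Real.sinh x * Real.cosh x / (Real.cosh x ^ 2 + Real.sinh y ^ 2) := by
  have hadd := (Real.cosh_pos (x + y)).ne'
  have hsub := (Real.cosh_pos (x - y)).ne'
  have hden : Real.cosh x ^ 2 + Real.sinh y ^ 2 ≠ 0 := by
    have := Real.cosh_pos x
    positivity
  rw [Real.tanh_eq_sinh_div_cosh, Real.tanh_eq_sinh_div_cosh, div_add_div _ _ hadd hsub,
    div_eq_div_iff (mul_ne_zero hadd hsub) hden, Real.cosh_add, Real.cosh_sub, Real.sinh_add,
    Real.sinh_sub]
  linear_combination (2 * Real.sinh x * Real.cosh x * Real.sinh y ^ 2) *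
    (Real.cosh_sq y - Real.cosh_sq x)

theorem tanh_add_add_tanh_sub_nonneg {x : ℝ} (hx : 0 ≤ x) (y : ℝ) :
    0 ≤ Real.tanh (x + y) + Real.tanh (x - y) := by
  have := Real.sinh_nonneg_iff.2 hx
  have := Real.cosh_pos x
  rw [tanh_add_add_tanh_sub]
  positivity

theorem tanh_add_add_tanh_sub_le {x : ℝ} (hx : 0 ≤ x) (y : ℝ) :
    Real.tanh (x + y) + Real.tanh (x - y) ≤ 2 * Real.tanh x := by
  have hsinh := Real.sinh_nonneg_iff.2 hx
  have hcosh := Real.cosh_pos x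
  rw [tanh_add_add_tanh_sub, Real.tanh_eq_sinh_div_cosh, mul_div_assoc',
    div_le_div_iff₀ (by positivity) hcosh]
  nlinarith [mul_nonneg hsinh (sq_nonneg (Real.sinh y))]

theorem abs_tanh_sub_le (x y : ℝ) : |Real.tanh x - Real.tanh y| ≤ |x - y| := by
  simpa using convex_univ.norm_image_sub_le_of_norm_deriv_le (f := Real.tanh) (x := y) (y := x)
    (fun z _ => (hasDerivAt_tanh z).differentiableAt) (fun z _ => abs_deriv_tanh_le_one z)
    trivial trivial

theorem abs_deriv_tanh_sub_le (x y : ℝ) :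
    |deriv Real.tanh x - deriv Real.tanh y| ≤ 2 * |x - y| := by
  have hfactor : deriv Real.tanh x - deriv Real.tanh y =
      -((Real.tanh x + Real.tanh y) * (Real.tanh x - Real.tanh y)) := by
    rw [deriv_tanh, deriv_tanh]
    ring
  rw [hfactor, abs_neg, abs_mul]
  refine mul_le_mul ((abs_add_le _ _).trans ?_) (abs_tanh_sub_le x y) (abs_nonneg _) zero_le_two
  linarith [abs_tanh_le_one x, abs_tanh_le_one y]

end Tanh

section SingleLayer

/-- `𝔼[tanh(√q z)²]` for `z ∼ N(0,1)`: the second moment of the activations at pre-activation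
variance `q`. -/
noncomputable def tanhVariance (q : ℝ) : ℝ := ∫ x, Real.tanh (√q * x) ^ 2 ∂(gaussianReal 0 1)

/-- `𝔼[tanh'(√q z)²]` for `z ∼ N(0,1)`: the second moment of the activation slopes at
pre-activation variance `q`. -/
noncomputable def tanhSlope (q : ℝ) : ℝ := ∫ x, deriv Real.tanh (√q * x) ^ 2 ∂(gaussianReal 0 1)

section Integrable

variable {Ω : Type*} [MeasurableSpace Ω] {μ : Measure Ω} [IsFiniteMeasure μ] {f g : ℝ → ℝ}
  {X Y : Ω → ℝ}

theorem integrable_comp_mul_comp (hf : Continuous f) (hfB : ∀ x, |f x| ≤ 1) (hg : Continuous g)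
    (hgB : ∀ x, |g x| ≤ 1) (hX : Measurable X) (hY : Measurable Y) :
    Integrable (fun ω => f (X ω) * g (Y ω)) μ :=
  .of_bound ((hf.measurable.comp hX).mul (hg.measurable.comp hY)).aestronglyMeasurable 1
    (.of_forall fun _ => (abs_mul _ _).trans_le (mul_le_one₀ (hfB _) (abs_nonneg _) (hgB _)))

theorem integrable_comp_sq (hf : Continuous f) (hfB : ∀ x, |f x| ≤ 1) (hX : Measurable X) :
    Integrable (fun ω => f (X ω) ^ 2) μ := by
  simpa only [sq] using integrable_comp_mul_comp hf hfB hf hfB hX hX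

end Integrable

theorem integrable_tanh_sq (σ : ℝ) :
    Integrable (fun x => Real.tanh (σ * x) ^ 2) (gaussianReal 0 1) :=
  integrable_comp_sq continuous_tanh abs_tanh_le_one (measurable_const_mul σ)

theorem integrable_deriv_tanh_sq (σ : ℝ) :
    Integrable (fun x => deriv Real.tanh (σ * x) ^ 2) (gaussianReal 0 1) :=
  integrable_comp_sq continuous_deriv_tanh abs_deriv_tanh_le_one (measurable_const_mul σ)

theorem abs_sqrt_mul_le_abs_sqrt_mul {q q' : ℝ} (h : q ≤ q') (x : ℝ) : |√q * x| ≤ |√q' * x| := by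
  rw [abs_mul, abs_mul, abs_of_nonneg (Real.sqrt_nonneg _), abs_of_nonneg (Real.sqrt_nonneg _)]
  gcongr

theorem tanhVariance_nonneg (q : ℝ) : 0 ≤ tanhVariance q := integral_nonneg fun _ => sq_nonneg _

theorem tanhVariance_mono : Monotone tanhVariance := fun _ _ h =>
  integral_mono (integrable_tanh_sq _) (integrable_tanh_sq _) fun x =>
    tanh_sq_le_tanh_sq (abs_sqrt_mul_le_abs_sqrt_mul h x)

theorem tanhSlope_anti : Antitone tanhSlope := fun _ _ h => by
  refine integral_mono (integrable_deriv_tanh_sq _) (integrable_deriv_tanh_sq _) fun x =>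
    pow_le_pow_left₀ (deriv_tanh_pos _).le ?_ 2
  rw [deriv_tanh, deriv_tanh]
  exact sub_le_sub_left (tanh_sq_le_tanh_sq (abs_sqrt_mul_le_abs_sqrt_mul h x)) 1

theorem mul_tanhVariance_le {q q' : ℝ} (hq : 0 ≤ q) (h : q ≤ q') :
    q * tanhVariance q' ≤ q' * tanhVariance q := by
  rcases (hq.trans h).eq_or_lt with hq' | hq'
  · rw [← hq', le_antisymm (h.trans hq'.ge) hq]
  have hratio0 : 0 ≤ √q / √q' := by positivity
  have hratio1 : √q / √q' ≤ 1 := (div_le_one (Real.sqrt_pos.2 hq')).2 (Real.sqrt_le_sqrt h)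
  have hscaled : (√q / √q') ^ 2 * tanhVariance q' ≤ tanhVariance q := by
    rw [tanhVariance, tanhVariance, ← integral_const_mul]
    refine integral_mono ((integrable_tanh_sq _).const_mul _) (integrable_tanh_sq _) fun x => ?_
    have hx : √q * x = √q / √q' * (√q' * x) := by
      rw [← mul_assoc, div_mul_cancel₀ _ (Real.sqrt_pos.2 hq').ne']
    rw [hx]
    exact sq_mul_tanh_sq_le hratio0 hratio1 _
  rw [div_pow, Real.sq_sqrt hq, Real.sq_sqrt hq'.le, div_mul_eq_mul_div, div_le_iff₀ hq'] at hscaled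
  linarith

theorem integral_abs_gaussianReal_le_one : ∫ x, |x| ∂(gaussianReal 0 1) ≤ 1 := by
  have hsq : Integrable (fun x : ℝ => x ^ 2) (gaussianReal 0 1) :=
    (memLp_id_gaussianReal 2).integrable_sq
  calc ∫ x, |x| ∂(gaussianReal 0 1)
    _ ≤ ∫ x, (1 + x ^ 2) / 2 ∂(gaussianReal 0 1) :=
      integral_mono integrable_id_gaussianReal.abs (((integrable_const 1).add hsq).div_const 2)
        fun x => by
          change |x| ≤ (1 + x ^ 2) / 2
          nlinarith [sq_nonneg (|x| - 1), sq_abs x]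
    _ = 1 := by
      have hone := integral_sq_gaussianReal 1
      simp only [one_mul, one_pow] at hone
      rw [integral_div, integral_add (integrable_const 1) hsq, hone]
      norm_num

theorem abs_sqrt_sub_sqrt_le {a q : ℝ} (ha : 0 ≤ a) (hq : 0 < q) :
    |√a - √q| ≤ |a - q| / √q := by
  have hfactor : a - q = (√a - √q) * (√a + √q) := by
    linear_combination Real.sq_sqrt hq.le - Real.sq_sqrt ha
  rw [le_div_iff₀ (Real.sqrt_pos.2 hq), hfactor, abs_mul,
    abs_of_nonneg (by positivity : 0 ≤ √a + √q)]
  exact mul_le_mul_of_nonneg_left (le_add_of_nonneg_left (Real.sqrt_nonneg a)) (abs_nonneg _)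

theorem abs_deriv_tanh_sq_sub_le (x y : ℝ) :
    |deriv Real.tanh x ^ 2 - deriv Real.tanh y ^ 2| ≤ 4 * |x - y| := by
  rw [sq_sub_sq, abs_mul]
  calc _ ≤ 2 * (2 * |x - y|) :=
        mul_le_mul ((abs_add_le _ _).trans
          (by linarith [abs_deriv_tanh_le_one x, abs_deriv_tanh_le_one y]))
          (abs_deriv_tanh_sub_le x y) (abs_nonneg _) zero_le_two
    _ = 4 * |x - y| := by ring

theorem abs_tanhSlope_sub_le {a q : ℝ} (ha : 0 ≤ a) (hq : 0 < q) :
    |tanhSlope a - tanhSlope q| ≤ 4 * (|a - q| / √q) := by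
  rw [tanhSlope, tanhSlope, ← integral_sub (integrable_deriv_tanh_sq _)
    (integrable_deriv_tanh_sq _)]
  calc |∫ x, deriv Real.tanh (√a * x) ^ 2 - deriv Real.tanh (√q * x) ^ 2 ∂(gaussianReal 0 1)|
    _ ≤ ∫ x, 4 * |√a - √q| * |x| ∂(gaussianReal 0 1) := by
      rw [← Real.norm_eq_abs]
      refine norm_integral_le_of_norm_le (integrable_id_gaussianReal.abs.const_mul _)
        (.of_forall fun x => ?_)
      refine (abs_deriv_tanh_sq_sub_le _ _).trans_eq ?_
      rw [← sub_mul, abs_mul, mul_assoc]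
    _ ≤ 4 * (|a - q| / √q) := by
      rw [integral_const_mul]
      nlinarith [integral_abs_gaussianReal_le_one, abs_nonneg (√a - √q),
        abs_sqrt_sub_sqrt_le ha hq]

end SingleLayer

section TanhPairing

variable {a b c : ℝ} {f : ℝ → ℝ}

theorem IsCovariance.pairing_symm (h : IsCovariance a b c) (hf : Measurable f) :
    pairing f f a b c = pairing f f b a c := by
  rw [← h.isGaussianPair.integral_eq_pairing hf hf,
    ← h.isGaussianPair.symm.integral_eq_pairing hf hf]
  simp_rw [mul_comm]

section Polarization

variable {Ω : Type*} [MeasurableSpace Ω] {μ : Measure Ω} [IsProbabilityMeasure μ] {X Y : Ω → ℝ}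

theorem IsGaussianPair.pairing_eq_sub (h : IsGaussianPair μ X Y a b c) (hf : Continuous f)
    (hB : ∀ x, |f x| ≤ 1) :
    pairing f f a b c = (∫ x, f (√a * x) ^ 2 ∂(gaussianReal 0 1) +
      ∫ x, f (√b * x) ^ 2 ∂(gaussianReal 0 1)) / 2 - (∫ ω, (f (X ω) - f (Y ω)) ^ 2 ∂μ) / 2 := by
  have hsq : Measurable fun x => f x ^ 2 := hf.measurable.pow_const 2
  have hX : Integrable (fun ω => f (X ω) ^ 2) μ := integrable_comp_sq hf hB h.measurable_left
  have hY : Integrable (fun ω => f (Y ω) ^ 2) μ := integrable_comp_sq hf hB h.measurable_right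
  have hXY : Integrable (fun ω => f (X ω) * f (Y ω)) μ :=
    integrable_comp_mul_comp hf hB hf hB h.measurable_left h.measurable_right
  have hadd : Integrable (fun ω => f (X ω) ^ 2 + f (Y ω) ^ 2) μ := hX.add hY
  have hexpand (ω : Ω) :
      (f (X ω) - f (Y ω)) ^ 2 = f (X ω) ^ 2 + f (Y ω) ^ 2 - 2 * (f (X ω) * f (Y ω)) := by ring
  have hleft : ∫ ω, f (X ω) ^ 2 ∂μ = ∫ x, f (√a * x) ^ 2 ∂(gaussianReal 0 1) :=
    (h.identDistrib_left.comp hsq).integral_eq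
  have hright : ∫ ω, f (Y ω) ^ 2 ∂μ = ∫ x, f (√b * x) ^ 2 ∂(gaussianReal 0 1) :=
    (h.identDistrib_right.comp hsq).integral_eq
  simp only [hexpand]
  rw [integral_sub hadd (hXY.const_mul 2), integral_add hX hY, integral_const_mul,
    h.integral_eq_pairing hf.measurable hf.measurable, hleft, hright]
  ring

theorem IsGaussianPair.pairing_lt [TopologicalSpace Ω] [OpensMeasurableSpace Ω]
    [μ.IsOpenPosMeasure] (h : IsGaussianPair μ X Y a a c) (hX : Continuous X) (hY : Continuous Y)
    (hf : Continuous f) (hB : ∀ x, |f x| ≤ 1) {ω : Ω} (hω : f (X ω) ≠ f (Y ω)) :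
    pairing f f a a c < ∫ x, f (√a * x) ^ 2 ∂(gaussianReal 0 1) := by
  have hint : Integrable (fun ω => (f (X ω) - f (Y ω)) ^ 2) μ := by
    refine .of_bound (Continuous.measurable (by fun_prop)).aestronglyMeasurable 4
      (.of_forall fun ω => ?_)
    rw [Real.norm_eq_abs, abs_pow, sq_abs]
    nlinarith [abs_le.1 (hB (X ω)), abs_le.1 (hB (Y ω))]
  have hpos : 0 < ∫ ω, (f (X ω) - f (Y ω)) ^ 2 ∂μ :=
    integral_pos_of_integrable_nonneg_nonzero (by fun_prop) hint (fun _ => sq_nonneg _)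
      (pow_ne_zero 2 (sub_ne_zero.2 hω))
  rw [h.pairing_eq_sub hf hB]
  linarith

/-- `f` averaged over a centred Gaussian perturbation of standard deviation `κ`; it arises by
conditioning a Gaussian pair on a part of its randomness. -/
noncomputable def gaussianSmooth (f : ℝ → ℝ) (κ x : ℝ) : ℝ := ∫ g, f (x + κ * g) ∂(gaussianReal 0 1)

theorem gaussianSmooth_zero_left (f : ℝ → ℝ) (x : ℝ) : gaussianSmooth f 0 x = f x := by
  simp [gaussianSmooth]

theorem abs_gaussianSmooth_le_one (hB : ∀ x, |f x| ≤ 1) (κ x : ℝ) : |gaussianSmooth f κ x| ≤ 1 := by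
  have hle := norm_integral_le_of_norm_le_const (μ := gaussianReal 0 1) (C := 1)
    (f := fun g => f (x + κ * g)) (.of_forall fun _ => hB _)
  simpa [gaussianSmooth] using hle

theorem continuous_gaussianSmooth (hf : Continuous f) (hB : ∀ x, |f x| ≤ 1) (κ : ℝ) :
    Continuous (gaussianSmooth f κ) :=
  continuous_of_dominated (bound := fun _ => 1)
    (fun _ => Continuous.aestronglyMeasurable (by fun_prop)) (fun _ => .of_forall fun _ => hB _)
    (integrable_const _) (.of_forall fun _ => by fun_prop)

theorem integrable_gaussianSmooth_mul (hf : Continuous f) (hB : ∀ x, |f x| ≤ 1)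
    (hX : Measurable X) (hY : Measurable Y) (κ κ' : ℝ) :
    Integrable (fun ω => gaussianSmooth f κ (X ω) * gaussianSmooth f κ' (Y ω)) μ :=
  integrable_comp_mul_comp (continuous_gaussianSmooth hf hB κ) (abs_gaussianSmooth_le_one hB κ)
    (continuous_gaussianSmooth hf hB κ') (abs_gaussianSmooth_le_one hB κ') hX hY

-- Realise the larger variances by adding independent Gaussians to both coordinates.
theorem IsGaussianPair.pairing_add_sq (h : IsGaussianPair μ X Y a b c) (hf : Continuous f)
    (hB : ∀ x, |f x| ≤ 1) (κ κ' : ℝ) :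
    pairing f f (a + κ ^ 2) (b + κ' ^ 2) c =
      ∫ ω, gaussianSmooth f κ (X ω) * gaussianSmooth f κ' (Y ω) ∂μ := by
  have hX := h.measurable_left
  have hY := h.measurable_right
  have hpair := h.prod ((isGaussianPair_gaussianReal κ 0).prod (isGaussianPair_gaussianReal 0 κ'))
  simp only [ne_eq, OfNat.ofNat_ne_zero, not_false_eq_true, zero_pow, add_zero, zero_add, mul_zero,
    zero_mul] at hpair
  rw [← hpair.integral_eq_pairing hf.measurable hf.measurable,
    integral_prod _ (integrable_comp_mul_comp hf hB hf hB (by fun_prop) (by fun_prop))]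
  congr 1
  funext ω
  exact integral_prod_mul (fun g => f (X ω + κ * g)) (fun g => f (Y ω + κ' * g))

end Polarization

theorem integrable_tanh_comp {Ω : Type*} [MeasurableSpace Ω] {μ : Measure Ω} [IsFiniteMeasure μ]
    {X : Ω → ℝ} (hX : Measurable X) : Integrable (fun ω => Real.tanh (X ω)) μ :=
  .of_bound (continuous_tanh.measurable.comp hX).aestronglyMeasurable 1
    (.of_forall fun _ => abs_tanh_le_one _)

theorem gaussianSmooth_tanh (κ x : ℝ) : gaussianSmooth Real.tanh κ x =
    ∫ g, (Real.tanh (x + κ * g) + Real.tanh (x - κ * g)) / 2 ∂(gaussianReal 0 1) := by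
  have hreflect :
      ∫ g, Real.tanh (x - κ * g) ∂(gaussianReal 0 1) = gaussianSmooth Real.tanh κ x := by
    have hneg := gaussianReal_map_neg (μ := 0) (v := 1)
    have htanh := continuous_tanh
    rw [neg_zero] at hneg
    conv_lhs => rw [← hneg]
    rw [integral_map (by fun_prop) (Continuous.aestronglyMeasurable (by fun_prop))]
    simp only [mul_neg, sub_neg_eq_add, gaussianSmooth]
  rw [integral_div, integral_add (integrable_tanh_comp (by fun_prop))
    (integrable_tanh_comp (by fun_prop)), hreflect, ← gaussianSmooth, add_self_div_two]

theorem gaussianSmooth_tanh_neg (κ x : ℝ) :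
    gaussianSmooth Real.tanh κ (-x) = -gaussianSmooth Real.tanh κ x := by
  rw [gaussianSmooth_tanh, gaussianSmooth_tanh, ← integral_neg]
  congr 1
  funext g
  rw [show -x + κ * g = -(x - κ * g) by ring, show -x - κ * g = -(x + κ * g) by ring,
    Real.tanh_neg, Real.tanh_neg]
  ring

theorem gaussianSmooth_tanh_zero (κ : ℝ) : gaussianSmooth Real.tanh κ 0 = 0 := by
  have hodd := gaussianSmooth_tanh_neg κ 0
  rw [neg_zero] at hodd
  linarith

theorem gaussianSmooth_tanh_nonneg (κ : ℝ) {x : ℝ} (hx : 0 ≤ x) :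
    0 ≤ gaussianSmooth Real.tanh κ x := by
  rw [gaussianSmooth_tanh]
  exact integral_nonneg fun g => div_nonneg (tanh_add_add_tanh_sub_nonneg hx _) zero_le_two

theorem gaussianSmooth_tanh_le (κ : ℝ) {x : ℝ} (hx : 0 ≤ x) :
    gaussianSmooth Real.tanh κ x ≤ Real.tanh x := by
  rw [gaussianSmooth_tanh]
  calc _ ≤ ∫ _, Real.tanh x ∂(gaussianReal 0 1) :=
        integral_mono (((integrable_tanh_comp (by fun_prop)).add
          (integrable_tanh_comp (by fun_prop))).div_const 2) (integrable_const _) fun g =>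
            (div_le_iff₀' two_pos).2 (tanh_add_add_tanh_sub_le hx (κ * g))
    _ = Real.tanh x := by simp

theorem pairing_tanh_zero (ha : 0 ≤ a) (hb : 0 ≤ b) :
    pairing Real.tanh Real.tanh a b 0 = 0 := by
  simpa [Real.sq_sqrt ha, Real.sq_sqrt hb, gaussianSmooth_tanh_zero] using
    (isGaussianPair_gaussianReal 0 0).pairing_add_sq continuous_tanh abs_tanh_le_one √a √b

-- Smoothing `tanh` shrinks it while preserving signs, and for `0 ≤ c` the regression of one
-- coordinate on the other preserves signs too.
theorem IsCovariance.pairing_tanh_add_sq_le (h : IsCovariance a b c) (hc : 0 ≤ c) (κ : ℝ) :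
    pairing Real.tanh Real.tanh (a + κ ^ 2) b c ≤ pairing Real.tanh Real.tanh a b c := by
  set τ := √(b - c ^ 2 / a)
  have hsmooth (κ : ℝ) : pairing Real.tanh Real.tanh (a + κ ^ 2) b c =
      ∫ x, gaussianSmooth Real.tanh κ (√a * x) * gaussianSmooth Real.tanh τ (c / √a * x)
        ∂(gaussianReal 0 1) := by
    simpa only [τ, Real.sq_sqrt (sub_nonneg.2 h.sq_div_le), add_sub_cancel] using
      h.isGaussianPair_gaussianReal.pairing_add_sq continuous_tanh abs_tanh_le_one κ τ
  have hzero := hsmooth 0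
  rw [zero_pow two_ne_zero, add_zero] at hzero
  rw [hzero, hsmooth κ]
  refine integral_mono
    (integrable_gaussianSmooth_mul continuous_tanh abs_tanh_le_one (by fun_prop) (by fun_prop) _ _)
    (integrable_gaussianSmooth_mul continuous_tanh abs_tanh_le_one (by fun_prop) (by fun_prop) _ _)
    fun x => ?_
  have hle (x : ℝ) (hx : 0 ≤ x) :
      gaussianSmooth Real.tanh κ (√a * x) * gaussianSmooth Real.tanh τ (c / √a * x) ≤
        gaussianSmooth Real.tanh 0 (√a * x) * gaussianSmooth Real.tanh τ (c / √a * x) := by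
    rw [gaussianSmooth_zero_left]
    exact mul_le_mul_of_nonneg_right (gaussianSmooth_tanh_le κ (by positivity))
      (gaussianSmooth_tanh_nonneg τ (by positivity))
  rcases le_total 0 x with hx | hx
  · exact hle x hx
  · simpa only [mul_neg, gaussianSmooth_tanh_neg, neg_mul, neg_neg] using hle (-x) (neg_nonneg.2 hx)

theorem IsCovariance.mono_left (h : IsCovariance a b c) {a' : ℝ} (ha : a ≤ a') :
    IsCovariance a' b c := fun s t =>
  (h s t).trans (by nlinarith [sq_nonneg s])

theorem IsCovariance.pairing_tanh_anti_left (h : IsCovariance a b c) (hc : 0 ≤ c) {a' : ℝ}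
    (ha : a ≤ a') : pairing Real.tanh Real.tanh a' b c ≤ pairing Real.tanh Real.tanh a b c := by
  simpa only [Real.sq_sqrt (sub_nonneg.2 ha), add_sub_cancel] using
    h.pairing_tanh_add_sq_le hc √(a' - a)

theorem IsCovariance.pairing_tanh_anti (h : IsCovariance a b c) (hc : 0 ≤ c) {a' b' : ℝ}
    (ha : a ≤ a') (hb : b ≤ b') :
    pairing Real.tanh Real.tanh a' b' c ≤ pairing Real.tanh Real.tanh a b c := by
  have h' := (h.mono_left ha).symm
  calc pairing Real.tanh Real.tanh a' b' c
    _ = pairing Real.tanh Real.tanh b' a' c :=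
      (h'.mono_left hb).symm.pairing_symm continuous_tanh.measurable
    _ ≤ pairing Real.tanh Real.tanh b a' c := h'.pairing_tanh_anti_left hc hb
    _ = pairing Real.tanh Real.tanh a' b c := h'.pairing_symm continuous_tanh.measurable
    _ ≤ pairing Real.tanh Real.tanh a b c := h.pairing_tanh_anti_left hc ha

variable {q : ℝ}

theorem isGaussianPair_gaussianReal_self (hq : 0 ≤ q) :
    IsGaussianPair (gaussianReal 0 1) (fun x => √q * x) (fun x => √q * x) q q q := by
  simpa only [Real.sq_sqrt hq, Real.mul_self_sqrt hq] using isGaussianPair_gaussianReal (√q) (√q)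

theorem pairing_tanh_self (hq : 0 ≤ q) : pairing Real.tanh Real.tanh q q q = tanhVariance q := by
  rw [(isGaussianPair_gaussianReal_self hq).pairing_eq_sub continuous_tanh abs_tanh_le_one,
    tanhVariance]
  simp

theorem sin_pos_of_mem_Ioo_pi_div_two {θ : ℝ} (hθ : θ ∈ Set.Ioo 0 (Real.pi / 2)) : 0 < Real.sin θ :=
  Real.sin_pos_of_pos_of_lt_pi hθ.1 (by linarith [hθ.2, Real.pi_pos])

theorem pairing_deriv_tanh_lt {θ : ℝ} (hq : 0 < q) (hθ : θ ∈ Set.Ioo 0 (Real.pi / 2)) :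
    pairing (deriv Real.tanh) (deriv Real.tanh) q q (Real.cos θ * q) < tanhSlope q := by
  have : (gaussianReal 0 1).IsOpenPosMeasure :=
    (gaussianReal_absolutelyContinuous' 0 one_ne_zero).isOpenPosMeasure
  refine ((isGaussianPair_gaussianReal_self hq.le).rotate_right θ).pairing_lt (by fun_prop)
    (by fun_prop) continuous_deriv_tanh abs_deriv_tanh_le_one (ω := (0, 1)) ?_
  have hsin : Real.sin θ * √q ≠ 0 :=
    (mul_pos (sin_pos_of_mem_Ioo_pi_div_two hθ) (Real.sqrt_pos.2 hq)).ne'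
  have htanh : Real.tanh (Real.sin θ * √q) ≠ 0 := by
    rwa [← Real.tanh_zero, Real.tanh_injective.ne_iff]
  simpa [deriv_tanh, eq_sub_iff_add_eq] using htanh

theorem strictMonoOn_pairing_tanh_cos (hq : 0 < q) :
    StrictMonoOn (fun θ => pairing Real.tanh Real.tanh q q (Real.cos θ * q) -
      q * tanhSlope q * Real.cos θ) (Set.Icc 0 (Real.pi / 2)) := by
  have hderiv (θ : ℝ) : HasDerivAt (fun θ => pairing Real.tanh Real.tanh q q (Real.cos θ * q) -
      q * tanhSlope q * Real.cos θ) (q * Real.sin θ * (tanhSlope q -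
        pairing (deriv Real.tanh) (deriv Real.tanh) q q (Real.cos θ * q))) θ :=
    (((isGaussianPair_gaussianReal_self hq.le).isCovariance.hasDerivAt_pairing_cos
      isBoundedC1_tanh isBoundedC1_tanh θ).sub
      ((Real.hasDerivAt_cos θ).const_mul (q * tanhSlope q))).congr_deriv (by ring)
  refine strictMonoOn_of_deriv_pos (convex_Icc _ _)
    (fun θ _ => (hderiv θ).continuousAt.continuousWithinAt) fun θ hθ => ?_
  rw [interior_Icc] at hθ
  rw [(hderiv θ).deriv]
  exact mul_pos (mul_pos hq (sin_pos_of_mem_Ioo_pi_div_two hθ))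
    (sub_pos.2 (pairing_deriv_tanh_lt hq hθ))

theorem tanhVariance_lt (hq : 0 < q) : tanhVariance q < q * tanhSlope q := by
  have hlt := strictMonoOn_pairing_tanh_cos hq (Set.left_mem_Icc.2 Real.pi_div_two_pos.le)
    (Set.right_mem_Icc.2 Real.pi_div_two_pos.le) Real.pi_div_two_pos
  simp only [Real.cos_zero, Real.cos_pi_div_two, one_mul, zero_mul, mul_one, mul_zero,
    pairing_tanh_self hq.le, pairing_tanh_zero hq.le hq.le] at hlt
  linarith

theorem tanhVariance_sub_le_pairing (hq : 0 < q) (hc0 : 0 ≤ c) (hcq : c ≤ q) :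
    tanhVariance q - tanhSlope q * (q - c) ≤ pairing Real.tanh Real.tanh q q c := by
  have hcos : Real.cos (Real.arccos (c / q)) = c / q :=
    Real.cos_arccos (by linarith [div_nonneg hc0 hq.le]) ((div_le_one hq).2 hcq)
  have hle := (strictMonoOn_pairing_tanh_cos hq).monotoneOn
    (Set.left_mem_Icc.2 Real.pi_div_two_pos.le)
    ⟨Real.arccos_nonneg (c / q), Real.arccos_le_pi_div_two.2 (div_nonneg hc0 hq.le)⟩
    (Real.arccos_nonneg (c / q))
  have hscale : q * tanhSlope q * (c / q) = tanhSlope q * c := by field_simp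
  simp only [Real.cos_zero, hcos, one_mul, mul_one, pairing_tanh_self hq.le,
    div_mul_cancel₀ c hq.ne', hscale] at hle
  linarith

end TanhPairing

section TanhKernelMap

variable {V : Type*} {K : V × V → ℝ} {σw σb : ℝ}

/-- One MLP layer with activation `tanh`, acting on Gaussian process kernels. -/
noncomputable def tanhStep (σw σb : ℝ) (K : V × V → ℝ) (p : V × V) : ℝ :=
  σw ^ 2 * gaussianPairing Real.tanh K p.1 p.2 + σb ^ 2

/-- The kernel by which an MLP layer with activation `tanh` multiplies its input kernel, up to the
factor `σ_w²` and the bias `σ_b²`; see `IsPSDKernel.tanhStep_eq`. -/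
noncomputable def slopeKernel (K : V × V → ℝ) (p : V × V) : ℝ :=
  ∫ s in (0 : ℝ)..(Real.pi / 2), Real.sin s * pairing (deriv Real.tanh) (deriv Real.tanh)
    (K (p.1, p.1)) (K (p.2, p.2)) (Real.cos s * K p)

theorem sin_nonneg_of_mem_Icc_pi_div_two {s : ℝ} (hs : s ∈ Set.Icc 0 (Real.pi / 2)) :
    0 ≤ Real.sin s :=
  Real.sin_nonneg_of_nonneg_of_le_pi hs.1 (by linarith [hs.2, Real.pi_pos])

theorem memLp_tanh_mul_gaussianReal (σ : ℝ) :
    MemLp (fun x => Real.tanh (σ * x)) 2 (gaussianReal 0 1) :=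
  .of_bound (continuous_tanh.comp (continuous_const_mul σ)).aestronglyMeasurable 1
    (.of_forall fun _ => abs_tanh_le_one _)

theorem slopeKernel_nonneg (p : V × V) : 0 ≤ slopeKernel K p :=
  intervalIntegral.integral_nonneg Real.pi_div_two_pos.le fun _ hs =>
    mul_nonneg (sin_nonneg_of_mem_Icc_pi_div_two hs)
      (integral_nonneg fun _ => mul_nonneg (deriv_tanh_pos _).le (deriv_tanh_pos _).le)

namespace IsPSDKernel

variable [Finite V]

-- For the centred Gaussian vector `z` with covariance `K`, adding to `√ρ z u` independent noise of
-- variance `(1 - ρ) K (u, u)` keeps the variances and scales the covariances by `ρ`; conditioning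
-- on `z` exhibits the pairing as a Gram kernel.
theorem pairing_mul (hK : IsPSDKernel K) {f : ℝ → ℝ} (hf : Continuous f) (hB : ∀ x, |f x| ≤ 1)
    {ρ : ℝ} (hρ0 : 0 ≤ ρ) (hρ1 : ρ ≤ 1) :
    IsPSDKernel fun p : V × V => pairing f f (K (p.1, p.1)) (K (p.2, p.2)) (ρ * K p) := by
  classical
  have := Fintype.ofFinite V
  have hsmooth := continuous_gaussianSmooth hf hB
  convert integral_mul (μ := multivariateGaussian (0 : EuclideanSpace ℝ V)
    (of fun u v => K (u, v)))
    (g := fun u z => gaussianSmooth f (√(1 - ρ) * √(K (u, u))) (√ρ * z u)) fun u =>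
      .of_bound (Continuous.aestronglyMeasurable (by fun_prop)) 1
        (.of_forall fun _ => abs_gaussianSmooth_le_one hB _ _) with p
  have hpair := (hK.isGaussianPair p.1 p.2).linear √ρ 0 0 √ρ
  simp only [ne_eq, OfNat.ofNat_ne_zero, not_false_eq_true, zero_pow, add_zero, mul_zero, zero_mul,
    zero_add, Real.sq_sqrt hρ0, Real.mul_self_sqrt hρ0] at hpair
  have hadd := hpair.pairing_add_sq hf hB (√(1 - ρ) * √(K (p.1, p.1))) (√(1 - ρ) * √(K (p.2, p.2)))
  simp only [mul_pow, Real.sq_sqrt (sub_nonneg.2 hρ1), Real.sq_sqrt (hK.diag_nonneg _),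
    ← add_mul, add_sub_cancel, one_mul] at hadd
  exact hadd

theorem intervalIntegral {K : ℝ → V × V → ℝ} {a b : ℝ} (hab : a ≤ b)
    (hK : ∀ s ∈ Set.Icc a b, IsPSDKernel (K s)) (hcont : ∀ p, Continuous fun s => K s p) :
    IsPSDKernel fun p => ∫ s in a..b, K s p := by
  have := Fintype.ofFinite V
  have hcont' (x : V → ℝ) (u v : V) : Continuous fun s => x u * (K s (u, v) * x v) :=
    continuous_const.mul ((hcont (u, v)).mul continuous_const)
  refine PosSemidef.of_dotProduct_mulVec_nonneg ?_ fun x => ?_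
  · ext u v
    refine intervalIntegral.integral_congr fun s hs => ?_
    rw [Set.uIcc_of_le hab] at hs
    exact (hK s hs).symm u v
  · have hquad : star x ⬝ᵥ ((of fun u v => ∫ s in a..b, K s (u, v)) *ᵥ x) =
        ∫ s in a..b, star x ⬝ᵥ ((of fun u v => K s (u, v)) *ᵥ x) := by
      simp only [dotProduct, mulVec, of_apply, star_trivial, Finset.mul_sum]
      rw [intervalIntegral.integral_finsetSum fun u _ =>
        (continuous_finsetSum _ fun v _ => hcont' x u v).intervalIntegrable _ _]
      refine Finset.sum_congr rfl fun u _ => ?_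
      rw [intervalIntegral.integral_finsetSum fun v _ => (hcont' x u v).intervalIntegrable _ _]
      simp only [intervalIntegral.integral_const_mul, intervalIntegral.integral_mul_const]
    rw [hquad]
    exact intervalIntegral.integral_nonneg hab fun s hs => (hK s hs).dotProduct_mulVec_nonneg x

theorem slopeKernel (hK : IsPSDKernel K) : IsPSDKernel (slopeKernel K) :=
  intervalIntegral Real.pi_div_two_pos.le
    (fun s hs => (hK.pairing_mul continuous_deriv_tanh abs_deriv_tanh_le_one
      (Real.cos_nonneg_of_neg_pi_div_two_le_of_le (by linarith [hs.1, Real.pi_pos]) hs.2)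
      (Real.cos_le_one s)).smul (sin_nonneg_of_mem_Icc_pi_div_two hs))
    fun p => Real.continuous_sin.mul ((hK.isCovariance p.1 p.2).continuous_pairing_cos
      continuous_deriv_tanh continuous_deriv_tanh abs_deriv_tanh_le_one abs_deriv_tanh_le_one)

theorem tanhStep (hK : IsPSDKernel K) : IsPSDKernel (tanhStep σw σb K) :=
  ((hK.gaussianPairing continuous_tanh.measurable memLp_tanh_mul_gaussianReal).smul
    (sq_nonneg σw)).add (.const (sq_nonneg σb))

omit [Finite V] in
theorem tanhStep_apply (hK : IsPSDKernel K) (p : V × V) : GNTK.tanhStep σw σb K p =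
    σw ^ 2 * pairing Real.tanh Real.tanh (K (p.1, p.1)) (K (p.2, p.2)) (K p) + σb ^ 2 := by
  rw [GNTK.tanhStep, hK.gaussianPairing_eq]

theorem tanhStep_diag (hK : IsPSDKernel K) (u : V) :
    GNTK.tanhStep σw σb K (u, u) = σw ^ 2 * tanhVariance (K (u, u)) + σb ^ 2 := by
  rw [hK.tanhStep_apply, pairing_tanh_self (hK.diag_nonneg u)]

theorem tanhStep_eq (hK : IsPSDKernel K) :
    GNTK.tanhStep σw σb K = σw ^ 2 • (GNTK.slopeKernel K * K) + fun _ => σb ^ 2 := by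
  funext p
  have hprice := (hK.isCovariance p.1 p.2).pairing_eq_add_mul_integral isBoundedC1_tanh
    isBoundedC1_tanh
  rw [pairing_tanh_zero (hK.diag_nonneg _) (hK.diag_nonneg _), zero_add] at hprice
  rw [hK.tanhStep_apply, hprice, mul_comm (K p)]
  rfl

end IsPSDKernel

/-- `K` lies entrywise above `c Y` for an entrywise nonnegative positive semidefinite kernel `Y`
with `σ_b² Y ≤ K` in the Loewner order. An MLP layer preserves this and increases `c`, so that the
entries of the Gaussian process kernels are eventually nonnegative. -/
def DominatesNonneg (σb c : ℝ) (K : V × V → ℝ) : Prop :=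
  ∃ Y : V × V → ℝ, IsPSDKernel Y ∧ (∀ p, 0 ≤ Y p) ∧ IsPSDKernel (K - σb ^ 2 • Y) ∧
    ∀ p, c * Y p ≤ K p

namespace DominatesNonneg

variable {B c : ℝ}

theorem mono (hK : DominatesNonneg σb c K) {c' : ℝ} (h : c' ≤ c) : DominatesNonneg σb c' K := by
  obtain ⟨Y, hY, hY0, hKY, hc⟩ := hK
  exact ⟨Y, hY, hY0, hKY, fun p => (mul_le_mul_of_nonneg_right h (hY0 p)).trans (hc p)⟩

theorem nonneg (hK : DominatesNonneg σb c K) (hc : 0 ≤ c) (p : V × V) : 0 ≤ K p := by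
  obtain ⟨Y, -, hY0, -, hle⟩ := hK
  exact (mul_nonneg hc (hY0 p)).trans (hle p)

theorem mulVec [Fintype V] [DecidableEq V] {A : Matrix (V × V) (V × V) ℝ}
    (hA : A ∈ rowStochastic ℝ (V × V))
    (hpsd : ∀ K : V × V → ℝ, IsPSDKernel K → IsPSDKernel (A *ᵥ K)) (hK : DominatesNonneg σb c K) :
    DominatesNonneg σb c (A *ᵥ K) := by
  obtain ⟨Y, hY, hY0, hKY, hle⟩ := hK
  refine ⟨A *ᵥ Y, hpsd Y hY, const_le_mulVec hA hY0, ?_, fun p => ?_⟩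
  · rw [← mulVec_smul, ← mulVec_sub]
    exact hpsd _ hKY
  · have hmono := mulVec_mono hA.1 (x := c • Y) (y := K) hle p
    rwa [mulVec_smul] at hmono

variable [Finite V]

theorem tanhStep_of_isPSDKernel (hK : IsPSDKernel K) (hB : ∀ u, tanhStep σw σb K (u, u) ≤ B) :
    DominatesNonneg σb (-B) (tanhStep σw σb K) := by
  refine ⟨fun _ => 1, .const zero_le_one, fun _ => zero_le_one, ?_, fun p => ?_⟩
  · have hexcess : tanhStep σw σb K - σb ^ 2 • (fun _ => (1 : ℝ)) =
        σw ^ 2 • (slopeKernel K * K) := by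
      rw [hK.tanhStep_eq]
      funext p
      simp
    rw [hexcess]
    exact (hK.slopeKernel.mul hK).smul (sq_nonneg σw)
  · rw [mul_one]
    exact hK.tanhStep.neg_le_apply hB p

-- If `Y` is the witness for `K`, then `Y' = σ_w² slopeKernel K * Y` is one for the next kernel
-- `σ_w² slopeKernel K * K + σ_b²`: the bias `σ_b²` dominates `(σ_b⁴ / B) Y'` since `σ_b² Y' ≤ B`.
theorem tanhStep (hpsd : IsPSDKernel K) (hK : DominatesNonneg σb c K) (hB0 : 0 < B)
    (hb : 0 < σb ^ 2) (hB : ∀ u, tanhStep σw σb K (u, u) ≤ B) :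
    DominatesNonneg σb (c + (σb ^ 2) ^ 2 / B) (tanhStep σw σb K) := by
  obtain ⟨Y, hY, hY0, hKY, hle⟩ := hK
  have hfactor (p : V × V) : 0 ≤ σw ^ 2 * slopeKernel K p :=
    mul_nonneg (sq_nonneg σw) (slopeKernel_nonneg p)
  have hY' : IsPSDKernel (σw ^ 2 • (slopeKernel K * Y)) :=
    (hpsd.slopeKernel.mul hY).smul (sq_nonneg σw)
  have hKY' : IsPSDKernel (GNTK.tanhStep σw σb K - σb ^ 2 • σw ^ 2 • (slopeKernel K * Y)) := by
    have hexcess : GNTK.tanhStep σw σb K - σb ^ 2 • σw ^ 2 • (slopeKernel K * Y) =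
        σw ^ 2 • (slopeKernel K * (K - σb ^ 2 • Y)) + fun _ => σb ^ 2 := by
      rw [hpsd.tanhStep_eq]
      funext p
      simp only [Pi.add_apply, Pi.sub_apply, Pi.smul_apply, Pi.mul_apply, smul_eq_mul]
      ring
    rw [hexcess]
    exact ((hpsd.slopeKernel.mul hKY).smul (sq_nonneg σw)).add (.const (sq_nonneg σb))
  refine ⟨σw ^ 2 • (slopeKernel K * Y), hY', fun p => ?_, hKY', fun p => ?_⟩
  · rw [Pi.smul_apply, Pi.mul_apply, smul_eq_mul, ← mul_assoc]
    exact mul_nonneg (hfactor p) (hY0 p)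
  · have hdiag (u : V) : (σw ^ 2 • (slopeKernel K * Y)) (u, u) ≤ B / σb ^ 2 := by
      have hnonneg := hKY'.diag_nonneg u
      rw [Pi.sub_apply, Pi.smul_apply, smul_eq_mul] at hnonneg
      rw [le_div_iff₀ hb]
      linarith [hB u]
    have hbias : (σb ^ 2) ^ 2 / B * (σw ^ 2 • (slopeKernel K * Y)) p ≤ σb ^ 2 := by
      refine (mul_le_mul_of_nonneg_left (hY'.apply_le hdiag p) (by positivity)).trans_eq ?_
      field_simp
    have hscaled := mul_le_mul_of_nonneg_left (hle p) (hfactor p)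
    rw [add_mul, hpsd.tanhStep_eq]
    simp only [Pi.add_apply, Pi.smul_apply, Pi.mul_apply, smul_eq_mul] at hbias ⊢
    linarith

end DominatesNonneg

end TanhKernelMap

section EdgeOfChaos

theorem mul_abs_tanhVariance_sub_le {a q : ℝ} (ha : 0 ≤ a) (hq : 0 ≤ q) :
    q * |tanhVariance a - tanhVariance q| ≤ tanhVariance q * |a - q| := by
  rcases le_total a q with h | h
  · rw [abs_of_nonpos (sub_nonpos.2 (tanhVariance_mono h)), abs_of_nonpos (sub_nonpos.2 h)]
    linarith [mul_tanhVariance_le ha h]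
  · rw [abs_of_nonneg (sub_nonneg.2 (tanhVariance_mono h)), abs_of_nonneg (sub_nonneg.2 h)]
    linarith [mul_tanhVariance_le hq h]

variable {σw σb q : ℝ}

theorem sq_bias_pos (hq : 0 < q) (hfix : σw ^ 2 * tanhVariance q + σb ^ 2 = q)
    (hslope : σw ^ 2 * tanhSlope q = 1) : 0 < σb ^ 2 := by
  have hw : 0 < σw ^ 2 := (sq_nonneg σw).lt_of_ne' fun hw0 => by
    rw [hw0, zero_mul] at hslope
    exact zero_ne_one hslope
  have hvariance : σw ^ 2 * tanhVariance q < q :=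
    calc σw ^ 2 * tanhVariance q < σw ^ 2 * (q * tanhSlope q) :=
          mul_lt_mul_of_pos_left (tanhVariance_lt hq) hw
      _ = q := by rw [mul_left_comm, hslope, mul_one]
  linarith

/-- The factor by which an MLP layer with activation `tanh` contracts variances towards the fixed
point `q`; see `abs_variance_sub_le`. -/
noncomputable def contractionRate (σb q : ℝ) : ℝ := 1 - σb ^ 2 / q

theorem mul_contractionRate (hq : 0 < q) (hfix : σw ^ 2 * tanhVariance q + σb ^ 2 = q) :
    q * contractionRate σb q = σw ^ 2 * tanhVariance q := by
  rw [contractionRate, mul_sub, mul_one, mul_div_cancel₀ _ hq.ne']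
  linarith

theorem contractionRate_nonneg (hq : 0 < q) (hfix : σw ^ 2 * tanhVariance q + σb ^ 2 = q) :
    0 ≤ contractionRate σb q :=
  (mul_nonneg_iff_of_pos_left hq).1 <| by
    rw [mul_contractionRate hq hfix]
    exact mul_nonneg (sq_nonneg σw) (tanhVariance_nonneg q)

theorem contractionRate_le_one (hq : 0 < q) : contractionRate σb q ≤ 1 :=
  sub_le_self 1 (div_nonneg (sq_nonneg σb) hq.le)

theorem contractionRate_lt_one (hq : 0 < q) (hb : 0 < σb ^ 2) : contractionRate σb q < 1 :=
  sub_lt_self 1 (div_pos hb hq)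

theorem abs_variance_sub_le (hq : 0 < q) (hfix : σw ^ 2 * tanhVariance q + σb ^ 2 = q) {a : ℝ}
    (ha : 0 ≤ a) :
    |σw ^ 2 * tanhVariance a + σb ^ 2 - q| ≤ contractionRate σb q * |a - q| := by
  refine le_of_mul_le_mul_left ?_ hq
  calc q * |σw ^ 2 * tanhVariance a + σb ^ 2 - q|
      = q * |σw ^ 2 * (tanhVariance a - tanhVariance q)| := by
        congr 2
        linear_combination hfix
    _ = σw ^ 2 * (q * |tanhVariance a - tanhVariance q|) := by
        rw [abs_mul, abs_of_nonneg (sq_nonneg σw), mul_left_comm]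
    _ ≤ σw ^ 2 * (tanhVariance q * |a - q|) :=
        mul_le_mul_of_nonneg_left (mul_abs_tanhVariance_sub_le ha hq.le) (sq_nonneg σw)
    _ = q * (contractionRate σb q * |a - q|) := by
        rw [← mul_assoc, ← mul_assoc, mul_contractionRate hq hfix]

variable {V : Type*} {K : V × V → ℝ} {ε : ℝ}

theorem tanhStep_le [Finite V] (hq : 0 < q) (hfix : σw ^ 2 * tanhVariance q + σb ^ 2 = q)
    (hK : IsPSDKernel K) (hε : 0 ≤ ε) (hKε : ∀ p, K p ≤ q + ε) (p : V × V) :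
    tanhStep σw σb K p ≤ q + contractionRate σb q * ε := by
  refine hK.tanhStep.apply_le (fun u => ?_) p
  have hcontract := abs_variance_sub_le hq hfix (add_nonneg hq.le hε)
  rw [add_sub_cancel_left, abs_of_nonneg hε] at hcontract
  calc tanhStep σw σb K (u, u) = σw ^ 2 * tanhVariance (K (u, u)) + σb ^ 2 := hK.tanhStep_diag u
    _ ≤ σw ^ 2 * tanhVariance (q + ε) + σb ^ 2 := by
        gcongr
        exact tanhVariance_mono (hKε (u, u))
    _ ≤ q + contractionRate σb q * ε := by linarith [(abs_le.1 hcontract).2]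

-- By Price's theorem the layer, at fixed variances `q`, has slope at most `σ_w² tanhSlope q = 1` in
-- the covariance, and it maps the covariance `q` to itself.
theorem sub_le_tanhStep [Finite V] (hq : 0 < q) (hfix : σw ^ 2 * tanhVariance q + σb ^ 2 = q)
    (hslope : σw ^ 2 * tanhSlope q = 1) (hK : IsPSDKernel K) (hK0 : ∀ p, 0 ≤ K p) (hε : 0 ≤ ε)
    (hKε : ∀ p, K p ≤ q + ε) (p : V × V) : K p - ε ≤ tanhStep σw σb K p := by
  have hqε : q ≤ q + ε := le_add_of_nonneg_right hε
  have hpairing : tanhVariance (q + ε) - tanhSlope (q + ε) * (q + ε - K p) ≤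
      pairing Real.tanh Real.tanh (K (p.1, p.1)) (K (p.2, p.2)) (K p) :=
    (tanhVariance_sub_le_pairing (hq.trans_le hqε) (hK0 p) (hKε p)).trans
      ((hK.isCovariance p.1 p.2).pairing_tanh_anti (hK0 p) (hKε _) (hKε _))
  have hslope_le : tanhSlope (q + ε) * (q + ε - K p) ≤ tanhSlope q * (q + ε - K p) :=
    mul_le_mul_of_nonneg_right (tanhSlope_anti hqε) (sub_nonneg.2 (hKε p))
  have hbound := mul_le_mul_of_nonneg_left
    (show tanhVariance q - tanhSlope q * (q + ε - K p) ≤ _ by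
      linarith [tanhVariance_mono hqε]) (sq_nonneg σw)
  rw [hK.tanhStep_apply]
  linear_combination hbound - hfix + (q + ε - K p) * hslope

/-- The factor by which an MLP layer with activation `tanh` damps the deficit `(q - K p)⁺`: only
the diagonal entries contract. -/
noncomputable def damping [DecidableEq V] (σb q : ℝ) (p : V × V) : ℝ :=
  if p.1 = p.2 then contractionRate σb q else 1

section damping

variable [DecidableEq V]

theorem damping_diag (u : V) : damping σb q (u, u) = contractionRate σb q := if_pos rfl

theorem damping_nonneg (hq : 0 < q) (hfix : σw ^ 2 * tanhVariance q + σb ^ 2 = q) (p : V × V) :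
    0 ≤ damping σb q p := by
  unfold damping
  split_ifs
  exacts [contractionRate_nonneg hq hfix, zero_le_one]

theorem damping_le_one (hq : 0 < q) (p : V × V) : damping σb q p ≤ 1 := by
  unfold damping
  split_ifs
  exacts [contractionRate_le_one hq, le_rfl]

theorem posPart_sub_tanhStep_le [Finite V] (hq : 0 < q)
    (hfix : σw ^ 2 * tanhVariance q + σb ^ 2 = q) (hslope : σw ^ 2 * tanhSlope q = 1)
    (hK : IsPSDKernel K) (hK0 : ∀ p, 0 ≤ K p) (hε : 0 ≤ ε) (hKε : ∀ p, K p ≤ q + ε) (p : V × V) :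
    (q - tanhStep σw σb K p)⁺ ≤ damping σb q p * (q - K p)⁺ + ε := by
  refine sup_le ?_ (add_nonneg (mul_nonneg (damping_nonneg hq hfix p) (posPart_nonneg _)) hε)
  obtain ⟨u, v⟩ := p
  rcases eq_or_ne u v with rfl | huv
  · rw [hK.tanhStep_diag, damping_diag]
    have hcontract := neg_le_of_abs_le (abs_variance_sub_le hq hfix (hK.diag_nonneg u))
    rcases le_total (K (u, u)) q with h | h
    · rw [abs_of_nonpos (sub_nonpos.2 h), neg_sub] at hcontract
      rw [posPart_of_nonneg (sub_nonneg.2 h)]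
      linarith
    · rw [posPart_of_nonpos (sub_nonpos.2 h), mul_zero, zero_add]
      linarith [mul_le_mul_of_nonneg_left (tanhVariance_mono h) (sq_nonneg σw)]
  · rw [damping, if_neg huv, one_mul]
    linarith [sub_le_tanhStep hq hfix hslope hK hK0 hε hKε (u, v), le_posPart (q - K (u, v))]

end damping

theorem IsGaussianPair.integral_sub_sq_deriv_tanh_le {Ω : Type*} [MeasurableSpace Ω]
    {μ : Measure Ω} [IsProbabilityMeasure μ] {X Y : Ω → ℝ} {a b c : ℝ}
    (h : IsGaussianPair μ X Y a b c) :
    ∫ ω, (deriv Real.tanh (X ω) - deriv Real.tanh (Y ω)) ^ 2 ∂μ ≤ 4 * (a + b - 2 * c) := by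
  rw [← h.integral_sub_sq, ← integral_const_mul]
  refine integral_mono_of_nonneg (.of_forall fun _ => sq_nonneg _)
    ((h.memLp_left.sub h.memLp_right).integrable_sq.const_mul 4) (.of_forall fun ω => ?_)
  have hsq := pow_le_pow_left₀ (abs_nonneg _) (abs_deriv_tanh_sub_le (X ω) (Y ω)) 2
  rw [mul_pow, sq_abs, sq_abs] at hsq
  exact hsq.trans_eq (by norm_num)

theorem IsCovariance.pairing_deriv_tanh_mem_Icc {a b c : ℝ} (h : IsCovariance a b c) :
    pairing (deriv Real.tanh) (deriv Real.tanh) a b c ∈ Set.Icc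
      ((tanhSlope a + tanhSlope b) / 2 - 2 * (a + b - 2 * c))
      ((tanhSlope a + tanhSlope b) / 2) := by
  have hpair := h.isGaussianPair
  rw [hpair.pairing_eq_sub continuous_deriv_tanh abs_deriv_tanh_le_one, ← tanhSlope, ← tanhSlope]
  exact ⟨by linarith [hpair.integral_sub_sq_deriv_tanh_le],
    sub_le_self _ (div_nonneg (integral_nonneg fun _ => sq_nonneg _) zero_le_two)⟩

theorem IsCovariance.abs_pairing_deriv_tanh_sub_one_le {a b c : ℝ} (h : IsCovariance a b c)
    (hq : 0 < q) (hslope : σw ^ 2 * tanhSlope q = 1) (ha : |a - q| ≤ ε) (hb : |b - q| ≤ ε)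
    (hc : |c - q| ≤ ε) :
    |σw ^ 2 * pairing (deriv Real.tanh) (deriv Real.tanh) a b c - 1| ≤
      σw ^ 2 * (4 / √q + 8) * ε := by
  have hslope_sub {a : ℝ} (ha0 : 0 ≤ a) (ha : |a - q| ≤ ε) :
      |tanhSlope a - tanhSlope q| ≤ 4 * (ε / √q) :=
    (abs_tanhSlope_sub_le ha0 hq).trans (by gcongr)
  have hsa := abs_le.1 (hslope_sub h.left_nonneg ha)
  have hsb := abs_le.1 (hslope_sub h.right_nonneg hb)
  have hclose : |pairing (deriv Real.tanh) (deriv Real.tanh) a b c - tanhSlope q| ≤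
      (4 / √q + 8) * ε := by
    obtain ⟨hlow, hup⟩ := h.pairing_deriv_tanh_mem_Icc
    rw [abs_le] at ha hb hc
    rw [show (4 / √q + 8) * ε = 4 * (ε / √q) + 8 * ε by ring, abs_le]
    constructor <;> linarith
  rw [← hslope, ← mul_sub, abs_mul, abs_of_nonneg (sq_nonneg σw), mul_assoc]
  exact mul_le_mul_of_nonneg_left hclose (sq_nonneg σw)

end EdgeOfChaos

section TanhKernel

variable {V : Type*} [Fintype V] {A : Matrix (V × V) (V × V) ℝ} {σw σb q : ℝ} {R d : ℕ}
  {h : V → EuclideanSpace ℝ (Fin d)}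

theorem isPSDKernel_gpk_tanh (hpsd : ∀ K, IsPSDKernel K → IsPSDKernel (A *ᵥ K)) (l r : ℕ) :
    IsPSDKernel (gpk A Real.tanh σw σb R h l r) :=
  isPSDKernel_gpk hpsd continuous_tanh.measurable memLp_tanh_mul_gaussianReal l r

theorem gpk_tanh_succ (l r : ℕ) :
    gpk A Real.tanh σw σb R h l (r + 1) = tanhStep σw σb (gpk A Real.tanh σw σb R h l r) :=
  gpk_succ l r

variable [DecidableEq V]

theorem posPart_sub_mulVec_le (hA : A ∈ rowStochastic ℝ (V × V)) (K : V × V → ℝ) (p : V × V) :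
    (q - (A *ᵥ K) p)⁺ ≤ (A *ᵥ fun p => (q - K p)⁺) p := by
  refine sup_le ?_ (const_le_mulVec hA (fun p => posPart_nonneg _) p)
  have hmono := mulVec_mono hA.1 (x := (fun _ => q) - K) (fun p => le_posPart (q - K p)) p
  rwa [mulVec_sub, mulVec_const hA, Pi.sub_apply] at hmono

theorem exists_gpk_tanh_le (hpsd : ∀ K, IsPSDKernel K → IsPSDKernel (A *ᵥ K))
    (hA : A ∈ rowStochastic ℝ (V × V)) (hR : 0 < R) (hq : 0 < q)
    (hfix : σw ^ 2 * tanhVariance q + σb ^ 2 = q) :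
    ∃ ε₀ : ℝ, 0 ≤ ε₀ ∧ ∀ l r p,
      gpk A Real.tanh σw σb R h l r p ≤ q + ε₀ * contractionRate σb q ^ l := by
  set β := contractionRate σb q
  have hβ0 : 0 ≤ β := contractionRate_nonneg hq hfix
  have hβ1 : β ≤ 1 := contractionRate_le_one hq
  set K := gpk A Real.tanh σw σb R h
  set ε₀ := ‖K 0 0‖
  have hε₀ : 0 ≤ ε₀ := norm_nonneg _
  have hpow_le {m n : ℕ} (hmn : m ≤ n) : q + ε₀ * β ^ n ≤ q + ε₀ * β ^ m := by
    gcongr q + _ * ?_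
    exact pow_le_pow_of_le_one hβ0 hβ1 hmn
  have hlayers (l r : ℕ) : ∀ p, K l r p ≤ q + ε₀ * β ^ (l + r) := by
    refine layer_induction (P := fun l r => ∀ p, K l r p ≤ q + ε₀ * β ^ (l + r)) R (fun p => ?_)
      (fun l hl p => ?_) (fun l r hr p => ?_) l r
    · rw [add_zero, pow_zero, mul_one]
      linarith [(Real.le_norm_self _).trans (norm_le_pi_norm (K 0 0) p)]
    · simp only [K, gpk_succ_zero]
      exact mulVec_le_const hA (fun p => (hl p).trans (hpow_le (by omega))) p
    · simp only [K, gpk_tanh_succ]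
      refine (tanhStep_le hq hfix (isPSDKernel_gpk_tanh hpsd l r) (by positivity) hr p).trans_eq ?_
      ring
  exact ⟨ε₀, hε₀, fun l r p => (hlayers l r p).trans (hpow_le (by omega))⟩

theorem dominatesNonneg_gpk_tanh (hpsd : ∀ K, IsPSDKernel K → IsPSDKernel (A *ᵥ K))
    (hA : A ∈ rowStochastic ℝ (V × V)) (hR : 0 < R) (hb : 0 < σb ^ 2) {B : ℝ} (hB0 : 0 < B)
    (hB : ∀ l r p, gpk A Real.tanh σw σb R h l r p ≤ B) (l r : ℕ) (hlr : 1 ≤ l + r) :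
    DominatesNonneg σb ((l + r - 1) * ((σb ^ 2) ^ 2 / B) - B)
      (gpk A Real.tanh σw σb R h l r) := by
  have hdiag (l r : ℕ) (u : V) : tanhStep σw σb (gpk A Real.tanh σw σb R h l r) (u, u) ≤ B := by
    rw [← gpk_tanh_succ]
    exact hB l (r + 1) (u, u)
  refine layer_induction (P := fun l r => 1 ≤ l + r →
    DominatesNonneg σb ((l + r - 1) * ((σb ^ 2) ^ 2 / B) - B) (gpk A Real.tanh σw σb R h l r))
    R (fun h0 => ?_) (fun l hl _ => ?_) (fun l r hr _ => ?_) l r hlr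
  · omega
  · rw [gpk_succ_zero]
    refine ((hl (by omega)).mulVec hA hpsd).mono ?_
    have hR' : (1 : ℝ) ≤ R := Nat.one_le_cast.2 hR
    gcongr ?_ * _ - _
    push_cast
    linarith
  · rw [gpk_tanh_succ]
    rcases Nat.eq_zero_or_pos (l + r) with hlr | hlr
    · obtain ⟨rfl, rfl⟩ := Nat.add_eq_zero_iff.1 hlr
      simpa using
        DominatesNonneg.tanhStep_of_isPSDKernel (isPSDKernel_gpk_tanh hpsd 0 0) (hdiag 0 0)
    · refine ((hr hlr).tanhStep (isPSDKernel_gpk_tanh hpsd l r) hB0 hb (hdiag l r)).mono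
        (le_of_eq ?_)
      push_cast
      ring

theorem eventually_gpk_tanh_nonneg (hpsd : ∀ K, IsPSDKernel K → IsPSDKernel (A *ᵥ K))
    (hA : A ∈ rowStochastic ℝ (V × V)) (hR : 0 < R) (hb : 0 < σb ^ 2) {B : ℝ} (hB0 : 0 < B)
    (hB : ∀ l r p, gpk A Real.tanh σw σb R h l r p ≤ B) :
    ∀ᶠ l in atTop, ∀ r p, 0 ≤ gpk A Real.tanh σw σb R h l r p := by
  have hκ : 0 < (σb ^ 2) ^ 2 / B := by positivity
  filter_upwards [eventually_ge_atTop (⌈B / ((σb ^ 2) ^ 2 / B)⌉₊ + 1)] with l hl r p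
  refine (dominatesNonneg_gpk_tanh hpsd hA hR hb hB0 hB l r (by omega)).nonneg ?_ p
  rw [sub_nonneg, ← div_le_iff₀ hκ]
  have hl' := (Nat.le_ceil (B / ((σb ^ 2) ^ 2 / B))).trans (Nat.cast_le.2 (Nat.le_sub_one_of_lt hl))
  rw [Nat.cast_sub (by omega)] at hl'
  linarith [(Nat.cast_nonneg r : (0 : ℝ) ≤ r)]

section singlePropagation

variable {l : ℕ} {ε : ℝ}

omit [DecidableEq V] in
theorem posPart_sub_gpk_tanh_le (hpsd : ∀ K, IsPSDKernel K → IsPSDKernel (A *ᵥ K)) (hq : 0 < q)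
    (hfix : σw ^ 2 * tanhVariance q + σb ^ 2 = q) (hslope : σw ^ 2 * tanhSlope q = 1)
    (hK0 : ∀ r p, 0 ≤ gpk A Real.tanh σw σb R h l r p) (hε : 0 ≤ ε)
    (hKε : ∀ r p, gpk A Real.tanh σw σb R h l r p ≤ q + ε) (r : ℕ) (p : V × V) :
    (q - gpk A Real.tanh σw σb R h l r p)⁺ ≤ (q - gpk A Real.tanh σw σb R h l 0 p)⁺ + r * ε := by
  classical
  induction r with
  | zero => simp
  | succ r ih =>
    have hstep := posPart_sub_tanhStep_le hq hfix hslope (isPSDKernel_gpk_tanh hpsd l r) (hK0 r) hε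
      (hKε r) p
    have hdamp := mul_le_of_le_one_left (posPart_nonneg (q - gpk A Real.tanh σw σb R h l r p))
      (damping_le_one (σb := σb) hq p)
    rw [gpk_tanh_succ]
    push_cast
    linarith

theorem posPart_sub_gpk_tanh_succ_le (hpsd : ∀ K, IsPSDKernel K → IsPSDKernel (A *ᵥ K))
    (hq : 0 < q) (hfix : σw ^ 2 * tanhVariance q + σb ^ 2 = q) (hslope : σw ^ 2 * tanhSlope q = 1)
    (hK0 : ∀ r p, 0 ≤ gpk A Real.tanh σw σb R h l r p) (hε : 0 ≤ ε)
    (hKε : ∀ r p, gpk A Real.tanh σw σb R h l r p ≤ q + ε) (r : ℕ) (p : V × V) :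
    (q - gpk A Real.tanh σw σb R h l (r + 1) p)⁺ ≤
      damping σb q p * (q - gpk A Real.tanh σw σb R h l 0 p)⁺ + (r + 1) * ε := by
  have hrε : 0 ≤ r * ε := by positivity
  rw [gpk_tanh_succ]
  calc (q - tanhStep σw σb (gpk A Real.tanh σw σb R h l r) p)⁺
      ≤ damping σb q p * (q - gpk A Real.tanh σw σb R h l r p)⁺ + ε :=
        posPart_sub_tanhStep_le hq hfix hslope (isPSDKernel_gpk_tanh hpsd l r) (hK0 r) hε (hKε r) p
    _ ≤ damping σb q p * ((q - gpk A Real.tanh σw σb R h l 0 p)⁺ + r * ε) + ε := by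
        gcongr
        · exact damping_nonneg hq hfix p
        · exact posPart_sub_gpk_tanh_le hpsd hq hfix hslope hK0 hε hKε r p
    _ ≤ damping σb q p * (q - gpk A Real.tanh σw σb R h l 0 p)⁺ + (r + 1) * ε := by
        linarith [mul_le_of_le_one_left hrε (damping_le_one (σb := σb) hq p)]

end singlePropagation

theorem decaysExponentially_posPart_sub_gpk_tanh [Nonempty V]
    (hpsd : ∀ K, IsPSDKernel K → IsPSDKernel (A *ᵥ K)) (hA : A ∈ rowStochastic ℝ (V × V))
    (hprim : A.IsPrimitive) (hR : 0 < R) (hq : 0 < q)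
    (hfix : σw ^ 2 * tanhVariance q + σb ^ 2 = q) (hslope : σw ^ 2 * tanhSlope q = 1)
    {ε : ℕ → ℝ} (hε0 : ∀ l, 0 ≤ ε l) (hε : DecaysExponentially ε)
    (hKε : ∀ l r p, gpk A Real.tanh σw σb R h l r p ≤ q + ε l)
    (hK0 : ∀ᶠ l in atTop, ∀ r p, 0 ≤ gpk A Real.tanh σw σb R h l r p) :
    DecaysExponentially fun l p => (q - gpk A Real.tanh σw σb R h l 0 p)⁺ := by
  obtain ⟨L, hL⟩ := eventually_atTop.1 hK0
  obtain ⟨n, rfl⟩ := Nat.exists_eq_add_of_le' hR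
  obtain ⟨u⟩ := ‹Nonempty V›
  set y : ℕ → V × V → ℝ := fun l p => (q - gpk A Real.tanh σw σb (n + 1) h (l + L) 0 p)⁺
  have hy0 (l : ℕ) (p : V × V) : 0 ≤ y l p := posPart_nonneg _
  refine .of_comp_add_nat (k := L) <| decaysExponentially_of_damped_iteration hA hprim (y := y)
    (z := fun l p => damping σb q p * y l p) (e := fun l => (n + 1) * ε (l + L))
    (contractionRate_nonneg hq hfix) (contractionRate_lt_one hq (sq_bias_pos hq hfix hslope)) hy0
    (fun l p => mul_le_of_le_one_left (hy0 l p) (damping_le_one hq p))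
    (fun l => ⟨(u, u), ?_⟩) (.const_mul _ (hε.comp_add_nat L)) fun l p => ?_
  · rw [damping_diag]
    exact mul_le_mul_of_nonneg_left ((Real.le_norm_self _).trans (norm_le_pi_norm (y l) (u, u)))
      (contractionRate_nonneg hq hfix)
  · have hlayers := mulVec_mono hA.1 (posPart_sub_gpk_tanh_succ_le hpsd hq hfix hslope
      (hL (l + L) (Nat.le_add_left L l)) (hε0 (l + L)) (hKε (l + L)) n) p
    have hpropagate := posPart_sub_mulVec_le (q := q) hA
      (gpk A Real.tanh σw σb (n + 1) h (l + L) (n + 1)) p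
    simp only [y, Nat.add_right_comm l 1 L, gpk_succ_zero]
    have hconst : (A *ᵥ fun p => damping σb q p * y l p + (n + 1) * ε (l + L)) p =
        (A *ᵥ fun p => damping σb q p * y l p) p + (n + 1) * ε (l + L) := by
      have := congrFun (mulVec_add A (fun p => damping σb q p * y l p)
        fun _ => (n + 1) * ε (l + L)) p
      rwa [mulVec_const hA] at this
    exact hpropagate.trans (hlayers.trans_eq hconst)

theorem decaysExponentially_gpk_tanh_sub [Nonempty V]
    (hpsd : ∀ K, IsPSDKernel K → IsPSDKernel (A *ᵥ K)) (hA : A ∈ rowStochastic ℝ (V × V))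
    (hprim : A.IsPrimitive) (hR : 0 < R) (hq : 0 < q)
    (hfix : σw ^ 2 * tanhVariance q + σb ^ 2 = q) (hslope : σw ^ 2 * tanhSlope q = 1)
    (r : ℕ) (p : V × V) :
    DecaysExponentially fun l => gpk A Real.tanh σw σb R h l r p - q := by
  obtain ⟨ε₀, hε₀, hup⟩ := exists_gpk_tanh_le (h := h) hpsd hA hR hq hfix
  have hb := sq_bias_pos hq hfix hslope
  set β := contractionRate σb q
  have hβ0 : 0 ≤ β := contractionRate_nonneg hq hfix
  have hβ1 : β < 1 := contractionRate_lt_one hq hb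
  have hε0 (l : ℕ) : 0 ≤ ε₀ * β ^ l := by positivity
  have hε : DecaysExponentially fun l => ε₀ * β ^ l :=
    .const_mul ε₀ (.pow hβ0 hβ1)
  have hnonneg : ∀ᶠ l in atTop, ∀ r p, 0 ≤ gpk A Real.tanh σw σb R h l r p :=
    eventually_gpk_tanh_nonneg hpsd hA hR hb (B := q + ε₀) (by positivity) fun l r p =>
      (hup l r p).trans (by
        gcongr
        exact mul_le_of_le_one_right hε₀ (pow_le_one₀ hβ0 hβ1.le))
  have hdeficit := decaysExponentially_pi_iff.1 (decaysExponentially_posPart_sub_gpk_tanh hpsd hA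
    hprim hR hq hfix hslope hε0 hε hup hnonneg) p
  refine (hdeficit.add (hε.const_mul (r + 1))).of_norm_le ?_
  filter_upwards [hnonneg] with l hl
  have hlow := (le_posPart _).trans
    (posPart_sub_gpk_tanh_le hpsd hq hfix hslope hl (hε0 l) (hup l) r p)
  have hrε : 0 ≤ r * (ε₀ * β ^ l) := by positivity
  have hdef0 := posPart_nonneg (q - gpk A Real.tanh σw σb R h l 0 p)
  rw [Real.norm_eq_abs, abs_le]
  constructor <;> linarith [hup l r p, hε0 l]

theorem exists_gntk_tanh_asymptotics [Nonempty V] (hchaos : IsEdgeOfChaos Real.tanh σw σb)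
    (hpsd : ∀ K, IsPSDKernel K → IsPSDKernel (A *ᵥ K)) (hA : A ∈ rowStochastic ℝ (V × V))
    (hprim : A.IsPrimitive) {π : V × V → ℝ} (hπ : IsStationaryDistribution A π) :
    ∃ α C : ℝ, 0 < α ∧ α < 1 ∧ 0 < C ∧
      ∃ v : V × V → ℝ, ∀ r ≤ R, ∃ v' : V × V → ℝ, ∀ (l : ℕ) (u u' : V),
        |gntk A Real.tanh σw σb R h l r (u, u') - π ⬝ᵥ (((R : ℝ) * (l : ℝ)) • v + v')| ≤
          C * α ^ l := by
  obtain ⟨q, hq, hfix, hslope⟩ := hchaos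
  have hgpk (hR : 0 < R) :=
    decaysExponentially_gpk_tanh_sub (h := h) hpsd hA hprim hR hq hfix hslope
  refine exists_gntk_asymptotics hA hprim hπ (q := q) (fun r hr p => hgpk (pos_of_gt hr) (r + 1) p)
    fun r hr p => ?_
  have hK := hgpk (pos_of_gt hr) r
  refine (((hK (p.1, p.1)).norm.add ((hK (p.2, p.2)).norm.add (hK p).norm)).const_mul
    (σw ^ 2 * (4 / √q + 8))).of_norm_le (.of_forall fun l => ?_)
  have hKl := isPSDKernel_gpk_tanh (σw := σw) (σb := σb) (R := R) (h := h) hpsd l r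
  have h0 := norm_nonneg (gpk A Real.tanh σw σb R h l r (p.1, p.1) - q)
  have h1 := norm_nonneg (gpk A Real.tanh σw σb R h l r (p.2, p.2) - q)
  have h2 := norm_nonneg (gpk A Real.tanh σw σb R h l r p - q)
  rw [gpkDeriv, hKl.gaussianPairing_eq, Real.norm_eq_abs]
  refine (hKl.isCovariance p.1 p.2).abs_pairing_deriv_tanh_sub_one_le hq hslope ?_ ?_ ?_ <;>
    rw [← Real.norm_eq_abs] <;> linarith

end TanhKernel

end GNTK

theorem theorem2 {V : Type*} [Fintype V] [DecidableEq V] [Nonempty V]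
    (G : SimpleGraph V) [DecidableRel G.Adj]
    (hirr : (GNTK.aggregation G).IsIrreducible)
    (δ : ℝ) (hδ0 : 0 < δ) (hδ1 : δ < 1)
    (φ : ℝ → ℝ) (hφ : φ = GNTK.relu ∨ φ = Real.tanh)
    (σw σb : ℝ) (hchaos : GNTK.IsEdgeOfChaos φ σw σb)
    (R d : ℕ) (h : V → EuclideanSpace ℝ (Fin d)) :
    GNTK.residualAggregation G δ ∈ rowStochastic ℝ (V × V) ∧
    (∃! π : V × V → ℝ, GNTK.IsStationaryDistribution (GNTK.residualAggregation G δ) π) ∧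
    (∀ π : V × V → ℝ, GNTK.IsStationaryDistribution (GNTK.residualAggregation G δ) π →
      ∃ α C : ℝ, 0 < α ∧ α < 1 ∧ 0 < C ∧
        ∃ v : V × V → ℝ, ∀ r ≤ R, ∃ v' : V × V → ℝ, ∀ (l : ℕ) (u u' : V),
          |GNTK.gntk (GNTK.residualAggregation G δ) φ σw σb R h l r (u, u') -
            π ⬝ᵥ (((R : ℝ) * (l : ℝ)) • v + v')| ≤ C * α ^ l) ∧
    (Nontrivial V → ∃ lam lamRes : ℝ,
      GNTK.IsSecondLargestEigenvalue (GNTK.aggregation G) lam ∧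
      GNTK.IsSecondLargestEigenvalue (GNTK.residualAggregation G δ) lamRes ∧
      lamRes = (1 - δ) * lam + δ ∧ lam < lamRes ∧ lamRes < 1) := by
  have hA := GNTK.residualAggregation_mem_rowStochastic (G := G) hδ0.le hδ1.le
  have hprim := GNTK.residualAggregation_isPrimitive hirr hδ0.le hδ1
  have hpsd : ∀ K, GNTK.IsPSDKernel K → GNTK.IsPSDKernel (GNTK.residualAggregation G δ *ᵥ K) :=
    fun _ hK => hK.residualAggregation hδ0.le hδ1.le
  refine ⟨hA, GNTK.existsUnique_isStationaryDistribution hirr hδ0.le hδ1, fun π hπ => ?_,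
    fun _ => ?_⟩
  · rcases hφ with rfl | rfl
    · exact GNTK.exists_gntk_relu_asymptotics hchaos hpsd hA hprim hπ
    · exact GNTK.exists_gntk_tanh_asymptotics hchaos hpsd hA hprim hπ
  · obtain ⟨μ, hμ1, hμ⟩ := GNTK.exists_isSecondLargestEigenvalue_aggregation hirr
    exact ⟨μ, (1 - δ) * μ + δ, hμ, hμ.smul_add_smul_one (sub_pos.2 hδ1) δ, rfl,
      by nlinarith, by nlinarith⟩
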